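/- **Setting.** An instance of the (symmetric) Lovász Local Lemma (LLL) consists of independent real-valued random variables with given distributions and $n$ bad events, each a (measurable) event determined by the values of finitely many of the variables. Its dependency graph has the bad events as nodes, two distinct events being adjacent if they share a variable. In the randomized LOCAL model on this graph, the nodes compute and communicate with their neighbours in synchronous rounds, with no restriction on local computation or message size. A node initially knows only $n,d,p$, its incident edges (ports), its own bad event (the names and the distributions of its variables, and the values for which the event occurs) and its own private, independent random source. After some number of rounds each node terminates, is silent from then on, and outputs values for the variables of its event. The outputs solve the instance if nodes sharing a variable output the same value for it and the resulting assignment avoids all bad events. **Theorem.** For every $\delta>0$ there is $d_0$ such that for every $k\ge 1$ there is a constant $C$ (depending only on $\delta$ and $k$) with the following property. For all $n$, all $d\ge d_0$ and all $0<p<1$ with $p\le d^{-(10+\delta)}$ there is a randomized LOCAL algorithm such that, on every LLL instance with $n$ bad events, in which each bad event has probability at most $p$ and shares variables with at most $d$ others (and for every port numbering): 1. (worst-case complexity) every node always terminates within $C\max\{1,\log_{1/p} n\}$ rounds; 2. with probability at least $1-n^{-k}$ the outputs solve the instance and the number of rounds until termination, averaged over all nodes, is at most $C\max\{1,\log\log_{1/p}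 n\}$; 3. the expectation of this node average is also at most $C\max\{1,\log\log_{1/p} n\}$. That is, under the polynomial criterion $p=d^{-(10+\Omega(1))}$, $d=\omega(1)$, the LLL can be solved with high probability in LOCAL with $O(\log\log_{1/p} n)$ node-averaged and $O(\log_{1/p} n)$ worst-case round complexity. -/

import Mathlib

open MeasureTheory
open scoped ENNReal

/-! ### The LOCAL model -/

/-- A port numbering of a graph: every node `v` has ports `0, …, deg v - 1`, which are in bijection
with its neighbours. -/
structure PortNumbering {V : Type} (G : SimpleGraph V) where
  deg : V → ℕ
  nbr : ∀ v, Fin (deg v) ≃ G.neighborSet v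

/-- A (randomized) algorithm for the LOCAL model with node inputs in `I`, private random seeds in
`R` and node outputs in `O`. There is no restriction on the size of states and messages, nor on the
local computation. All nodes run the same algorithm and there are no identifiers.
* `init i k r` is the initial state of a node with input `i`, `k` incident edges and random seed `r`.
* `send s j` is the message that a node in state `s` sends through its port `j`.
* `recv s l` is the new state of a node in state `s` that receives the list `l` of messages, in port
  order; an entry is `none` if the corresponding neighbour is silent (it has terminated).
* `out s = some o` means that a node in state `s` terminates with output `o`. -/
structure LocalAlgorithm (I R O : Type) where
  State : Type
  Msg : Type
  init : I → ℕ → R → State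
  send : State → ℕ → Msg
  recv : State → List (Option Msg) → State
  out : State → Option O

namespace LocalAlgorithm

variable {I R O V : Type} {G : SimpleGraph V}

/-- The state of every node after `t` synchronous rounds. A node that has terminated keeps its state
and sends no further messages. -/
def state (A : LocalAlgorithm I R O) (P : PortNumbering G) (input : V → I) (seed : V → R) :
    ℕ → V → A.State
  | 0, v => A.init (input v) (P.deg v) (seed v)
  | t + 1, v =>
    let s := A.state P input seed t
    if (A.out (s v)).isSome then s v
    else A.recv (s v) (List.ofFn fun i : Fin (P.deg v) =>
      let u : G.neighborSet v := P.nbr v i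
      if (A.out (s u)).isSome then none
      else some (A.send (s u) ((P.nbr u).symm ⟨v, G.adj_symm u.2⟩ : Fin (P.deg u))))

/-- Node `v` terminates with output `o`. -/
def Outputs (A : LocalAlgorithm I R O) (P : PortNumbering G) (input : V → I) (seed : V → R)
    (v : V) (o : O) : Prop :=
  ∃ t, A.out (A.state P input seed t v) = some o

/-- The number of rounds until node `v` terminates (`⊤` if it never does). -/
noncomputable def rounds (A : LocalAlgorithm I R O) (P : PortNumbering G) (input : V → I)
    (seed : V → R) (v : V) : ℕ∞ :=
  ⨅ (t : ℕ) (_ : (A.out (A.state P input seed t v)).isSome), (t : ℕ∞)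

/-- The number of rounds until termination, averaged over all nodes. -/
noncomputable def averageRounds [Fintype V] (A : LocalAlgorithm I R O) (P : PortNumbering G)
    (input : V → I) (seed : V → R) : ℝ≥0∞ :=
  (∑ v, (A.rounds P input seed v : ℝ≥0∞)) / (Fintype.card V : ℝ≥0∞)

end LocalAlgorithm

/-- The private randomness of a node: an infinite sequence of numbers in `[0,1]`. -/
abbrev Seed : Type := ℕ → unitInterval

/-- The joint law of the private random seeds: all entries of all nodes are independent and
uniform on `[0,1]`. -/
noncomputable def seedMeasure (V : Type) [Fintype V] : Measure (V → Seed) :=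
  Measure.pi fun _ => Measure.infinitePi fun _ => (volume : Measure unitInterval)

/-! ### Instances of the Lovász Local Lemma -/

/-- The description of one bad event: the (names of the) variables it depends on, their
distributions, and the set of those values of these variables for which the event occurs. -/
structure EventSpec where
  vars : Finset ℕ
  law : vars → ProbabilityMeasure ℝ
  bad : Set (vars → ℝ)

/-- An instance with set of bad events `V`, over independent real random variables (named by natural
numbers), where variable `x` has distribution `law x`. -/
structure LLLInstance (V : Type) where
  law : ℕ → ProbabilityMeasure ℝ
  vars : V → Finset ℕ
  bad : ∀ v, Set (vars v → ℝ)
  measurableSet_bad : ∀ v, MeasurableSet (bad v)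

namespace LLLInstance

variable {V : Type}

/-- What node `v` knows initially: the description of its own bad event. -/
def spec (L : LLLInstance V) (v : V) : EventSpec where
  vars := L.vars v
  law := fun x => L.law x
  bad := L.bad v

/-- The probability that the bad event `v` occurs when the variables are sampled independently. -/
noncomputable def prob (L : LLLInstance V) (v : V) : ℝ≥0∞ :=
  Measure.pi (fun x : L.vars v => (L.law x : Measure ℝ)) (L.bad v)

/-- The dependency graph: distinct events are adjacent if they share a variable. -/
def dependencyGraph (L : LLLInstance V) : SimpleGraph V where
  Adj u v := u ≠ v ∧ ∃ x, x ∈ L.vars u ∧ x ∈ L.vars v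
  symm := ⟨fun _ _ h => ⟨h.1.symm, h.2.imp fun _ hx => ⟨hx.2, hx.1⟩⟩⟩
  loopless := ⟨fun _ h => h.1 rfl⟩

/-- Every bad event has probability at most `p` and shares variables with at most `d` others. -/
def Bounded (L : LLLInstance V) (p : ℝ) (d : ℕ) : Prop :=
  ∀ v, L.prob v ≤ ENNReal.ofReal p ∧ (L.dependencyGraph.neighborSet v).ncard ≤ d

/-- A run of `A` on the dependency graph solves the instance: every node terminates, the values that
the nodes output for their own variables are consistent, that is, they form one assignment `a`, and
`a` avoids all bad events. (Only the values that `v` outputs for variables of `v` matter.) -/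
def SolvedBy (L : LLLInstance V) (A : LocalAlgorithm EventSpec Seed (ℕ → ℝ))
    (P : PortNumbering L.dependencyGraph) (seed : V → Seed) : Prop :=
  ∃ a : ℕ → ℝ, ∀ v,
    (∃ o, A.Outputs P L.spec seed v o ∧ ∀ x ∈ L.vars v, o x = a x) ∧
    (fun x : L.vars v => a x) ∉ L.bad v

end LLLInstance

/-! Sample all variables. Relative to a set S of active events, an event is dangerous if its
conditional probability exceeds θ = 1/(8d) once all variables of neighbours of S are freed for
resampling. Starting with nothing active, activate in each step the dangerous events that are
minimal, in a fixed well-order, among their dangerous neighbours. An active event and its neighbours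
have all their variables freed, so their probability is back to at most p ≤ θ. Hence active events
share no variables, and in the end nothing is dangerous (`not_danger_active`). The local lemma then
completes the freed variables (`exists_avoiding`, `exists_solves`). Clusters of active events,
linked at distance at most 4, can be completed independently (`result_notMem_occurs`).

Large clusters are rare. By Markov, an event is dangerous for a fixed S with probability at most p/θ
= 8dp, and independently for events without common variables. A union bound over connected sets
(about d^4 per event, `sum_connectedFrom_le`) and over the ways in which activation times order
nearby members (about d^4 per event, `exists_patterns`) is affordable because dp ≤ d^(-9). With z =
p^(1/50), a cluster of size at least s at a given event has probability at most z^s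
(`unif_cascade_le`). So with high probability all clusters have size at most M = O(log_{1/p} n), and
O(M) rounds suffice.

For the node average, an event is suspect if some good world that agrees with its surroundings puts
it into a cluster of size at least s = Θ(log M). A node with no suspect event nearby stops after
O(log M) rounds; the others run for O(M) rounds. Stopped nodes relay nothing, so a waiting node
learns only what travels through uncertified events, and it completes its knowledge by an arbitrary
good world. By `result_eq_of_agreeFrom` the choice is irrelevant: a cluster either consists of
suspect events, and is then surrounded by running nodes, or has fewer than s events and fits into a
small ball. Suspicion is rare as well: a slowly growing layer of the hypothetical cluster yields a
cascade in the actual world (`mem_cascade_of_suspect`). The expected fraction of waiting nodes is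
therefore O(1/M), which costs O(1) rounds on average. A moment bound for locally dependent events
(`unif_le_occurring`) makes this hold with high probability once log_{1/p} n is large; otherwise the
worst-case bound is already constant.

There are no identifiers, so nodes sharing a variable agree on its sample through a symmetric
function of their private numbers, `pooled`. -/

namespace LLLProof

/-! ### Resampling and independence for a product of uniform laws. -/

/-- Assignments of uniform random numbers to the variables. -/
abbrev Assignment := ℕ → unitInterval

/-- The law of independent uniform numbers. -/
noncomputable def unif : Measure Assignment := Measure.infinitePi fun _ => volume

instance : IsProbabilityMeasure unif := by unfold unif; infer_instance

/-- The assignment that agrees with `z` on `D` and with `u` off `D`. -/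
noncomputable def splice (D : Set ℕ) (z u : Assignment) : Assignment :=
  open Classical in fun x => if x ∈ D then z x else u x

lemma splice_of_mem {D : Set ℕ} {z u : Assignment} {x : ℕ} (h : x ∈ D) : splice D z u x = z x := by
  simp [splice, h]

lemma splice_of_notMem {D : Set ℕ} {z u : Assignment} {x : ℕ} (h : x ∉ D) :
    splice D z u x = u x := by
  simp [splice, h]

lemma measurable_splice (D : Set ℕ) :
    Measurable fun q : Assignment × Assignment => splice D q.1 q.2 := by
  refine measurable_pi_lambda _ fun x => ?_
  by_cases h : x ∈ D
  · simp only [splice_of_mem h]; fun_prop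
  · simp only [splice_of_notMem h]; fun_prop

/-- Mixing two independent samples along a fixed coordinate set gives a sample again, as one checks
on boxes. Both independence and the averaging of `resampled` come from this. -/
lemma map_splice (D : Set ℕ) :
    (unif.prod unif).map (fun q => splice D q.1 q.2) = unif := by
  classical
  refine Measure.eq_infinitePi _ fun s t ht => ?_
  rw [Measure.map_apply (measurable_splice D) (.pi s.countable_toSet fun i _ => ht i)]
  have : (fun q : Assignment × Assignment => splice D q.1 q.2) ⁻¹' (Set.pi s t) =
      (Set.pi (s.filter (· ∈ D) : Finset ℕ) t) ×ˢ (Set.pi (s.filter (· ∉ D) : Finset ℕ) t) := by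
    ext q
    simp only [Set.mem_preimage, Set.mem_pi, Set.mem_prod, Finset.coe_filter, Set.mem_ofPred_eq,
      Finset.mem_coe]
    constructor
    · intro h
      exact ⟨fun x hx => by simpa [splice_of_mem hx.2] using h x hx.1,
        fun x hx => by simpa [splice_of_notMem hx.2] using h x hx.1⟩
    · intro h x hx
      by_cases hD : x ∈ D
      · simpa [splice_of_mem hD] using h.1 x ⟨hx, hD⟩
      · simpa [splice_of_notMem hD] using h.2 x ⟨hx, hD⟩
  rw [this, Measure.prod_prod, unif, Measure.infinitePi_pi _ fun i _ => ht i,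
    Measure.infinitePi_pi _ fun i _ => ht i, Finset.prod_filter_mul_prod_filter_not]

/-- Membership in `C` is determined by the coordinates in `T`. -/
def DeterminedBy (C : Set Assignment) (T : Set ℕ) : Prop :=
  ∀ u u' : Assignment, (∀ x ∈ T, u x = u' x) → (u ∈ C ↔ u' ∈ C)

lemma DeterminedBy.mono {C : Set Assignment} {T T' : Set ℕ} (h : DeterminedBy C T) (hT : T ⊆ T') :
    DeterminedBy C T' := fun u u' hu => h u u' fun x hx => hu x (hT hx)

lemma DeterminedBy.compl {C : Set Assignment} {T : Set ℕ} (h : DeterminedBy C T) :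
    DeterminedBy Cᶜ T := fun u u' hu => not_congr (h u u' hu)

lemma DeterminedBy.biInter {ι : Type*} {s : Set ι} {C : ι → Set Assignment} {T : Set ℕ}
    (h : ∀ i ∈ s, DeterminedBy (C i) T) : DeterminedBy (⋂ i ∈ s, C i) T := by
  intro u u' hu
  simp only [Set.mem_iInter]
  exact forall₂_congr fun i hi => h i hi u u' hu

lemma DeterminedBy.biUnion {ι : Type*} {s : Set ι} {C : ι → Set Assignment} {T : Set ℕ}
    (h : ∀ i ∈ s, DeterminedBy (C i) T) : DeterminedBy (⋃ i ∈ s, C i) T := by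
  intro u u' hu
  simp only [Set.mem_iUnion, exists_prop]
  exact exists_congr fun i => and_congr_right fun hi => h i hi u u' hu

/-- Pulled back along `splice T`, the intersection becomes a rectangle in the product of two copies.
-/
lemma unif_inter {C C' : Set Assignment} {T T' : Set ℕ} (hC : MeasurableSet C)
    (hC' : MeasurableSet C') (hT : DeterminedBy C T) (hT' : DeterminedBy C' T')
    (hd : Disjoint T T') : unif (C ∩ C') = unif C * unif C' := by
  rw [← map_splice T, Measure.map_apply (measurable_splice T) (hC.inter hC'), map_splice,
    ← Measure.prod_prod]
  congr 1
  ext q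
  refine and_congr (hT _ _ fun x hx => splice_of_mem hx) (hT' _ _ fun x hx => splice_of_notMem ?_)
  exact fun h => Set.disjoint_left.1 hd h hx

lemma unif_biInter {ι : Type*} (s : Finset ι) (C : ι → Set Assignment) (T : ι → Set ℕ)
    (hC : ∀ i ∈ s, MeasurableSet (C i)) (hT : ∀ i ∈ s, DeterminedBy (C i) (T i))
    (hd : (s : Set ι).PairwiseDisjoint T) : unif (⋂ i ∈ s, C i) = ∏ i ∈ s, unif (C i) := by
  classical
  induction s using Finset.induction_on with
  | empty => simp
  | insert a s ha ih =>
    rw [Finset.set_biInter_insert, Finset.prod_insert ha, ← ih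
      (fun i hi => hC i (Finset.mem_insert_of_mem hi))
      (fun i hi => hT i (Finset.mem_insert_of_mem hi))
      (hd.subset (by simp))]
    refine unif_inter (T' := ⋃ i ∈ s, T i) (hC a (Finset.mem_insert_self a s))
      (.biInter s.countable_toSet fun i hi => hC i (Finset.mem_insert_of_mem hi))
      (hT a (Finset.mem_insert_self a s)) (DeterminedBy.biInter fun i hi =>
        (hT i (Finset.mem_insert_of_mem hi)).mono (Set.subset_biUnion_of_mem hi)) ?_
    simp only [Set.disjoint_iUnion_right]
    exact fun i hi => hd (by simp) (by simp [hi]) (by rintro rfl; exact ha hi)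

/-- The conditional probability of `C` when the coordinates in `D` are resampled. -/
noncomputable def resampled (D : Set ℕ) (C : Set Assignment) (u : Assignment) : ℝ≥0∞ :=
  unif {z | splice D z u ∈ C}

lemma measurable_resampled (D : Set ℕ) {C : Set Assignment} (hC : MeasurableSet C) :
    Measurable (resampled D C) :=
  measurable_measure_prodMk_right (measurable_splice D hC)

lemma lintegral_resampled (D : Set ℕ) {C : Set Assignment} (hC : MeasurableSet C) :
    ∫⁻ u, resampled D C u ∂unif = unif C := by
  conv_rhs => rw [← map_splice D, Measure.map_apply (measurable_splice D) hC,
    Measure.prod_apply_symm (measurable_splice D hC)]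
  rfl

/-- Markov's inequality, since the resampled probability averages to that of `C`. For fixed `D` it
bounds the probability of danger by p/θ. -/
lemma unif_lt_resampled_le (D : Set ℕ) {C : Set Assignment} (hC : MeasurableSet C) {θ : ℝ≥0∞}
    (h0 : θ ≠ 0) (h1 : θ ≠ ∞) : unif {u | θ < resampled D C u} ≤ unif C / θ := by
  rw [← lintegral_resampled D hC]
  have hsub : {u | θ < resampled D C u} ⊆ {u | θ ≤ resampled D C u} := by
    intro u hu
    simp only [Set.mem_ofPred_eq] at hu ⊢
    exact hu.le
  exact (measure_mono hsub).trans
    (meas_ge_le_lintegral_div (measurable_resampled D hC).aemeasurable h0 h1)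

lemma resampled_congr {D D' : Set ℕ} {C : Set Assignment} {T : Set ℕ} {u u' : Assignment}
    (hC : DeterminedBy C T) (hD : ∀ x ∈ T, x ∈ D ↔ x ∈ D') (hu : ∀ x ∈ T, u x = u' x) :
    resampled D C u = resampled D' C u' := by
  unfold resampled
  congr 1
  ext z
  refine hC _ _ fun x hx => ?_
  by_cases h : x ∈ D
  · rw [splice_of_mem h, splice_of_mem ((hD x hx).1 h)]
  · rw [splice_of_notMem h, splice_of_notMem (mt (hD x hx).2 h), hu x hx]

/-- Freeing every variable of an event erases what the sample says about it. This is what stops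
activation next to an active event. -/
lemma resampled_of_subset {D : Set ℕ} {C : Set Assignment} {T : Set ℕ}
    (hC : DeterminedBy C T) (hD : T ⊆ D) (u : Assignment) : resampled D C u = unif C := by
  unfold resampled
  congr 1
  ext z
  exact hC _ _ fun x hx => splice_of_mem (hD hx)

lemma determinedBy_lt_resampled {D : Set ℕ} {C : Set Assignment} {T : Set ℕ}
    (hC : DeterminedBy C T) (θ : ℝ≥0∞) : DeterminedBy {u | θ < resampled D C u} T := by
  intro u u' hu
  simp only [Set.mem_ofPred_eq]
  rw [resampled_congr hC (fun _ _ => Iff.rfl) hu]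

lemma determinedBy_splice {D : Set ℕ} {C : Set Assignment} {T : Set ℕ}
    (hC : DeterminedBy C T) (u : Assignment) : DeterminedBy {z | splice D z u ∈ C} T := by
  intro z z' h
  refine hC _ _ fun x hx => ?_
  by_cases hD : x ∈ D
  · rw [splice_of_mem hD, splice_of_mem hD, h x hx]
  · rw [splice_of_notMem hD, splice_of_notMem hD]

lemma measurableSet_splice (D : Set ℕ) {C : Set Assignment} (hC : MeasurableSet C)
    (u : Assignment) : MeasurableSet {z | splice D z u ∈ C} :=
  (measurable_splice D).comp (measurable_id.prodMk measurable_const) hC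

/-! ### The symmetric Lovász Local Lemma. -/

section LocalLemma

variable {ι : Type*} {s : Finset ι} {C : ι → Set Assignment} {T : ι → Finset ℕ} {θ : ℝ} {d : ℕ}

-- The usual induction on the number of avoided events, in product form so that nothing is
-- conditioned on an event of probability zero.
open Classical in
lemma unif_inter_avoid_le (hC : ∀ i ∈ s, MeasurableSet (C i))
    (hT : ∀ i ∈ s, DeterminedBy (C i) (T i)) (hθ : ∀ i ∈ s, unif.real (C i) ≤ θ) (h0 : 0 ≤ θ)
    (hd : ∀ i ∈ s, (s.filter fun j => j ≠ i ∧ ¬ Disjoint (T i) (T j)).card ≤ d)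
    (h4 : 4 * θ * d ≤ 1) (n : ℕ) : ∀ S ⊆ s, S.card ≤ n → ∀ i ∈ s, i ∉ S →
      unif.real (C i ∩ ⋂ j ∈ S, (C j)ᶜ) ≤ 2 * θ * unif.real (⋂ j ∈ S, (C j)ᶜ) := by
  induction n with
  | zero =>
    intro S hS hn i hi _
    obtain rfl : S = ∅ := by simpa using hn
    simp only [Finset.notMem_empty, Set.iInter_of_empty, Set.iInter_univ, Set.inter_univ,
      probReal_univ]
    linarith [hθ i hi]
  | succ n ih =>
    intro S hS hn i hi hiS
    set S₁ := S.filter fun j => ¬ Disjoint (T i) (T j) with hS₁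
    set S₂ := S.filter fun j => Disjoint (T i) (T j) with hS₂
    have hmeas : ∀ S' ⊆ s, MeasurableSet (⋂ j ∈ S', (C j)ᶜ) := fun S' hS' =>
      .biInter S'.countable_toSet fun j hj => (hC j (hS' hj)).compl
    have h₂s : S₂ ⊆ s := (Finset.filter_subset _ _).trans hS
    have hind : unif.real (C i ∩ ⋂ j ∈ S₂, (C j)ᶜ) =
        unif.real (C i) * unif.real (⋂ j ∈ S₂, (C j)ᶜ) := by
      have := unif_inter (T' := ⋃ j ∈ S₂, (T j : Set ℕ)) (hC i hi) (hmeas S₂ h₂s) (hT i hi)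
        (DeterminedBy.biInter fun j hj =>
          (hT j (h₂s hj)).compl.mono (Set.subset_biUnion_of_mem (u := fun j => (T j : Set ℕ)) hj))
        (by
          simp only [Set.disjoint_iUnion_right, Finset.disjoint_coe]
          exact fun j hj => (Finset.mem_filter.1 hj).2)
      simp [Measure.real, this]
    have hsub : (⋂ j ∈ S, (C j)ᶜ) ⊆ ⋂ j ∈ S₂, (C j)ᶜ :=
      Set.biInter_subset_biInter_left (Finset.filter_subset _ _)
    have h1 : unif.real (C i ∩ ⋂ j ∈ S, (C j)ᶜ) ≤ θ * unif.real (⋂ j ∈ S₂, (C j)ᶜ) :=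
      (measureReal_mono (Set.inter_subset_inter_right _ hsub)).trans
        (hind.le.trans (mul_le_mul_of_nonneg_right (hθ i hi) measureReal_nonneg))
    -- Without neighbours in `S` independence suffices; otherwise `S₂` is smaller than `S` and the
    -- induction hypothesis applies to it.
    by_cases hS1 : S₁ = ∅
    · have : S₂ = S := by
        rw [hS₂, Finset.filter_eq_self]
        intro j hj
        by_contra h
        exact Finset.notMem_empty j (hS1 ▸ Finset.mem_filter.2 ⟨hj, h⟩)
      rw [this] at h1
      nlinarith [measureReal_nonneg (μ := unif) (s := ⋂ j ∈ S, (C j)ᶜ)]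
    · obtain ⟨a, ha⟩ := Finset.nonempty_iff_ne_empty.2 hS1
      have hlt : S₂.card < S.card := by
        refine Finset.card_lt_card ⟨Finset.filter_subset _ _, fun h => ?_⟩
        exact (Finset.mem_filter.1 ha).2 (Finset.mem_filter.1 (h (Finset.mem_filter.1 ha).1)).2
      have hcover : (⋂ j ∈ S₂, (C j)ᶜ) ⊆
          (⋂ j ∈ S, (C j)ᶜ) ∪ ⋃ k ∈ S₁, (C k ∩ ⋂ j ∈ S₂, (C j)ᶜ) := by
        intro u hu
        by_cases h : u ∈ ⋂ j ∈ S, (C j)ᶜ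
        · exact Or.inl h
        · right
          simp only [Set.mem_iInter, not_forall] at h
          obtain ⟨k, hk, hku⟩ := h
          have hk1 : k ∈ S₁ := by
            refine Finset.mem_filter.2 ⟨hk, fun hdis => hku ?_⟩
            exact Set.mem_iInter₂.1 hu k (Finset.mem_filter.2 ⟨hk, hdis⟩)
          exact Set.mem_iUnion₂.2 ⟨k, hk1, by simpa using hku, hu⟩
      have hsum : unif.real (⋂ j ∈ S₂, (C j)ᶜ) ≤ unif.real (⋂ j ∈ S, (C j)ᶜ) +
          ∑ k ∈ S₁, unif.real (C k ∩ ⋂ j ∈ S₂, (C j)ᶜ) :=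
        (measureReal_mono hcover).trans ((measureReal_union_le _ _).trans
          (add_le_add le_rfl (measureReal_biUnion_finset_le _ _)))
      have hcard : (S₁.card : ℝ) ≤ d := by
        refine Nat.cast_le.2 ((Finset.card_le_card fun j hj => ?_).trans (hd i hi))
        obtain ⟨hj1, hj2⟩ := Finset.mem_filter.1 hj
        exact Finset.mem_filter.2 ⟨hS hj1, by rintro rfl; exact hiS hj1, hj2⟩
      have hterm : ∑ k ∈ S₁, unif.real (C k ∩ ⋂ j ∈ S₂, (C j)ᶜ) ≤
          S₁.card * (2 * θ * unif.real (⋂ j ∈ S₂, (C j)ᶜ)) := by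
        rw [← nsmul_eq_mul]
        refine Finset.sum_le_card_nsmul _ _ _ fun k hk => ?_
        obtain ⟨hk1, hk2⟩ := Finset.mem_filter.1 hk
        exact ih S₂ h₂s (by omega) k (hS hk1) fun h => hk2 (Finset.mem_filter.1 h).2
      -- The neighbours remove at most 2θd·X ≤ X/2 from `X`, so `X` is at most twice the probability
      -- of avoiding `S`.
      set X := unif.real (⋂ j ∈ S₂, (C j)ᶜ)
      have hX : 0 ≤ X := measureReal_nonneg
      have : (S₁.card : ℝ) * (2 * θ * X) ≤ d * (2 * θ * X) := by gcongr
      nlinarith [mul_nonneg h0 hX]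

open Classical in
/-- The symmetric Lovász Local Lemma. -/
theorem exists_avoiding (hC : ∀ i ∈ s, MeasurableSet (C i))
    (hT : ∀ i ∈ s, DeterminedBy (C i) (T i)) (hθ : ∀ i ∈ s, unif.real (C i) ≤ θ) (h0 : 0 ≤ θ)
    (hd : ∀ i ∈ s, (s.filter fun j => j ≠ i ∧ ¬ Disjoint (T i) (T j)).card ≤ d)
    (h4 : 4 * θ * d ≤ 1) (h2 : 2 * θ < 1) : ∃ z, ∀ i ∈ s, z ∉ C i := by
  have key : ∀ S ⊆ s, 0 < unif.real (⋂ j ∈ S, (C j)ᶜ) := by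
    intro S
    induction S using Finset.induction_on with
    | empty => intro _; simp
    | insert a S ha ih =>
      intro hS
      have hS' : S ⊆ s := (Finset.subset_insert _ _).trans hS
      have h1 := unif_inter_avoid_le hC hT hθ h0 hd h4 S.card S hS' le_rfl a
        (hS (Finset.mem_insert_self _ _)) ha
      have h3 := ih hS'
      have hcov : (⋂ j ∈ S, (C j)ᶜ) ⊆ (⋂ j ∈ insert a S, (C j)ᶜ) ∪ (C a ∩ ⋂ j ∈ S, (C j)ᶜ) := by
        intro u hu
        rw [Finset.set_biInter_insert]
        by_cases h : u ∈ C a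
        · exact Or.inr ⟨h, hu⟩
        · exact Or.inl ⟨h, hu⟩
      have h4 := (measureReal_mono (μ := unif) hcov).trans (measureReal_union_le _ _)
      nlinarith
  obtain ⟨z, hz⟩ := nonempty_of_measure_ne_zero (μ := unif) (s := ⋂ j ∈ s, (C j)ᶜ) (by
    have := key s subset_rfl
    intro h
    simp [Measure.real, h] at this)
  exact ⟨z, fun i hi => Set.mem_iInter₂.1 hz i hi⟩

end LocalLemma

/-! ### Bad events as events about uniform numbers, and worlds. -/

/-- A map that turns a uniform random number into one with law `ν`. -/
noncomputable def quantile (ν : ProbabilityMeasure ℝ) : unitInterval → ℝ :=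
  (Measure.exists_measurable_map_eq (ν : Measure ℝ)).choose

lemma measurable_quantile (ν : ProbabilityMeasure ℝ) : Measurable (quantile ν) :=
  (Measure.exists_measurable_map_eq (ν : Measure ℝ)).choose_spec.1

lemma map_quantile (ν : ProbabilityMeasure ℝ) : volume.map (quantile ν) = ν :=
  (Measure.exists_measurable_map_eq (ν : Measure ℝ)).choose_spec.2

/-- The bad event of `e` in terms of the uniform random numbers. -/
def occurs (e : EventSpec) : Set Assignment :=
  {u | (fun x : e.vars => quantile (e.law x) (u x)) ∈ e.bad}

lemma determinedBy_occurs (e : EventSpec) : DeterminedBy (occurs e) e.vars := by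
  intro u u' h
  have : (fun x : e.vars => quantile (e.law x) (u x)) =
      fun x : e.vars => quantile (e.law x) (u' x) := by
    funext x
    rw [h x x.2]
  simp only [occurs, Set.mem_ofPred_eq, this]

/-- Finitely many events together with uniform numbers for all variables. -/
structure World where
  events : Finset EventSpec
  val : Assignment

/-- The parameters of the analysis: the bound `d` on the number of neighbours, the bound `p` on the
probabilities, and the threshold `θ` above which an event is regarded as dangerous. -/
structure Params where
  d : ℕ
  p : ℝ≥0∞
  θ : ℝ≥0∞
  p_le : p ≤ θ
  pos : 0 < θ
  lll : 4 * θ.toReal * d ≤ 1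
  half : 2 * θ.toReal < 1
  ne_top : θ ≠ ∞

open scoped Classical

namespace World

/-- The closed neighbourhood of `e`. -/
noncomputable def nb (W : World) (e : EventSpec) : Finset EventSpec :=
  W.events.filter fun g => g = e ∨ ¬ Disjoint e.vars g.vars

/-- The ball of radius `r` around `e`. -/
noncomputable def ball (W : World) : ℕ → EventSpec → Finset EventSpec
  | 0, e => {e}
  | r + 1, e => (W.ball r e).biUnion W.nb

/-- The variables of the neighbours of events in `S`. -/
def freed (W : World) (S : Finset EventSpec) : Set ℕ :=
  {x | ∃ f ∈ S, ∃ g ∈ W.nb f, x ∈ g.vars}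

/-! ### Distance balls and agreement of worlds on them. -/

section Ball

variable {W W' : World} {e f g : EventSpec} {r r' : ℕ}

lemma mem_nb : g ∈ W.nb e ↔ g ∈ W.events ∧ (g = e ∨ ¬ Disjoint e.vars g.vars) := by
  simp [nb]

lemma self_mem_nb (h : e ∈ W.events) : e ∈ W.nb e := mem_nb.2 ⟨h, .inl rfl⟩

lemma mem_nb_comm (he : e ∈ W.events) (h : g ∈ W.nb e) : e ∈ W.nb g :=
  mem_nb.2 ⟨he, (mem_nb.1 h).2.imp Eq.symm fun h => by rwa [disjoint_comm]⟩

lemma mem_nb_of_mem {x : ℕ} (hg : g ∈ W.events) (hx : x ∈ e.vars) (hx' : x ∈ g.vars) :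
    g ∈ W.nb e :=
  mem_nb.2 ⟨hg, .inr fun h => Finset.disjoint_left.1 h hx hx'⟩

lemma mem_ball_zero : f ∈ W.ball 0 e ↔ f = e := by simp [ball]

lemma mem_ball_succ : f ∈ W.ball (r + 1) e ↔ ∃ g ∈ W.ball r e, f ∈ W.nb g := by simp [ball]

lemma mem_ball_one : f ∈ W.ball 1 e ↔ f ∈ W.nb e := by
  simp [mem_ball_succ (r := 0), mem_ball_zero]

lemma ball_subset_events (he : e ∈ W.events) : W.ball r e ⊆ W.events := by
  cases r with
  | zero => simpa [ball] using he
  | succ r =>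
    intro f hf
    obtain ⟨g, -, h⟩ := mem_ball_succ.1 hf
    exact (mem_nb.1 h).1

lemma self_mem_ball (he : e ∈ W.events) : e ∈ W.ball r e := by
  induction r with
  | zero => simp [ball]
  | succ r ih => exact mem_ball_succ.2 ⟨e, ih, self_mem_nb he⟩

lemma mem_ball_add : f ∈ W.ball (r + r') e ↔ ∃ g ∈ W.ball r e, f ∈ W.ball r' g := by
  induction r' generalizing f with
  | zero => simp [mem_ball_zero]
  | succ r' ih =>
    rw [← add_assoc, mem_ball_succ]
    simp only [ih, mem_ball_succ]
    aesop

lemma ball_mono (he : e ∈ W.events) (h : r ≤ r') : W.ball r e ⊆ W.ball r' e := by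
  obtain ⟨k, rfl⟩ := Nat.exists_eq_add_of_le h
  intro f hf
  exact mem_ball_add.2 ⟨f, hf, self_mem_ball (ball_subset_events he hf)⟩

lemma mem_ball_comm (he : e ∈ W.events) (h : f ∈ W.ball r e) : e ∈ W.ball r f := by
  induction r generalizing f with
  | zero => rw [mem_ball_zero] at h ⊢; exact h.symm
  | succ r ih =>
    obtain ⟨g, hg, hf⟩ := mem_ball_succ.1 h
    rw [add_comm, mem_ball_add]
    exact ⟨g, mem_ball_one.2 (mem_nb_comm (ball_subset_events he hg) hf), ih hg⟩

lemma mem_ball_trans (hf : f ∈ W.ball r e) (hg : g ∈ W.ball r' f) : g ∈ W.ball (r + r') e :=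
  mem_ball_add.2 ⟨f, hf, hg⟩

lemma card_ball_le {d : ℕ} (hd : ∀ e ∈ W.events, (W.nb e).card ≤ d + 1) (he : e ∈ W.events) :
    (W.ball r e).card ≤ (d + 1) ^ r := by
  induction r with
  | zero => simp [ball]
  | succ r ih =>
    rw [ball, pow_succ]
    exact (Finset.card_biUnion_le_card_mul _ _ _ fun f hf => hd f (ball_subset_events he hf)).trans
      (Nat.mul_le_mul_right _ ih)

/-- Both worlds have the same data at `e`. -/
def Same (W W' : World) (e : EventSpec) : Prop :=
  e ∈ W.events ∧ e ∈ W'.events ∧ W.nb e = W'.nb e ∧ ∀ x ∈ e.vars, W.val x = W'.val x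

/-- Both worlds have the same data in the ball of radius `r` around `e`. -/
def Agree (W W' : World) (r : ℕ) (e : EventSpec) : Prop :=
  e ∈ W.events ∧ ∀ f ∈ W.ball r e, Same W W' f

lemma Same.symm (h : Same W W' e) : Same W' W e :=
  ⟨h.2.1, h.1, h.2.2.1.symm, fun x hx => (h.2.2.2 x hx).symm⟩

lemma Agree.mono (h : Agree W W' r e) (hr : r' ≤ r) : Agree W W' r' e :=
  ⟨h.1, fun f hf => h.2 f (ball_mono h.1 hr hf)⟩

lemma Agree.ball_eq (h : Agree W W' r e) {k : ℕ} (hk : k ≤ r + 1) :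
    W.ball k e = W'.ball k e := by
  induction k with
  | zero => rfl
  | succ k ih =>
    have hk' := ih (by omega)
    ext f
    simp only [mem_ball_succ, ← hk']
    refine exists_congr fun g => and_congr_right fun hg => ?_
    rw [(h.2 g (ball_mono h.1 (by omega) hg)).2.2.1]

lemma Agree.same (h : Agree W W' r e) : Same W W' e := h.2 e (self_mem_ball h.1)

lemma Agree.symm (h : Agree W W' r e) : Agree W' W r e :=
  ⟨h.same.2.1, fun f hf => (h.2 f (by rwa [h.ball_eq (by omega)])).symm⟩

lemma Agree.of_mem (h : Agree W W' r e) {k : ℕ} (hf : f ∈ W.ball k e) (hr : k + r' ≤ r) :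
    Agree W W' r' f :=
  ⟨ball_subset_events h.1 hf, fun _ hg => h.2 _ (ball_mono h.1 hr (mem_ball_trans hf hg))⟩

lemma Agree.trans {W'' : World} (h : Agree W W' r e) (h' : Agree W' W'' r e) :
    Agree W W'' r e := by
  refine ⟨h.1, fun f hf => ?_⟩
  have h1 := h.2 f hf
  have h2 := h'.2 f (by rwa [← h.ball_eq (by omega)])
  exact ⟨h1.1, h2.2.1, h1.2.2.1.trans h2.2.2.1,
    fun x hx => (h1.2.2.2 x hx).trans (h2.2.2.2 x hx)⟩

end Ball

/-! ### The activation process. -/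

section Activation

variable (W : World) (θ : ℝ≥0∞)

/-- The event `e` is likely when the neighbourhoods of all events in `S` are resampled. -/
def Danger (e : EventSpec) (S : Finset EventSpec) : Prop :=
  θ < resampled (W.freed S) (occurs e) W.val

/-- The event `e` is activated next when the events in `S` are active. -/
def Fresh (S : Finset EventSpec) (e : EventSpec) : Prop :=
  W.Danger θ e S ∧ ∀ e' ∈ W.nb e, W.Danger θ e' S → ¬ WellOrderingRel e' e

/-- The events that are active after `j` steps. -/
noncomputable def stage : ℕ → Finset EventSpec
  | 0 => ∅
  | j + 1 => stage j ∪ W.events.filter (W.Fresh θ (stage j))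

/-- The events that are ever activated. -/
noncomputable def active : Finset EventSpec := W.events.filter fun e => ∃ j, e ∈ W.stage θ j

/-- The step in which an event is activated. -/
noncomputable def rank (e : EventSpec) : ℕ := sInf {j | e ∈ W.stage θ (j + 1)}

/-- Two active events are linked if they are at distance at most four. -/
def Link (e f : EventSpec) : Prop := e ∈ W.active θ ∧ f ∈ W.active θ ∧ f ∈ W.ball 4 e

/-- The component of an active event. -/
noncomputable def cluster (e : EventSpec) : Finset EventSpec :=
  (W.active θ).filter fun f => Relation.ReflTransGen (W.Link θ) e f

/-- The conditions on an instance. -/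
structure Valid (c : Params) (W : World) : Prop where
  meas : ∀ e ∈ W.events, MeasurableSet (occurs e)
  prob : ∀ e ∈ W.events, unif (occurs e) ≤ c.p
  deg : ∀ e ∈ W.events, (W.nb e).card ≤ c.d + 1

end Activation

/-! ### Locality of activation, disjointness of active events and termination. -/

section Stage

variable {W W' : World} {c : Params} {θ : ℝ≥0∞} {e f g : EventSpec} {S S' : Finset EventSpec}
  {j k : ℕ}

/-- A variable of `e` is freed by `f` only through a common neighbour, so only events of `S` within
distance 2 of `e` matter. -/
lemma freed_congr (hS : S ⊆ W.events) (hS' : S' ⊆ W'.events) (h : Agree W W' 1 e)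
    (hSS' : ∀ f ∈ W.ball 2 e, f ∈ S ↔ f ∈ S') :
    ∀ x ∈ e.vars, x ∈ W.freed S ↔ x ∈ W'.freed S' := by
  have main : ∀ {V V' : World} {R R' : Finset EventSpec}, R ⊆ V.events → Agree V V' 1 e →
      (∀ f ∈ V.ball 2 e, f ∈ R → f ∈ R') → ∀ x ∈ e.vars, x ∈ V.freed R → x ∈ V'.freed R' := by
    intro V V' R R' hR h hRR' x hx ⟨f, hf, g, hg, hxg⟩
    have hgV := (mem_nb.1 hg).1
    have hge : g ∈ V.nb e := mem_nb_of_mem hgV hx hxg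
    have hfg : f ∈ V.nb g := mem_nb_comm (hR hf) hg
    have hsame := h.2 g (mem_ball_one.2 hge)
    refine ⟨f, hRR' f (mem_ball_succ.2 ⟨g, mem_ball_one.2 hge, hfg⟩) hf, g, ?_, hxg⟩
    rw [hsame.2.2.1] at hfg
    exact mem_nb_comm hsame.2.1 hfg
  refine fun x hx => ⟨main hS h (fun f hf => (hSS' f hf).1) x hx,
    main hS' h.symm (fun f hf => (hSS' f ?_).2) x hx⟩
  rwa [h.ball_eq (by omega)]

lemma danger_congr (hS : S ⊆ W.events) (hS' : S' ⊆ W'.events) (h : Agree W W' 1 e)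
    (hSS' : ∀ f ∈ W.ball 2 e, f ∈ S ↔ f ∈ S') : W.Danger θ e S ↔ W'.Danger θ e S' := by
  unfold Danger
  rw [resampled_congr (determinedBy_occurs e) (freed_congr hS hS' h hSS') h.same.2.2.2]

/-- Freshness compares `e` with its neighbours, which adds one to the radius of danger. -/
lemma fresh_congr (hS : S ⊆ W.events) (hS' : S' ⊆ W'.events) (h : Agree W W' 2 e)
    (hSS' : ∀ f ∈ W.ball 3 e, f ∈ S ↔ f ∈ S') : W.Fresh θ S e ↔ W'.Fresh θ S' e := by
  refine and_congr (danger_congr hS hS' (h.mono (by omega)) fun f hf =>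
    hSS' f (ball_mono h.1 (by omega) hf)) ?_
  rw [← h.same.2.2.1]
  refine forall₂_congr fun e' he' => imp_congr_left ?_
  have he1 := mem_ball_one.2 he'
  exact danger_congr hS hS' (h.of_mem he1 (by omega)) fun f hf =>
    hSS' f (mem_ball_add (r := 1).2 ⟨e', he1, hf⟩)

lemma stage_subset_events : W.stage θ j ⊆ W.events := by
  induction j with
  | zero => simp [stage]
  | succ j ih => exact Finset.union_subset ih (Finset.filter_subset _ _)

lemma stage_mono (h : j ≤ k) : W.stage θ j ⊆ W.stage θ k := by
  induction h with
  | refl => rfl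
  | step _ ih => exact ih.trans Finset.subset_union_left

lemma stage_congr (h : Agree W W' (3 * j) e) : e ∈ W.stage θ j ↔ e ∈ W'.stage θ j := by
  induction j generalizing e with
  | zero => simp [stage]
  | succ j ih =>
    simp only [stage, Finset.mem_union, Finset.mem_filter]
    refine or_congr (ih (h.mono (by omega))) ?_
    rw [fresh_congr stage_subset_events stage_subset_events (h.mono (by omega)) fun f hf =>
      ih (h.of_mem hf (by omega))]
    simp [h.1, h.same.2.1]

lemma active_subset_events : W.active θ ⊆ W.events := Finset.filter_subset _ _

lemma stage_subset_active : W.stage θ j ⊆ W.active θ := fun _ h =>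
  Finset.mem_filter.2 ⟨stage_subset_events h, j, h⟩

lemma mem_stage_rank (h : e ∈ W.active θ) : e ∈ W.stage θ (W.rank θ e + 1) := by
  obtain ⟨-, j, hj⟩ := Finset.mem_filter.1 h
  exact Nat.sInf_mem (s := {j | e ∈ W.stage θ (j + 1)}) ⟨j, stage_mono (by omega) hj⟩

lemma mem_stage_iff : e ∈ W.stage θ j ↔ e ∈ W.active θ ∧ W.rank θ e < j := by
  constructor
  · intro h
    refine ⟨stage_subset_active h, ?_⟩
    cases j with
    | zero => simp [stage] at h
    | succ j => exact Nat.lt_succ_of_le (Nat.sInf_le h)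
  · rintro ⟨h, hj⟩
    exact stage_mono hj (mem_stage_rank h)

lemma fresh_rank (h : e ∈ W.active θ) : W.Fresh θ (W.stage θ (W.rank θ e)) e := by
  have h1 := mem_stage_rank h
  rw [stage, Finset.mem_union, Finset.mem_filter] at h1
  refine (h1.resolve_left fun h2 => ?_).2
  exact lt_irrefl _ (mem_stage_iff.1 h2).2

lemma agree_refl (h : e ∈ W.events) {r : ℕ} : Agree W W r e :=
  ⟨h, fun _ hf => ⟨ball_subset_events h hf, ball_subset_events h hf, rfl, fun _ _ => rfl⟩⟩

/-- If no event within distance 3 had been activated in step `j`, then `e` would already have been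
fresh in that step. -/
lemma exists_rank_eq (h : e ∈ W.active θ) (hj : W.rank θ e = j + 1) :
    ∃ f ∈ W.active θ, W.rank θ f = j ∧ f ∈ W.ball 3 e := by
  by_contra! hne
  have he := active_subset_events h
  have h1 := fresh_rank h
  rw [hj, ← fresh_congr (S := W.stage θ j) stage_subset_events stage_subset_events
    (agree_refl he)] at h1
  · have : e ∈ W.stage θ (j + 1) := by
      rw [stage, Finset.mem_union, Finset.mem_filter]
      exact .inr ⟨he, h1⟩
    have := (mem_stage_iff.1 this).2
    omega
  · intro f hf
    simp only [mem_stage_iff]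
    refine and_congr_right fun hfa => ⟨fun h => h.trans (by omega), fun h => ?_⟩
    by_contra hlt
    exact hne f hfa (by omega) hf

lemma not_danger_of_subset (hW : W.Valid c) (he : e ∈ W.events)
    (h : (e.vars : Set ℕ) ⊆ W.freed S) : ¬ W.Danger c.θ e S := by
  unfold Danger
  rw [resampled_of_subset (determinedBy_occurs e) h, not_lt]
  exact (hW.prob e he).trans c.p_le

/-- A common variable would make `e` a neighbour of `f`, and then all variables of `e` are freed. -/
lemma Danger.disjoint (hW : W.Valid c) (he : e ∈ W.events) (h : W.Danger c.θ e S) (hf : f ∈ S) :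
    Disjoint e.vars f.vars := by
  by_contra hd
  refine not_danger_of_subset hW he (fun x hx => ⟨f, hf, e, ?_, hx⟩) h
  exact mem_nb.2 ⟨he, .inr fun h => hd h.symm⟩

lemma Danger.vars_nonempty (hW : W.Valid c) (he : e ∈ W.events) (h : W.Danger c.θ e S) :
    e.vars.Nonempty := by
  by_contra hd
  rw [Finset.not_nonempty_iff_eq_empty] at hd
  exact not_danger_of_subset hW he (by simp [hd]) h

lemma danger_rank (h : e ∈ W.active θ) : W.Danger θ e (W.stage θ (W.rank θ e)) := (fresh_rank h).1

/-- For different ranks, the later event was dangerous while the earlier one was active. For equal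
ranks, the well-order lets only one of two dangerous neighbours through. -/
lemma disjoint_of_active (hW : W.Valid c) (he : e ∈ W.active c.θ) (hf : f ∈ W.active c.θ)
    (hne : e ≠ f) : Disjoint e.vars f.vars := by
  rcases lt_trichotomy (W.rank c.θ e) (W.rank c.θ f) with h | h | h
  · exact ((danger_rank hf).disjoint hW (active_subset_events hf) (mem_stage_iff.2 ⟨he, h⟩)).symm
  · by_contra hd
    have h1 := (fresh_rank he).2 f (mem_nb.2 ⟨active_subset_events hf, .inr hd⟩)
      (h ▸ danger_rank hf)
    have h2 := (fresh_rank hf).2 e (mem_nb.2 ⟨active_subset_events he, .inr fun h => hd h.symm⟩)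
      (h ▸ danger_rank he)
    rcases trichotomous_of WellOrderingRel e f with h3 | h3 | h3
    exacts [h2 h3, hne h3, h1 h3]
  · exact (danger_rank he).disjoint hW (active_subset_events he) (mem_stage_iff.2 ⟨hf, h⟩)

/-- The least dangerous event in the well-order would be fresh, hence active, hence disjoint from
itself although it has variables. -/
lemma not_danger_active (hW : W.Valid c) (he : e ∈ W.events) :
    ¬ W.Danger c.θ e (W.active c.θ) := by
  intro h
  -- There are finitely many events, so the process is stationary from some step on.
  obtain ⟨j, hj⟩ : ∃ j, W.stage c.θ j = W.active c.θ := by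
    refine ⟨(W.active c.θ).sup (W.rank c.θ) + 1, stage_subset_active.antisymm fun e he => ?_⟩
    exact mem_stage_iff.2 ⟨he, Nat.lt_succ_of_le (Finset.le_sup he)⟩
  have hT : ∃ e, e ∈ W.events ∧ W.Danger c.θ e (W.active c.θ) := ⟨e, he, h⟩
  obtain ⟨m, ⟨hm, hmd⟩, hmin⟩ := (IsWellFounded.wf (r := @WellOrderingRel EventSpec)).has_min
    {e | e ∈ W.events ∧ W.Danger c.θ e (W.active c.θ)} hT
  have hfresh : W.Fresh c.θ (W.stage c.θ j) m := by
    rw [hj]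
    exact ⟨hmd, fun e' he' hd => hmin e' ⟨(mem_nb.1 he').1, hd⟩⟩
  have hmem : m ∈ W.stage c.θ (j + 1) := by
    rw [stage, Finset.mem_union, Finset.mem_filter]
    exact .inr ⟨hm, hfresh⟩
  have hact := stage_subset_active hmem
  obtain ⟨x, hx⟩ := hmd.vars_nonempty hW hm
  exact Finset.disjoint_left.1 (hmd.disjoint hW hm hact) hx hx

end Stage

/-! ### Clusters of active events. -/

section Cluster

variable {W W' : World} {c : Params} {θ : ℝ≥0∞} {e f g : EventSpec} {i j k : ℕ}

lemma Link.symm (h : W.Link θ e f) : W.Link θ f e :=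
  ⟨h.2.1, h.1, mem_ball_comm (active_subset_events h.1) h.2.2⟩

lemma reflTransGen_link_symm (h : Relation.ReflTransGen (W.Link θ) e f) :
    Relation.ReflTransGen (W.Link θ) f e := by
  induction h with
  | refl => rfl
  | tail _ h ih => exact ih.head h.symm

lemma mem_cluster : f ∈ W.cluster θ e ↔ f ∈ W.active θ ∧ Relation.ReflTransGen (W.Link θ) e f :=
  Finset.mem_filter

lemma cluster_subset_active : W.cluster θ e ⊆ W.active θ := Finset.filter_subset _ _

lemma self_mem_cluster (he : e ∈ W.active θ) : e ∈ W.cluster θ e := mem_cluster.2 ⟨he, .refl⟩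

lemma cluster_eq (h : f ∈ W.cluster θ e) : W.cluster θ f = W.cluster θ e := by
  have h' := (mem_cluster.1 h).2
  ext g
  simp only [mem_cluster]
  exact and_congr_right fun _ => ⟨fun h2 => h'.trans h2,
    fun h2 => (reflTransGen_link_symm h').trans h2⟩

lemma mem_cluster_of_mem_ball (he : e ∈ W.active θ) (hf : f ∈ W.active θ) (h : f ∈ W.ball 4 e) :
    f ∈ W.cluster θ e := mem_cluster.2 ⟨hf, .single ⟨he, hf, h⟩⟩

lemma mem_cluster_of_mem_ball_le (he : e ∈ W.active θ) (hf : f ∈ W.active θ) (hi : i ≤ 4)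
    (h : f ∈ W.ball i e) : f ∈ W.cluster θ e :=
  mem_cluster_of_mem_ball he hf (ball_mono (active_subset_events he) hi h)

/-- By `exists_rank_eq` one can descend through all smaller ranks without leaving the cluster. So a
cluster with fewer than `s` events is complete after `s` steps of activation. -/
lemma rank_lt_card_cluster (he : e ∈ W.active θ) : W.rank θ e < (W.cluster θ e).card := by
  have main : ∀ i ≤ W.rank θ e, ∃ f ∈ W.cluster θ e, W.rank θ f = W.rank θ e - i := by
    intro i
    induction i with
    | zero => exact fun _ => ⟨e, self_mem_cluster he, rfl⟩
    | succ i ih =>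
      intro hi
      obtain ⟨f, hf, hfr⟩ := ih (by omega)
      have hfa := cluster_subset_active hf
      obtain ⟨g, hg, hgr, hgf⟩ := exists_rank_eq (j := W.rank θ e - (i + 1)) hfa (by omega)
      refine ⟨g, ?_, hgr⟩
      rw [← cluster_eq hf]
      exact mem_cluster_of_mem_ball_le hfa hg (by omega) hgf
  have hsub : Finset.range (W.rank θ e + 1) ⊆ (W.cluster θ e).image (W.rank θ) := by
    intro j hj
    obtain ⟨f, hf, h⟩ := main (W.rank θ e - j) (by omega)
    refine Finset.mem_image.2 ⟨f, hf, ?_⟩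
    have := Finset.mem_range.1 hj
    omega
  have := (Finset.card_le_card hsub).trans Finset.card_image_le
  rw [Finset.card_range] at this
  omega

/-- The events that are joined to `e` by at most `i` links. -/
noncomputable def clusterBall (W : World) (θ : ℝ≥0∞) : ℕ → EventSpec → Finset EventSpec
  | 0, e => {e}
  | i + 1, e => (W.active θ).filter fun g => ∃ f ∈ clusterBall W θ i e, g ∈ W.ball 4 f

lemma mem_clusterBall_succ : g ∈ W.clusterBall θ (i + 1) e ↔
    g ∈ W.active θ ∧ ∃ f ∈ W.clusterBall θ i e, g ∈ W.ball 4 f := by simp [clusterBall]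

lemma clusterBall_subset_cluster (he : e ∈ W.active θ) :
    W.clusterBall θ i e ⊆ W.cluster θ e := by
  induction i with
  | zero => simpa [clusterBall] using self_mem_cluster he
  | succ i ih =>
    intro g hg
    obtain ⟨hga, f, hf, hgf⟩ := mem_clusterBall_succ.1 hg
    rw [← cluster_eq (ih hf)]
    exact mem_cluster_of_mem_ball (cluster_subset_active (ih hf)) hga hgf

lemma clusterBall_subset_active (he : e ∈ W.active θ) : W.clusterBall θ i e ⊆ W.active θ :=
  (clusterBall_subset_cluster he).trans cluster_subset_active

lemma clusterBall_subset_succ (he : e ∈ W.active θ) :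
    W.clusterBall θ i e ⊆ W.clusterBall θ (i + 1) e := fun f hf =>
  mem_clusterBall_succ.2 ⟨clusterBall_subset_active he hf, f, hf,
    self_mem_ball (active_subset_events (clusterBall_subset_active he hf))⟩

lemma self_mem_clusterBall (he : e ∈ W.active θ) : e ∈ W.clusterBall θ i e := by
  induction i with
  | zero => simp [clusterBall]
  | succ i ih => exact clusterBall_subset_succ he ih

lemma clusterBall_subset_ball :
    W.clusterBall θ i e ⊆ W.ball (4 * i) e := by
  induction i with
  | zero => simp [clusterBall, ball]
  | succ i ih =>
    intro g hg
    obtain ⟨hga, f, hf, hgf⟩ := mem_clusterBall_succ.1 hg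
    exact mem_ball_trans (ih hf) hgf

lemma clusterBall_eq_cluster (he : e ∈ W.active θ)
    (h : W.clusterBall θ (i + 1) e = W.clusterBall θ i e) :
    W.clusterBall θ i e = W.cluster θ e := by
  refine (clusterBall_subset_cluster he).antisymm fun f hf => ?_
  have hf' := (mem_cluster.1 hf).2
  clear hf
  induction hf' with
  | refl => exact self_mem_clusterBall he
  | tail _ h2 ih =>
    rw [← h]
    exact mem_clusterBall_succ.2 ⟨h2.2.1, _, ih, h2.2.2⟩

/-- Each further layer either adds an event or shows that the whole cluster has been found. -/
lemma clusterBall_eq_or_lt_card (he : e ∈ W.active θ) :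
    W.clusterBall θ i e = W.cluster θ e ∨ i < (W.clusterBall θ i e).card := by
  induction i with
  | zero => right; simp [clusterBall]
  | succ i ih =>
    rcases ih with ih | ih
    · left
      refine (clusterBall_subset_cluster he).antisymm ?_
      rw [← ih]
      exact clusterBall_subset_succ he
    · by_cases h : W.clusterBall θ (i + 1) e = W.clusterBall θ i e
      · left
        rw [h, clusterBall_eq_cluster he h]
      · right
        have := Finset.card_lt_card ((clusterBall_subset_succ (i := i) he).ssubset_of_ne (Ne.symm h))
        omega

lemma cluster_subset_ball (he : e ∈ W.active θ) (hi : (W.cluster θ e).card ≤ i) :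
    W.cluster θ e ⊆ W.ball (4 * i) e := by
  rcases clusterBall_eq_or_lt_card (i := i) he with h | h
  · exact h ▸ clusterBall_subset_ball
  · have := Finset.card_le_card (clusterBall_subset_cluster (i := i) he)
    omega

end Cluster

/-! ### Solving the clusters independently. -/

section Result

variable {W W' : World} {c : Params} {θ : ℝ≥0∞} {e f g : EventSpec} {K : Finset EventSpec} {x : ℕ}

/-- The assignment `z` solves the component `K` when the variables outside are kept. -/
def Solves (W : World) (K : Finset EventSpec) (z : Assignment) : Prop :=
  ∀ f ∈ K, ∀ e ∈ W.ball 2 f, splice (W.freed K) z W.val ∉ occurs e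

/-- A solution of the component `K`. -/
noncomputable def solution (W : World) (K : Finset EventSpec) : Assignment :=
  Classical.epsilon (W.Solves K)

/-- The assignment in which all components are solved. -/
noncomputable def result (W : World) (θ : ℝ≥0∞) : Assignment := fun x =>
  if h : ∃ f ∈ W.active θ, x ∈ W.freed {f} then W.solution (W.cluster θ h.choose) x else W.val x

lemma mem_freed_singleton : x ∈ W.freed {f} ↔ ∃ g ∈ W.nb f, x ∈ g.vars := by simp [freed]

lemma mem_freed {S : Finset EventSpec} : x ∈ W.freed S ↔ ∃ f ∈ S, x ∈ W.freed {f} := by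
  simp [freed]

lemma mem_ball_two_of_freed (hf : f ∈ W.events) (hx : x ∈ e.vars)
    (h : x ∈ W.freed {f}) : f ∈ W.ball 2 e := by
  obtain ⟨g, hg, hxg⟩ := mem_freed_singleton.1 h
  exact mem_ball_succ.2 ⟨g, mem_ball_one.2 (mem_nb_of_mem (mem_nb.1 hg).1 hx hxg),
    mem_nb_comm hf hg⟩

/-- Two active events that free the same variable are at distance at most 3, within the link radius.
-/
lemma cluster_eq_of_freed (hf : f ∈ W.active θ) (hg : g ∈ W.active θ) (hxf : x ∈ W.freed {f})
    (hxg : x ∈ W.freed {g}) : W.cluster θ f = W.cluster θ g := by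
  obtain ⟨e, he, hxe⟩ := mem_freed_singleton.1 hxf
  have he' := (mem_nb.1 he).1
  have h1 := mem_ball_two_of_freed (active_subset_events hg) hxe hxg
  exact (cluster_eq (mem_cluster_of_mem_ball_le hf hg (by omega)
    (mem_ball_trans (mem_ball_one.2 he) h1))).symm

lemma result_of_freed (hf : f ∈ W.active θ) (hx : x ∈ W.freed {f}) :
    W.result θ x = W.solution (W.cluster θ f) x := by
  have h : ∃ f ∈ W.active θ, x ∈ W.freed {f} := ⟨f, hf, hx⟩
  rw [result, dif_pos h, cluster_eq_of_freed h.choose_spec.1 hf h.choose_spec.2 hx]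

lemma result_of_notMem_freed (hx : x ∉ W.freed (W.active θ)) : W.result θ x = W.val x := by
  rw [result, dif_neg (mt mem_freed.2 hx)]

/-- Any active event that frees a variable of `e` is within 2 of `e`, hence within 4 of `f`. The
link radius 4 is what makes each event see a single cluster. -/
lemma mem_freed_cluster_iff (hf : f ∈ W.active θ) (hfe : f ∈ W.ball 2 e) (he : e ∈ W.events)
    (hx : x ∈ e.vars) : x ∈ W.freed (W.cluster θ f) ↔ x ∈ W.freed (W.active θ) := by
  constructor
  · intro h
    obtain ⟨g, hg, hxg⟩ := mem_freed.1 h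
    exact mem_freed.2 ⟨g, cluster_subset_active hg, hxg⟩
  · intro h
    obtain ⟨g, hg, hxg⟩ := mem_freed.1 h
    refine mem_freed.2 ⟨g, mem_cluster_of_mem_ball hf hg ?_, hxg⟩
    exact mem_ball_trans (mem_ball_comm he hfe)
      (mem_ball_two_of_freed (active_subset_events hg) hx hxg)

/-- At the end no event is dangerous, so the local lemma with bound θ applies to the freed variables
while the others keep their values. -/
lemma exists_solves (hW : W.Valid c) : ∃ z, ∀ f ∈ W.active c.θ, W.Solves (W.cluster c.θ f) z := by
  obtain ⟨z, hz⟩ := exists_avoiding (s := W.events) (T := EventSpec.vars)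
    (C := fun e => {z | splice (W.freed (W.active c.θ)) z W.val ∈ occurs e}) (θ := c.θ.toReal)
    (d := c.d) (fun e he => measurableSet_splice _ (hW.meas e he) _)
    (fun e _ => determinedBy_splice (determinedBy_occurs e) _)
    (fun e he => ENNReal.toReal_mono c.ne_top (not_lt.1 (not_danger_active hW he)))
    ENNReal.toReal_nonneg
    (fun e he => by
      have hsub : W.events.filter (fun g => g ≠ e ∧ ¬ Disjoint e.vars g.vars) ⊆
          (W.nb e).erase e := by
        intro g hg
        obtain ⟨h1, h2, h3⟩ := Finset.mem_filter.1 hg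
        exact Finset.mem_erase.2 ⟨h2, mem_nb.2 ⟨h1, .inr h3⟩⟩
      have h1 := Finset.card_le_card hsub
      rw [Finset.card_erase_of_mem (self_mem_nb he)] at h1
      have h2 := hW.deg e he
      omega)
    c.lll c.half
  refine ⟨z, fun f hf g hg e he => ?_⟩
  have hga := cluster_subset_active hg
  have hgE := active_subset_events hga
  have heE := ball_subset_events hgE he
  have h1 := hz e heE
  rw [Set.mem_ofPred_eq] at h1
  refine fun h2 => h1 ((determinedBy_occurs e _ _ fun x hx => ?_).1 h2)
  rw [← cluster_eq hg]
  have h3 := mem_freed_cluster_iff hga (mem_ball_comm hgE he) heE hx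
  by_cases hx' : x ∈ W.freed (W.active c.θ)
  · rw [splice_of_mem hx', splice_of_mem (h3.2 hx')]
  · rw [splice_of_notMem hx', splice_of_notMem (mt h3.1 hx')]

lemma solves_solution (hW : W.Valid c) (hf : f ∈ W.active c.θ) :
    W.Solves (W.cluster c.θ f) (W.solution (W.cluster c.θ f)) := by
  obtain ⟨z, hz⟩ := exists_solves hW
  exact Classical.epsilon_spec (p := W.Solves (W.cluster c.θ f)) ⟨z, hz f hf⟩

lemma result_notMem_occurs (hW : W.Valid c) (he : e ∈ W.events) : W.result c.θ ∉ occurs e := by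
  by_cases h : ∃ f ∈ W.active c.θ, f ∈ W.ball 2 e
  · obtain ⟨f, hf, hfe⟩ := h
    have h1 := solves_solution hW hf f (self_mem_cluster hf) e (mem_ball_comm he hfe)
    refine fun h2 => h1 ((determinedBy_occurs e _ _ fun x hx => ?_).1 h2)
    have h3 := mem_freed_cluster_iff hf hfe he hx
    by_cases hx' : x ∈ W.freed (W.cluster c.θ f)
    · obtain ⟨g, hg, hxg⟩ := mem_freed.1 hx'
      rw [splice_of_mem hx', result_of_freed (cluster_subset_active hg) hxg, cluster_eq hg]
    · rw [splice_of_notMem hx', result_of_notMem_freed (mt h3.2 hx')]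
  · have hx : ∀ x ∈ e.vars, x ∉ W.freed (W.active c.θ) := by
      intro x hx hx'
      obtain ⟨g, hg, hxg⟩ := mem_freed.1 hx'
      exact h ⟨g, hg, mem_ball_two_of_freed (active_subset_events hg) hx hxg⟩
    intro h2
    refine not_danger_active hW he ?_
    -- No variable of `e` is freed. If `e` occurred, its conditional probability would be one, above
    -- θ.
    have h3 : {z | splice (W.freed (W.active c.θ)) z W.val ∈ occurs e} = Set.univ := by
      refine Set.eq_univ_of_forall fun z => ?_
      rw [Set.mem_ofPred_eq]
      refine (determinedBy_occurs e _ _ fun x hxe => ?_).1 h2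
      rw [splice_of_notMem (hx x hxe), result_of_notMem_freed (hx x hxe)]
    rw [Danger, resampled, h3, measure_univ]
    have := c.half
    rw [← ENNReal.toReal_lt_toReal c.ne_top ENNReal.one_ne_top, ENNReal.toReal_one]
    linarith

/-- The two worlds impose the same condition on a solution of `K`, and `Classical.epsilon` then
picks the same one. Nodes thus agree on the solution without further communication. -/
lemma solution_congr (hK : K ⊆ W.events) (h : ∀ f ∈ K, Agree W W' 3 f) :
    W.solution K = W'.solution K := by
  unfold solution
  congr 1
  funext z
  refine propext (forall₂_congr fun f hf => ?_)
  rw [(h f hf).ball_eq (k := 2) (by omega)]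
  refine forall₂_congr fun e he => not_congr (determinedBy_occurs e _ _ fun x hx => ?_)
  rw [← (h f hf).ball_eq (k := 2) (by omega)] at he
  have hag : Agree W W' 1 e := (h f hf).of_mem he (by omega)
  have hfr := freed_congr hK (fun f hf => (h f hf).same.2.1) hag (fun _ _ => Iff.rfl) x hx
  by_cases hx' : x ∈ W.freed K
  · rw [splice_of_mem hx', splice_of_mem (hfr.1 hx')]
  · rw [splice_of_notMem hx', splice_of_notMem (mt hfr.2 hx'), hag.same.2.2.2 x hx]

/-- The result at `e` is determined by the components near `e`. -/
lemma result_congr (h : Agree W W' 3 e)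
    (hact : ∀ f ∈ W.ball 2 e, f ∈ W.active θ ↔ f ∈ W'.active θ)
    (hcl : ∀ f ∈ W.ball 2 e, f ∈ W.active θ → W.cluster θ f = W'.cluster θ f ∧
      ∀ g ∈ W.cluster θ f, Agree W W' 3 g) {x : ℕ} (hx : x ∈ e.vars) :
    W.result θ x = W'.result θ x := by
  have hfr := freed_congr active_subset_events active_subset_events (h.mono (by omega)) hact x hx
  by_cases hx' : x ∈ W.freed (W.active θ)
  · obtain ⟨f, hf, hxf⟩ := mem_freed.1 hx'
    have hfe := mem_ball_two_of_freed (active_subset_events hf) hx hxf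
    obtain ⟨h1, h2⟩ := hcl f hfe hf
    have hf' := (hact f hfe).1 hf
    have hxf' : x ∈ W'.freed {f} := by
      obtain ⟨g, hg, hxg⟩ := mem_freed_singleton.1 hxf
      rw [(h2 f (self_mem_cluster hf)).same.2.2.1] at hg
      exact mem_freed_singleton.2 ⟨g, hg, hxg⟩
    rw [result_of_freed hf hxf, result_of_freed hf' hxf', ← h1,
      solution_congr (cluster_subset_active.trans active_subset_events) h2]
  · rw [result_of_notMem_freed hx', result_of_notMem_freed (mt hfr.2 hx'), h.same.2.2.2 x hx]

end Result

/-! ### Locality of the result when some nodes stop early. -/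

/-- An instance whose components have size at most `M`. -/
structure Good (c : Params) (M : ℕ) (W : World) : Prop extends W.Valid c where
  card_le : ∀ e ∈ W.active c.θ, (W.cluster c.θ e).card ≤ M

/-- Judging from the ball of radius `ρ`, the event `e` may belong to a component of size at least
`s`. -/
def Suspect (c : Params) (M s ρ : ℕ) (W : World) (e : EventSpec) : Prop :=
  ∃ W', Good c M W' ∧ Agree W W' ρ e ∧ e ∈ W'.active c.θ ∧ s ≤ (W'.cluster c.θ e).card

/-- There is a suspect event close to `e`. -/
def Uncertified (c : Params) (M s ρ : ℕ) (W : World) (e : EventSpec) : Prop :=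
  ∃ f ∈ W.ball 10 e, Suspect c M s ρ W f

/-- There is a path with at most `r` edges from `e` to `g` through uncertified events. -/
def Reach (c : Params) (M s ρ : ℕ) (W : World) : ℕ → EventSpec → EventSpec → Prop
  | 0, e, g => g = e
  | r + 1, e, g => Reach c M s ρ W r e g ∨ ∃ e' ∈ W.nb e,
      Uncertified c M s ρ W e ∧ Uncertified c M s ρ W e' ∧ Reach c M s ρ W r e' g

variable {c : Params} {M s ρ : ℕ} {W W' : World} {e f g v : EventSpec} {r r' R P j k : ℕ}

lemma suspect_congr (h : Agree W W' ρ e) : Suspect c M s ρ W e ↔ Suspect c M s ρ W' e :=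
  exists_congr fun _ => and_congr_right fun _ => and_congr_left fun _ =>
    ⟨fun h' => h.symm.trans h', fun h' => h.trans h'⟩

lemma uncertified_congr (h : Agree W W' (ρ + 10) e) :
    Uncertified c M s ρ W e ↔ Uncertified c M s ρ W' e := by
  unfold Uncertified
  rw [← h.ball_eq (by omega)]
  exact exists_congr fun f => and_congr_right fun hf => suspect_congr (h.of_mem hf (by omega))

lemma card_cluster_lt (hW : Good c M W) (he : e ∈ W.active c.θ) (h : ¬ Suspect c M s ρ W e) :
    (W.cluster c.θ e).card < s := by
  by_contra hs
  exact h ⟨W, hW, agree_refl (active_subset_events he), he, not_lt.1 hs⟩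

lemma mem_stage_of_card_le (he : e ∈ W.active c.θ) (h : (W.cluster c.θ e).card ≤ j) :
    e ∈ W.stage c.θ j :=
  mem_stage_iff.2 ⟨he, (rank_lt_card_cluster he).trans_le h⟩

/-- In either world an event that is not suspect is activated within `s` steps or never, and `s`
steps depend on radius `3 * s` only. -/
lemma stage_congr_of_not_suspect (hW : Good c M W) (hW' : Good c M W') (hρ : 3 * s ≤ ρ)
    (h : Agree W W' ρ e) (hs : ¬ Suspect c M s ρ W e) :
    e ∈ W.stage c.θ j ↔ e ∈ W'.stage c.θ j := by
  have hs' : ¬ Suspect c M s ρ W' e := by rwa [← suspect_congr h]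
  have main : ∀ {V : World}, Good c M V → ¬ Suspect c M s ρ V e → s ≤ j →
      (e ∈ V.stage c.θ j ↔ e ∈ V.stage c.θ s) := by
    intro V hV hVs hj
    refine ⟨fun he => ?_, fun he => stage_mono hj he⟩
    have hea := stage_subset_active he
    exact mem_stage_of_card_le hea (card_cluster_lt hV hea hVs).le
  rcases le_total s j with hj | hj
  · rw [main hW hs hj, main hW' hs' hj]
    exact stage_congr (h.mono hρ)
  · exact stage_congr (h.mono (by omega))

lemma reach_mono (h : Reach c M s ρ W r e g) (hr : r ≤ r') : Reach c M s ρ W r' e g := by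
  induction hr with
  | refl => exact h
  | step _ ih => exact .inl ih

lemma reach_trans (h : Reach c M s ρ W r e f) (h' : Reach c M s ρ W r' f g) :
    Reach c M s ρ W (r + r') e g := by
  induction r generalizing e with
  | zero => cases h; simpa using h'
  | succ r ih =>
    rw [Nat.succ_add]
    rcases h with h | ⟨e', he', h1, h2, h3⟩
    · exact .inl (ih h)
    · exact .inr ⟨e', he', h1, h2, ih h3⟩

/-- Every event within distance 10 of a suspect event is uncertified, so a shortest path to it never
meets a certified event. -/
lemma reach_of_suspect (hg : g ∈ W.events) (he : Suspect c M s ρ W e) (h : e ∈ W.ball k g)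
    (hk : k ≤ 10) : Reach c M s ρ W k g e := by
  induction k generalizing g with
  | zero => exact mem_ball_zero.1 h
  | succ k ih =>
    have h' := h
    rw [add_comm, mem_ball_add] at h'
    obtain ⟨g', hg', heg⟩ := h'
    rw [mem_ball_one] at hg'
    have hgE := (mem_nb.1 hg').1
    exact .inr ⟨g', hg', ⟨e, ball_mono hg hk h, he⟩, ⟨e, ball_mono hgE (by omega) heg, he⟩,
      ih hgE heg (by omega)⟩

/-- The two worlds agree in the balls around all events that are reachable from `v`. -/
def AgreeFrom (c : Params) (M s ρ : ℕ) (W W' : World) (R P : ℕ) (v : EventSpec) : Prop :=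
  ∀ g, Reach c M s ρ W R v g → Agree W W' P g

/-- Whether a path may be continued is decided by a ball of radius `ρ + 10` around its next event,
inside the region of agreement. -/
lemma reach_congr (hP : ρ + 11 ≤ P) (h : AgreeFrom c M s ρ W W' R P v) (hr : r ≤ R) :
    Reach c M s ρ W r v g ↔ Reach c M s ρ W' r v g := by
  induction r generalizing v R with
  | zero => rfl
  | succ r ih =>
    obtain ⟨R, rfl⟩ := Nat.exists_eq_add_of_le' (show 1 ≤ R by omega)
    have hv : Agree W W' P v := h v (reach_mono (r := 0) rfl (by omega))
    refine or_congr (ih h (by omega)) ?_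
    rw [hv.same.2.2.1]
    refine exists_congr fun e' => and_congr_right fun he' => ?_
    rw [← hv.same.2.2.1] at he'
    rw [← uncertified_congr (hv.mono (by omega)),
      ← uncertified_congr (hv.of_mem (r' := ρ + 10) (mem_ball_one.2 he') (by omega))]
    refine and_congr_right fun h1 => and_congr_right fun h2 => ?_
    exact ih (R := R) (fun g hg => h g (.inr ⟨e', he', h1, h2, hg⟩)) (by omega)

lemma AgreeFrom.symm (hP : ρ + 11 ≤ P) (h : AgreeFrom c M s ρ W W' R P v) :
    AgreeFrom c M s ρ W' W R P v := fun g hg =>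
  (h g ((reach_congr hP h le_rfl).2 hg)).symm

/-- Induction on the step. An event that is not suspect is settled by its own ball. A suspect event
is reachable with at most 6 more edges and becomes the new base point, from which the ball of radius
3 that matters for the step is covered. -/
lemma stage_congr_of_reach (hW : Good c M W) (hW' : Good c M W') (hρ : 3 * s ≤ ρ)
    (hP : ρ + 11 ≤ P) (h : AgreeFrom c M s ρ W W' R P v) (hr : r + 6 * j ≤ R)
    (hg : Reach c M s ρ W r v g) (he : e ∈ W.ball 6 g) :
    e ∈ W.stage c.θ j ↔ e ∈ W'.stage c.θ j := by
  induction j generalizing r g e with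
  | zero => simp [stage]
  | succ j ih =>
    have hgA := h g (reach_mono hg (by omega))
    have heA : Agree W W' ρ e := hgA.of_mem he (by omega)
    by_cases hs : Suspect c M s ρ W e
    · have heR := reach_trans hg (reach_of_suspect hgA.1 hs he (by omega))
      have heA2 : Agree W W' 2 e := (h e (reach_mono heR (by omega))).mono (by omega)
      simp only [stage, Finset.mem_union, Finset.mem_filter]
      refine or_congr (ih (by omega) hg he) ?_
      rw [fresh_congr stage_subset_events stage_subset_events heA2 fun f hf =>
        ih (by omega) heR (ball_mono heA.1 (by omega) hf)]
      simp [heA.1, heA.same.2.1]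
    · exact stage_congr_of_not_suspect hW hW' hρ heA hs

lemma active_of_reach (hW : Good c M W) (hW' : Good c M W') (hρ : 3 * s ≤ ρ)
    (hP : ρ + 11 ≤ P) (h : AgreeFrom c M s ρ W W' R P v) (hr : r + 6 * M ≤ R)
    (hg : Reach c M s ρ W r v g) (he : e ∈ W.ball 6 g) (hact : e ∈ W.active c.θ) :
    e ∈ W'.active c.θ :=
  stage_subset_active ((stage_congr_of_reach hW hW' hρ hP h hr hg he).1
    (mem_stage_of_card_le hact (hW.card_le e hact)))

lemma reach_cluster (hf : f ∈ W.active c.θ) (hv : Reach c M s ρ W r v f)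
    (h : ∀ g ∈ W.cluster c.θ f, Suspect c M s ρ W g) {i : ℕ}
    (hg : g ∈ W.clusterBall c.θ i f) : Reach c M s ρ W (r + 4 * i) v g := by
  induction i generalizing g with
  | zero => rw [clusterBall, Finset.mem_singleton] at hg; exact hg ▸ hv
  | succ i ih =>
    obtain ⟨hga, g', hg', hgg⟩ := mem_clusterBall_succ.1 hg
    rw [Nat.mul_succ, ← add_assoc]
    exact reach_trans (ih hg') (reach_of_suspect
      (active_subset_events (clusterBall_subset_active hf hg'))
      (h g (clusterBall_subset_cluster hf hg)) hgg (by omega))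

lemma cluster_transfer (hW : Good c M W) (hW' : Good c M W') (hρ : 3 * s ≤ ρ)
    (hP : ρ + 11 ≤ P) (hP' : 7 * s + 6 ≤ P) (hR : 10 * M + 10 ≤ R)
    (h : AgreeFrom c M s ρ W W' R P v) (hfv : f ∈ W.ball 2 v) (hf : f ∈ W.active c.θ) :
    ∀ g ∈ W.cluster c.θ f, Agree W W' 4 g ∧ g ∈ W'.active c.θ := by
  have hv0 : Reach c M s ρ W 0 v v := rfl
  have hvA : Agree W W' P v := h v (reach_mono hv0 (by omega))
  intro g hg
  -- If all members are suspect, the whole cluster can be walked through: 2 edges to `f`, `4 * M`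
  -- along links, `6 * M` for the stages. If one is not, the cluster has fewer than `s` members and
  -- lies within `4 * s + 2` of `v`; its activation needs `3 * s` more.
  by_cases hall : ∀ g ∈ W.cluster c.θ f, Suspect c M s ρ W g
  · have hfR := reach_of_suspect hvA.1 (hall f (self_mem_cluster hf)) hfv (by omega)
    have hgM : g ∈ W.clusterBall c.θ M f := by
      rcases clusterBall_eq_or_lt_card (i := M) hf with h1 | h1
      · rwa [h1]
      · have h2 := Finset.card_le_card (clusterBall_subset_cluster (i := M) hf)
        have h3 := hW.card_le f hf
        omega
    have hgR := reach_cluster hf hfR hall hgM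
    have hgA := h g (reach_mono hgR (by omega))
    exact ⟨hgA.mono (by omega), active_of_reach hW hW' hρ hP h (by omega) hgR
      (self_mem_ball hgA.1) (cluster_subset_active hg)⟩
  · push Not at hall
    obtain ⟨f', hf', hs⟩ := hall
    have hlt := card_cluster_lt hW (cluster_subset_active hf') hs
    rw [cluster_eq hf'] at hlt
    have hgv := mem_ball_trans hfv (cluster_subset_ball hf hlt.le hg)
    have hgs : g ∈ W.stage c.θ s :=
      mem_stage_of_card_le (cluster_subset_active hg) (by rw [cluster_eq hg]; exact hlt.le)
    exact ⟨hvA.of_mem hgv (by omega), stage_subset_active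
      ((stage_congr (hvA.of_mem (r' := 3 * s) hgv (by omega))).1 hgs)⟩

lemma cluster_subset_of_transfer
    (h : ∀ g ∈ W.cluster c.θ f, Agree W W' 4 g ∧ g ∈ W'.active c.θ) :
    W.cluster c.θ f ⊆ W'.cluster c.θ f := by
  intro g hg
  refine mem_cluster.2 ⟨(h g hg).2, ?_⟩
  have hg' := (mem_cluster.1 hg).2
  clear hg
  induction hg' with
  | refl => rfl
  | @tail a b hab hl ih =>
    have ha : a ∈ W.cluster c.θ f := mem_cluster.2 ⟨hl.1, hab⟩
    have hb : b ∈ W.cluster c.θ f := mem_cluster.2 ⟨hl.2.1, hab.tail hl⟩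
    refine ih.tail ⟨(h a ha).2, (h b hb).2, ?_⟩
    rw [← (h a ha).1.ball_eq (by omega)]
    exact hl.2.2

/-- Two good worlds that agree in the balls around all events reachable from `v` have the same
result at `v`. -/
theorem result_eq_of_agreeFrom (hW : Good c M W) (hW' : Good c M W') (hρ : 3 * s ≤ ρ)
    (hP : ρ + 11 ≤ P) (hP' : 7 * s + 6 ≤ P) (hR : 10 * M + 10 ≤ R)
    (h : AgreeFrom c M s ρ W W' R P v) {x : ℕ} (hx : x ∈ v.vars) :
    W.result c.θ x = W'.result c.θ x := by
  have hv0 : Reach c M s ρ W 0 v v := rfl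
  have hvA : Agree W W' P v := h v (reach_mono hv0 (by omega))
  have h' := h.symm hP
  have hball : W.ball 2 v = W'.ball 2 v := hvA.ball_eq (by omega)
  have hact : ∀ f ∈ W.ball 2 v, f ∈ W.active c.θ ↔ f ∈ W'.active c.θ := fun f hf =>
    ⟨active_of_reach hW hW' hρ hP h (by omega) hv0 (ball_mono hvA.1 (by omega) hf),
      active_of_reach hW' hW hρ hP h' (r := 0) (by omega) rfl
        (ball_mono hvA.same.2.1 (by omega) (hball ▸ hf))⟩
  refine result_congr (hvA.mono (by omega)) hact (fun f hf hfa => ?_) hx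
  have h1 := cluster_transfer hW hW' hρ hP hP' hR h hf hfa
  have h2 := cluster_transfer hW' hW hρ hP hP' hR h' (hball ▸ hf) ((hact f hf).1 hfa)
  exact ⟨(cluster_subset_of_transfer h1).antisymm
    (cluster_subset_of_transfer h2), fun g hg => (h1 g hg).1.mono (by omega)⟩

end World

/-! ### The distributed algorithm. -/

/-- The power of the maximum of some numbers that is uniform if the numbers are independent and
uniform. -/
noncomputable def pooled (m : Multiset unitInterval) : unitInterval := m.sup ^ m.card

/-- What there is to know about an event: its closed neighbourhood and the uniform numbers of its
variables. -/
abbrev Fact : Type := EventSpec × Finset EventSpec × Assignment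

/-- The state of a node: the number of rounds so far, its input, its seed and the known facts. -/
structure NodeState where
  time : ℕ
  spec : EventSpec
  seed : Seed
  known : Set Fact

/-- The description of an event in a given world. -/
noncomputable def World.factOf (W : World) (e : EventSpec) : Fact :=
  (e, W.nb e, fun x => if x ∈ e.vars then W.val x else 0)

/-- All facts in `K` are true in `W`. -/
def World.Consistent (W : World) (K : Set Fact) : Prop :=
  ∀ φ ∈ K, φ.1 ∈ W.events ∧ W.factOf φ.1 = φ

/-- The time schedule and the thresholds of the algorithm. -/
structure Schedule where
  M : ℕ
  s : ℕ
  ρ : ℕ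
  early : ℕ
  late : ℕ
  size : 3 * s ≤ ρ
  radius : ρ + 12 ≤ early
  radius' : 7 * s + 7 ≤ early
  wait : early + 10 * M + 11 ≤ late

section Algorithm

variable (c : Params) (q : Schedule)

/-- The fact that a node learns in the first round from the messages of its neighbours. -/
noncomputable def firstFact (e : EventSpec) (r : Seed) (l : List (EventSpec × Seed)) : Fact :=
  (e, insert e (l.map Prod.fst).toFinset, fun x => if x ∈ e.vars then
    pooled ((((e, r) :: l : List _) : Multiset (EventSpec × Seed)).filter
      (fun y => x ∈ y.1.vars) |>.map fun y => y.2 x) else 0)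

/-- A node may stop early if no event close to it is suspect. -/
def NodeState.Certified (S : NodeState) : Prop :=
  ∃ W : World, W.Consistent S.known ∧ ¬ W.Uncertified c q.M q.s q.ρ S.spec

instance : Nonempty World := ⟨⟨∅, fun _ => 0⟩⟩

/-- A good world in which the known facts are true. -/
noncomputable def NodeState.guess (S : NodeState) : World :=
  Classical.epsilon fun W => W.Good c q.M ∧ W.Consistent S.known

/-- The output of a node. -/
noncomputable def NodeState.output (S : NodeState) : ℕ → ℝ := fun x =>
  if h : x ∈ S.spec.vars then quantile (S.spec.law ⟨x, h⟩) ((S.guess c q).result c.θ x) else 0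

/-- The state of a node after it has received messages. -/
noncomputable def NodeState.receive (S : NodeState)
    (l : List (Option ((EventSpec × Seed) × Set Fact))) : NodeState :=
  if S.time = 0 then ⟨1, S.spec, S.seed, {firstFact S.spec S.seed (l.reduceOption.map Prod.fst)}⟩
  else ⟨S.time + 1, S.spec, S.seed, S.known ∪ ⋃ m ∈ l.reduceOption, m.2⟩

/-- The algorithm floods all facts. Certified nodes stop early, all others stop late. -/
noncomputable def algorithm : LocalAlgorithm EventSpec Seed (ℕ → ℝ) where
  State := NodeState
  Msg := (EventSpec × Seed) × Set Fact
  init e _ r := ⟨0, e, r, ∅⟩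
  send S _ := ((S.spec, S.seed), S.known)
  recv S l := S.receive l
  out S := if (S.time = q.early ∧ S.Certified c q) ∨ q.late ≤ S.time then some (S.output c q)
    else none

end Algorithm

/-! ### Runs of the algorithm and its correctness on good worlds. -/

section Run

variable {V : Type} {L : LLLInstance V} {c : Params} {q : Schedule}
  {P : PortNumbering L.dependencyGraph} {seed : V → Seed} {v w : V} {e g : EventSpec} {t : ℕ}

/-- The state of a node after some rounds. -/
noncomputable abbrev stateAt (c : Params) (q : Schedule) (P : PortNumbering L.dependencyGraph)
    (seed : V → Seed) (t : ℕ) (v : V) : NodeState :=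
  (algorithm c q).state P L.spec seed t v

/-- The node has terminated. -/
def Stopped (c : Params) (q : Schedule) (S : NodeState) : Prop :=
  (S.time = q.early ∧ S.Certified c q) ∨ q.late ≤ S.time

lemma out_isSome {S : NodeState} : ((algorithm c q).out S).isSome ↔ Stopped c q S := by
  simp only [algorithm, Stopped]
  split_ifs with h <;> simp [h]

/-- The messages that a node receives. -/
noncomputable def inbox (c : Params) (q : Schedule) (P : PortNumbering L.dependencyGraph)
    (seed : V → Seed) (t : ℕ) (v : V) : List (Option ((EventSpec × Seed) × Set Fact)) :=
  List.ofFn fun i : Fin (P.deg v) =>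
    if Stopped c q (stateAt c q P seed t (P.nbr v i)) then none
    else some (((stateAt c q P seed t (P.nbr v i)).spec, (stateAt c q P seed t (P.nbr v i)).seed),
      (stateAt c q P seed t (P.nbr v i)).known)

lemma stateAt_succ_of_stopped (h : Stopped c q (stateAt c q P seed t v)) :
    stateAt c q P seed (t + 1) v = stateAt c q P seed t v :=
  if_pos (out_isSome.2 h)

lemma stateAt_succ_of_not_stopped (h : ¬ Stopped c q (stateAt c q P seed t v)) :
    stateAt c q P seed (t + 1) v =
      (stateAt c q P seed t v).receive (inbox c q P seed t v) := by
  refine (if_neg (mt out_isSome.1 h)).trans ?_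
  refine congrArg (NodeState.receive _) (congrArg List.ofFn (funext fun i => ?_))
  by_cases h' : Stopped c q (stateAt c q P seed t (P.nbr v i))
  · exact (if_pos (out_isSome.2 h')).trans (if_pos h').symm
  · exact (if_neg (mt out_isSome.1 h')).trans (if_neg h').symm

lemma spec_seed_stateAt : (stateAt c q P seed t v).spec = L.spec v ∧
    (stateAt c q P seed t v).seed = seed v := by
  induction t with
  | zero => exact ⟨rfl, rfl⟩
  | succ t ih =>
    by_cases h : Stopped c q (stateAt c q P seed t v)
    · rwa [stateAt_succ_of_stopped h]
    · rw [stateAt_succ_of_not_stopped h, NodeState.receive]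
      split_ifs <;> exact ih

lemma known_stateAt_succ (h : ¬ Stopped c q (stateAt c q P seed t v))
    (h0 : (stateAt c q P seed t v).time ≠ 0) :
    (stateAt c q P seed (t + 1) v).known = (stateAt c q P seed t v).known ∪
      ⋃ m ∈ (inbox c q P seed t v).reduceOption, m.2 := by
  rw [stateAt_succ_of_not_stopped h, NodeState.receive, if_neg h0]

lemma time_stateAt_succ (h : ¬ Stopped c q (stateAt c q P seed t v)) :
    (stateAt c q P seed (t + 1) v).time = (stateAt c q P seed t v).time + 1 := by
  rw [stateAt_succ_of_not_stopped h, NodeState.receive]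
  split_ifs with h0
  · simp [h0]
  · rfl

lemma mem_inbox {m : (EventSpec × Seed) × Set Fact} :
    m ∈ (inbox c q P seed t v).reduceOption ↔ ∃ w, L.dependencyGraph.Adj v w ∧
      ¬ Stopped c q (stateAt c q P seed t w) ∧ m = ((L.spec w, seed w),
        (stateAt c q P seed t w).known) := by
  rw [List.reduceOption_mem_iff, inbox, List.mem_ofFn]
  constructor
  · rintro ⟨i, hi⟩
    split_ifs at hi with h
    refine ⟨P.nbr v i, (P.nbr v i).2, h, ?_⟩
    rw [← Option.some_injective _ hi, spec_seed_stateAt.1, spec_seed_stateAt.2]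
  · rintro ⟨w, hw, hs, rfl⟩
    refine ⟨(P.nbr v).symm ⟨w, hw⟩, ?_⟩
    simp only [Equiv.apply_symm_apply]
    rw [if_neg hs, spec_seed_stateAt.1, spec_seed_stateAt.2]

lemma early_pos : 0 < q.early := by have := q.radius; omega

lemma early_lt_late : q.early < q.late := by have := q.wait; omega

lemma not_stopped_of_time_lt {S : NodeState} (h : S.time < q.early) : ¬ Stopped c q S := by
  rintro (h1 | h1)
  · omega
  · have := early_lt_late (q := q); omega

lemma time_stateAt_of_le (h : t ≤ q.early) : (stateAt c q P seed t v).time = t := by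
  induction t with
  | zero => rfl
  | succ t ih =>
    have := ih (by omega)
    rw [time_stateAt_succ (not_stopped_of_time_lt (by omega)), this]

lemma known_stateAt_zero : (stateAt c q P seed 0 v).known = ∅ := rfl

lemma known_mono (h0 : (stateAt c q P seed t v).time ≠ 0) :
    (stateAt c q P seed t v).known ⊆ (stateAt c q P seed (t + 1) v).known := by
  by_cases hv : Stopped c q (stateAt c q P seed t v)
  · rw [stateAt_succ_of_stopped hv]
  · rw [known_stateAt_succ hv h0]
    exact Set.subset_union_left

variable [Fintype V]

/-- The nodes whose seeds determine the variable `x`. -/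
noncomputable def holders (L : LLLInstance V) (x : ℕ) : Finset V :=
  -- A variable of no event is pooled over all nodes, only to keep every coordinate of the world
  -- uniform.
  if ∃ v, x ∈ L.vars v then Finset.univ.filter fun v => x ∈ L.vars v else Finset.univ

/-- The world that is determined by an instance and the seeds of the nodes. -/
noncomputable def worldOf (L : LLLInstance V) (seed : V → Seed) : World where
  events := Finset.univ.image L.spec
  val x := pooled ((holders L x).val.map fun v => seed v x)

lemma spec_mem (v : V) : L.spec v ∈ (worldOf L seed).events :=
  Finset.mem_image_of_mem _ (Finset.mem_univ v)

lemma adj_of_mem_nb (h : L.spec w ∈ (worldOf L seed).nb (L.spec v)) :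
    L.spec w = L.spec v ∨ L.dependencyGraph.Adj v w := by
  by_cases hvw : L.spec w = L.spec v
  · exact .inl hvw
  · right
    obtain ⟨x, hx, hx'⟩ := Finset.not_disjoint_iff.1 ((World.mem_nb.1 h).2.resolve_left hvw)
    exact ⟨fun h => hvw (h ▸ rfl), x, hx, hx'⟩

/-- The messages in the first round. -/
lemma firstFact_eq (P : PortNumbering L.dependencyGraph) (seed : V → Seed) (v : V) :
    firstFact (L.spec v) (seed v) (List.ofFn fun i : Fin (P.deg v) =>
      (L.spec (P.nbr v i), seed (P.nbr v i))) = (worldOf L seed).factOf (L.spec v) := by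
  refine Prod.ext rfl (Prod.ext ?_ ?_)
  · ext g
    simp only [firstFact, World.factOf, Finset.mem_insert, List.mem_toFinset, List.map_ofFn,
      List.mem_ofFn, Function.comp_apply]
    constructor
    · rintro (rfl | ⟨i, rfl⟩)
      · exact World.self_mem_nb (spec_mem v)
      · obtain ⟨x, hx, hx'⟩ := (P.nbr v i).2.2
        exact World.mem_nb_of_mem (spec_mem _) hx hx'
    · intro h
      obtain ⟨w, -, rfl⟩ := Finset.mem_image.1 (World.mem_nb.1 h).1
      rcases adj_of_mem_nb h with h | h
      · exact .inl h
      · right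
        refine ⟨(P.nbr v).symm ⟨w, h⟩, ?_⟩
        simp
  · funext x
    simp only [firstFact, World.factOf]
    by_cases hx : x ∈ (L.spec v).vars
    · rw [if_pos hx, if_pos hx]
      simp only [worldOf]
      congr 1
      have h1 : ((L.spec v, seed v) :: List.ofFn fun i : Fin (P.deg v) =>
          (L.spec (P.nbr v i), seed (P.nbr v i))) =
          (v :: List.ofFn fun i : Fin (P.deg v) => (P.nbr v i : V)).map
            fun w => (L.spec w, seed w) := by
        simp only [List.map_cons, List.map_ofFn]
        rfl
      have h2 : (holders L x).val = ((v :: List.ofFn fun i : Fin (P.deg v) =>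
          (P.nbr v i : V) : List V) : Multiset V).filter fun w => x ∈ L.vars w := by
        refine ((holders L x).nodup.ext ((Multiset.Nodup.filter _ ?_))).2 fun w => ?_
        · rw [Multiset.coe_nodup, List.nodup_cons, List.nodup_ofFn]
          refine ⟨fun hv => ?_, Subtype.val_injective.comp (P.nbr v).injective⟩
          obtain ⟨i, hi⟩ := List.mem_ofFn.1 hv
          exact (P.nbr v i).2.1 hi.symm
        · have hex : ∃ v, x ∈ L.vars v := ⟨v, hx⟩
          rw [Finset.mem_val, holders, if_pos hex, Finset.mem_filter, Multiset.mem_filter,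
            Multiset.mem_coe, List.mem_cons, List.mem_ofFn]
          refine ⟨fun h => ⟨?_, h.2⟩, fun h => ⟨Finset.mem_univ _, h.2⟩⟩
          by_cases hvw : w = v
          · exact .inl hvw
          · exact .inr ⟨(P.nbr v).symm ⟨w, Ne.symm hvw, x, hx, h.2⟩, by simp⟩
      rw [h1, h2, ← Multiset.map_coe, Multiset.filter_map, Multiset.map_map]
      rfl
    · rw [if_neg hx, if_neg hx]

lemma known_stateAt_one :
    (stateAt c q P seed 1 v).known = {(worldOf L seed).factOf (L.spec v)} := by
  have h0 : ∀ w, ¬ Stopped c q (stateAt c q P seed 0 w) := fun w =>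
    not_stopped_of_time_lt (by rw [time_stateAt_of_le (by omega)]; exact early_pos)
  rw [stateAt_succ_of_not_stopped (h0 v), NodeState.receive]
  rw [if_pos (time_stateAt_of_le (by omega)), ← firstFact_eq P]
  simp only [spec_seed_stateAt]
  congr 2
  have : inbox c q P seed 0 v = (List.ofFn fun i : Fin (P.deg v) =>
      ((L.spec (P.nbr v i), seed (P.nbr v i)), (∅ : Set Fact))).map some := by
    rw [inbox, List.map_ofFn]
    congr 1
    funext i
    rw [if_neg (h0 _), spec_seed_stateAt.1, spec_seed_stateAt.2, known_stateAt_zero]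
    rfl
  rw [this, List.reduceOption, List.filterMap_map]
  simp only [Function.comp_def, id_eq]
  rw [List.filterMap_some, List.map_ofFn]
  rfl

lemma consistent_stateAt : (worldOf L seed).Consistent (stateAt c q P seed t v).known := by
  induction t generalizing v with
  | zero => rw [known_stateAt_zero]; intro φ hφ; exact absurd hφ (Set.notMem_empty _)
  | succ t ih =>
    by_cases hs : Stopped c q (stateAt c q P seed t v)
    · rw [stateAt_succ_of_stopped hs]; exact ih
    · cases t with
      | zero =>
        rw [known_stateAt_one]
        rintro φ rfl
        exact ⟨spec_mem v, rfl⟩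
      | succ t =>
        have h0 : (stateAt c q P seed (t + 1) v).time ≠ 0 := by
          by_cases hs' : Stopped c q (stateAt c q P seed t v)
          · rw [stateAt_succ_of_stopped hs'] at hs; exact absurd hs' hs
          · rw [time_stateAt_succ hs']; omega
        rw [known_stateAt_succ hs h0]
        rintro φ (hφ | hφ)
        · exact ih φ hφ
        · obtain ⟨m, hm, hφ⟩ := Set.mem_iUnion₂.1 hφ
          obtain ⟨w, -, -, rfl⟩ := mem_inbox.1 hm
          exact ih φ hφ

/-- Facts travel through nodes that are still running. -/
lemma known_subset_succ (h0 : (stateAt c q P seed t v).time ≠ 0)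
    (hv : ¬ Stopped c q (stateAt c q P seed t v))
    (hw : ¬ Stopped c q (stateAt c q P seed t w))
    (h : L.spec w ∈ (worldOf L seed).nb (L.spec v)) {S : Set Fact}
    (hS : ∀ w', L.spec w' = L.spec w → S ⊆ (stateAt c q P seed t w').known) :
    S ⊆ (stateAt c q P seed (t + 1) v).known := by
  rw [known_stateAt_succ hv h0]
  -- Nodes with equal descriptions form one event of the world and need not be adjacent. In that
  -- case `v` itself already knows the fact.
  rcases adj_of_mem_nb h with h | h
  · exact (hS v h.symm).trans Set.subset_union_left
  · intro φ hφ
    exact .inr (Set.mem_iUnion₂.2 ⟨_, mem_inbox.2 ⟨w, h, hw, rfl⟩, hS w rfl hφ⟩)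

lemma exists_spec_eq (h : e ∈ (worldOf L seed).events) : ∃ w, L.spec w = e := by
  simpa [worldOf] using h

lemma ball_known (ht : t + 1 ≤ q.early) (he : e ∈ (worldOf L seed).ball t (L.spec v)) :
    (worldOf L seed).factOf e ∈ (stateAt c q P seed (t + 1) v).known := by
  induction t generalizing v with
  | zero =>
    rw [known_stateAt_one, World.mem_ball_zero.1 he]
    rfl
  | succ t ih =>
    have hrun : ∀ w, ¬ Stopped c q (stateAt c q P seed (t + 1) w) := fun w =>
      not_stopped_of_time_lt (by rw [time_stateAt_of_le (by omega)]; omega)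
    rw [add_comm t 1, World.mem_ball_add] at he
    obtain ⟨g, hg, heg⟩ := he
    rw [World.mem_ball_one] at hg
    obtain ⟨w, rfl⟩ := exists_spec_eq (World.mem_nb.1 hg).1
    refine known_subset_succ (w := w) (S := {(worldOf L seed).factOf e})
      (by rw [time_stateAt_of_le (by omega)]; omega) (hrun v) (hrun w) hg ?_ rfl
    rintro w' hw' _ rfl
    exact ih (by omega) (hw' ▸ heg)

lemma same_of_factOf_mem {W W' : World} {K : Set Fact} (hK : W'.Consistent K) (he : e ∈ W.events)
    (h : W.factOf e ∈ K) : World.Same W W' e := by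
  obtain ⟨h1, h2⟩ := hK _ h
  refine ⟨he, h1, (congrArg (fun φ => φ.2.1) h2).symm, fun x hx => ?_⟩
  have := congrFun (congrArg (fun φ => φ.2.2) h2) x
  simpa [World.factOf, hx] using this.symm

lemma agree_of_known {W' : World} {K : Set Fact} (hK : W'.Consistent K)
    (hg : g ∈ (worldOf L seed).events) {r : ℕ}
    (h : ∀ e ∈ (worldOf L seed).ball r g, (worldOf L seed).factOf e ∈ K) :
    World.Agree (worldOf L seed) W' r g :=
  ⟨hg, fun f hf => same_of_factOf_mem hK (World.ball_subset_events hg hf) (h f hf)⟩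

lemma ball_known_early (he : e ∈ (worldOf L seed).ball (q.early - 1) (L.spec v)) :
    (worldOf L seed).factOf e ∈ (stateAt c q P seed q.early v).known := by
  have h := early_pos (q := q)
  have := ball_known (c := c) (q := q) (P := P) (t := q.early - 1) (by omega) he
  rwa [Nat.sub_add_cancel h] at this

/-- The event is uncertified in the actual world. -/
abbrev Waiting (c : Params) (q : Schedule) (L : LLLInstance V) (seed : V → Seed)
    (e : EventSpec) : Prop :=
  (worldOf L seed).Uncertified c q.M q.s q.ρ e

/-- The known ball determines whether the event is uncertified, so any consistent world gives the
same verdict as the actual one. -/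
lemma stopped_early_iff :
    Stopped c q (stateAt c q P seed q.early v) ↔ ¬ Waiting c q L seed (L.spec v) := by
  have hlt := early_lt_late (q := q)
  have ht : (stateAt c q P seed q.early v).time = q.early := time_stateAt_of_le le_rfl
  rw [Stopped, ht, NodeState.Certified, spec_seed_stateAt.1]
  constructor
  · rintro (⟨-, W', hW', hu⟩ | h)
    · rwa [Waiting, World.uncertified_congr]
      exact (agree_of_known hW' (spec_mem v) fun e he => ball_known_early he).mono
        (by have := q.radius; omega)
    · omega
  · exact fun h => .inl ⟨rfl, worldOf L seed, consistent_stateAt, h⟩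

lemma time_of_waiting (h : Waiting c q L seed (L.spec v)) (ht : t ≤ q.late) :
    (stateAt c q P seed t v).time = t ∧ (t < q.late → ¬ Stopped c q (stateAt c q P seed t v)) := by
  have aux : (stateAt c q P seed t v).time = t → t < q.late →
      ¬ Stopped c q (stateAt c q P seed t v) := by
    intro h1 h2 hs
    by_cases h3 : t = q.early
    · subst h3
      exact stopped_early_iff.1 hs h
    · rcases hs with hs | hs <;> omega
  induction t with
  | zero => exact ⟨rfl, aux rfl⟩
  | succ t ih =>
    have aux' : (stateAt c q P seed t v).time = t → t < q.late →
        ¬ Stopped c q (stateAt c q P seed t v) := by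
      intro h1 h2 hs
      by_cases h3 : t = q.early
      · subst h3
        exact stopped_early_iff.1 hs h
      · rcases hs with hs | hs <;> omega
    obtain ⟨h1, h2⟩ := ih (by omega) aux'
    have h3 : (stateAt c q P seed (t + 1) v).time = t + 1 := by
      rw [time_stateAt_succ (h2 (by omega)), h1]
    exact ⟨h3, aux h3⟩

/-- All events on a path of `Reach` are uncertified, so their nodes keep running and relay facts one
edge per round. -/
lemma reach_known (h : Waiting c q L seed (L.spec v)) {r : ℕ} (hr : q.early + r ≤ q.late)
    (hg : (worldOf L seed).Reach c q.M q.s q.ρ r (L.spec v) g)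
    (he : e ∈ (worldOf L seed).ball (q.early - 1) g) :
    (worldOf L seed).factOf e ∈ (stateAt c q P seed (q.early + r) v).known := by
  have hpos := early_pos (q := q)
  induction r generalizing v with
  | zero => exact ball_known_early (hg ▸ he)
  | succ r ih =>
    rw [← add_assoc]
    obtain ⟨h1, h2⟩ := time_of_waiting (P := P) h (show q.early + r ≤ q.late by omega)
    rcases hg with hg | ⟨e', he', -, hu, hg⟩
    · exact known_mono (by omega) (ih h (by omega) hg)
    · obtain ⟨w, rfl⟩ := exists_spec_eq (World.mem_nb.1 he').1
      obtain ⟨h3, h4⟩ := time_of_waiting (P := P) hu (show q.early + r ≤ q.late by omega)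
      refine known_subset_succ (w := w) (S := {(worldOf L seed).factOf e}) (by omega)
        (h2 (by omega)) (h4 (by omega)) he' ?_ rfl
      rintro w' hw' _ rfl
      exact ih (hw' ▸ hu) (by omega) (hw' ▸ hg)

/-- The time at which a node stops. -/
noncomputable def stopTime (c : Params) (q : Schedule) (L : LLLInstance V) (seed : V → Seed)
    (v : V) : ℕ :=
  if Waiting c q L seed (L.spec v) then q.late else q.early

lemma stopped_stopTime : Stopped c q (stateAt c q P seed (stopTime c q L seed v) v) := by
  unfold stopTime
  split_ifs with h
  · right
    rw [(time_of_waiting h le_rfl).1]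
  · exact stopped_early_iff.2 h

lemma eq_of_reach_of_not_waiting (h : ¬ Waiting c q L seed (L.spec v)) {r : ℕ}
    (hg : (worldOf L seed).Reach c q.M q.s q.ρ r (L.spec v) g) : g = L.spec v := by
  induction r with
  | zero => exact hg
  | succ r ih =>
    rcases hg with hg | ⟨_, _, hu, _⟩
    · exact ih hg
    · exact absurd hu h

/-- A node that stops early reaches nothing but itself, and its ball is known by then; a waiting
node has had time for all paths of length `q.late - q.early`. -/
lemma agreeFrom_of_consistent {W' : World}
    (hW' : W'.Consistent (stateAt c q P seed (stopTime c q L seed v) v).known) :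
    World.AgreeFrom c q.M q.s q.ρ (worldOf L seed) W' (q.late - q.early) (q.early - 1)
      (L.spec v) := by
  have hlt := early_lt_late (q := q)
  intro g hg
  have hgE : g ∈ (worldOf L seed).events := by
    have : ∀ r e, e ∈ (worldOf L seed).events →
        (worldOf L seed).Reach c q.M q.s q.ρ r e g → g ∈ (worldOf L seed).events := by
      intro r
      induction r with
      | zero => rintro e he rfl; exact he
      | succ r ih =>
        rintro e he (h | ⟨e', he', -, -, h⟩)
        · exact ih e he h
        · exact ih e' (World.mem_nb.1 he').1 h
    exact this _ _ (spec_mem v) hg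
  refine agree_of_known hW' hgE fun e he => ?_
  unfold stopTime
  split_ifs with h
  · have := reach_known (P := P) h (by omega) hg he
    rwa [Nat.add_sub_cancel' hlt.le] at this
  · rw [eq_of_reach_of_not_waiting h hg] at he
    exact ball_known_early he

theorem output_eq (hW : (worldOf L seed).Good c q.M) {x : ℕ} (hx : x ∈ L.vars v) :
    (stateAt c q P seed (stopTime c q L seed v) v).output c q x =
      quantile (L.law x) ((worldOf L seed).result c.θ x) := by
  set S := stateAt c q P seed (stopTime c q L seed v) v with hS
  have hspec : S.spec = L.spec v := spec_seed_stateAt.1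
  have hex : (S.guess c q).Good c q.M ∧ (S.guess c q).Consistent S.known :=
    Classical.epsilon_spec (p := fun W : World => W.Good c q.M ∧ W.Consistent S.known)
      ⟨worldOf L seed, hW, consistent_stateAt⟩
  have hr := World.result_eq_of_agreeFrom hW hex.1 q.size (R := q.late - q.early)
    (P := q.early - 1) (by have := q.radius; omega) (by have := q.radius'; omega)
    (by have := q.wait; omega) (agreeFrom_of_consistent hex.2) (x := x) hx
  have hlaw : ∀ (e : EventSpec) (he : e = L.spec v) (h : x ∈ e.vars),
      e.law ⟨x, h⟩ = L.law x := by
    rintro e rfl h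
    rfl
  have hxS : x ∈ S.spec.vars := by rw [hspec]; exact hx
  rw [NodeState.output, dif_pos hxS, hlaw _ hspec, hr]

theorem rounds_le_stopTime :
    (algorithm c q).rounds P L.spec seed v ≤ stopTime c q L seed v :=
  iInf₂_le (f := fun (t : ℕ)
      (_ : ((algorithm c q).out ((algorithm c q).state P L.spec seed t v)).isSome) => (t : ℕ∞))
    (stopTime c q L seed v) (out_isSome.2 stopped_stopTime)

lemma stopTime_le_late : stopTime c q L seed v ≤ q.late := by
  unfold stopTime
  split_ifs
  · exact le_rfl
  · exact early_lt_late.le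

theorem solvedBy_of_good (hW : (worldOf L seed).Good c q.M) :
    L.SolvedBy (algorithm c q) P seed := by
  refine ⟨fun x => quantile (L.law x) ((worldOf L seed).result c.θ x), fun v =>
    ⟨⟨_, ⟨stopTime c q L seed v, if_pos stopped_stopTime⟩, fun x hx => output_eq hW hx⟩, ?_⟩⟩
  exact World.result_notMem_occurs hW.toValid (spec_mem (seed := seed) v)

end Run

/-! ### Counting connected sets and rank patterns. -/

section Combinatorics

variable {α : Type*}

/-- Every element of `A` can be reached from `e` within `A`. -/
def ConnectedFrom (N : α → Finset α) (e : α) (A : Finset α) : Prop :=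
  e ∈ A ∧ ∀ B ⊆ A, e ∈ B → (∀ b ∈ B, ∀ a ∈ A, a ∈ N b → a ∈ B) → B = A

/-- A configuration `ω` has only one component at `e`: growing from `e` inside `A`, one never leaves
`A'`, and conversely. -/
lemma ConnectedFrom.eq_of_inter_eq {N : α → Finset α} {e : α} {A A' X ω : Finset α}
    (hA : ConnectedFrom N e A) (hA' : ConnectedFrom N e A') (hAX : A ⊆ X) (hAX' : A' ⊆ X)
    (h : ω ∩ (A ∪ A.biUnion N ∩ X) = A) (h' : ω ∩ (A' ∪ A'.biUnion N ∩ X) = A') : A = A' := by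
  have key : ∀ {A A' : Finset α}, ConnectedFrom N e A → ConnectedFrom N e A' → A ⊆ X →
      ω ∩ (A ∪ A.biUnion N ∩ X) = A → ω ∩ (A' ∪ A'.biUnion N ∩ X) = A' → A ∩ A' = A := by
    intro A A' hA hA' hAX h h'
    refine hA.2 _ Finset.inter_subset_left (Finset.mem_inter.2 ⟨hA.1, hA'.1⟩)
      fun b hb a ha hab => ?_
    have haω : a ∈ ω := by rw [← h] at ha; exact (Finset.mem_inter.1 ha).1
    refine Finset.mem_inter.2 ⟨ha, ?_⟩
    rw [← h']
    exact Finset.mem_inter.2 ⟨haω, Finset.mem_union_right _ (Finset.mem_inter.2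
      ⟨Finset.mem_biUnion.2 ⟨b, (Finset.mem_inter.1 hb).2, hab⟩, hAX ha⟩)⟩
  rw [← key hA hA' hAX h h', Finset.inter_comm, key hA' hA hAX' h' h]

/-- Connected sets that contain `e`, weighted by their size, have total weight at most one: each
bounds the probability that it is the component of `e` in site percolation. -/
theorem sum_connectedFrom_le (X : Finset α) (N : α → Finset α) (e : α) {Δ : ℕ} (hΔ : 1 ≤ Δ)
    (hN : ∀ x ∈ X, (N x).card ≤ Δ) :
    ∑ A ∈ X.powerset.filter (ConnectedFrom N e), (1 / (4 * Δ) : ℝ) ^ A.card ≤ 1 := by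
  have hΔ' : (1 : ℝ) ≤ Δ := by exact_mod_cast hΔ
  -- Keep each site with probability `y`: `w` is the law of the set of kept sites, and `G A` is the
  -- event that `A` is the component of `e`. These events are disjoint.
  set y : ℝ := 1 / (2 * Δ) with hy
  have hy0 : 0 < y := by positivity
  have hyΔ : y * Δ = 1 / 2 := by rw [hy]; field_simp
  have hy1 : y ≤ 1 / 2 := by nlinarith
  have hpow : 1 / 2 ≤ (1 - y) ^ Δ := by
    have := one_add_mul_le_pow (a := -y) (by linarith) Δ
    rw [← sub_eq_add_neg] at this
    linarith
  let w : Finset α → ℝ := fun ω => y ^ ω.card * (1 - y) ^ (X.card - ω.card)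
  have hw0 : ∀ ω, 0 ≤ w ω := fun ω => by
    have : 0 ≤ 1 - y := by linarith
    positivity
  have htot : ∑ ω ∈ X.powerset, w ω = 1 := by
    rw [Finset.sum_pow_mul_eq_add_pow, add_sub_cancel, one_pow]
  let Y : Finset α → Finset α := fun A => A ∪ A.biUnion N ∩ X
  let G : Finset α → Finset (Finset α) := fun A => X.powerset.filter fun ω => ω ∩ Y A = A
  calc ∑ A ∈ X.powerset.filter (ConnectedFrom N e), (1 / (4 * Δ) : ℝ) ^ A.card
      ≤ ∑ A ∈ X.powerset.filter (ConnectedFrom N e), ∑ ω ∈ G A, w ω := by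
        refine Finset.sum_le_sum fun A hA => ?_
        obtain ⟨hAX, -⟩ := Finset.mem_filter.1 hA
        rw [Finset.mem_powerset] at hAX
        have hYX : Y A ⊆ X := Finset.union_subset hAX Finset.inter_subset_right
        have hAY : A ⊆ Y A := Finset.subset_union_left
        have hdisj : ∀ ω ∈ (X \ Y A).powerset, Disjoint (Y A) ω := fun ω hω =>
          Finset.disjoint_of_subset_right (Finset.mem_powerset.1 hω) Finset.disjoint_sdiff
        have hsub : (X \ Y A).powerset.image (A ∪ ·) ⊆ G A := by
          intro ω hω
          obtain ⟨ω', hω', rfl⟩ := Finset.mem_image.1 hω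
          have hd := hdisj ω' hω'
          rw [Finset.mem_powerset] at hω'
          refine Finset.mem_filter.2 ⟨Finset.mem_powerset.2 (Finset.union_subset hAX
            (hω'.trans Finset.sdiff_subset)), ?_⟩
          rw [Finset.union_inter_distrib_right, Finset.inter_eq_left.2 hAY, Finset.inter_comm,
            Finset.disjoint_iff_inter_eq_empty.1 hd, Finset.union_empty]
        have hinj : Set.InjOn (A ∪ ·) ((X \ Y A).powerset : Set (Finset α)) := by
          intro ω hω ω' hω' h
          have h1 := (hdisj ω hω).mono_left hAY
          have h2 := (hdisj ω' hω').mono_left hAY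
          simp only at h
          rw [← Finset.union_sdiff_cancel_left h1, h, Finset.union_sdiff_cancel_left h2]
        have hcardY : (Y A).card ≤ A.card + Δ * A.card := by
          refine (Finset.card_union_le _ _).trans (Nat.add_le_add_left ?_ _)
          refine (Finset.card_le_card Finset.inter_subset_left).trans ?_
          rw [mul_comm]
          exact Finset.card_biUnion_le_card_mul _ _ _ fun a ha => hN a (hAX ha)
        have hXc : X.card = (Y A).card + (X \ Y A).card := by
          rw [Finset.card_sdiff_of_subset hYX, Nat.add_sub_cancel' (Finset.card_le_card hYX)]
        have hAc := Finset.card_le_card hAY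
        -- `A` must be kept and its at most Δ·|A| neighbours outside deleted. By Bernoulli (1-y)^Δ ≥
        -- 1/2, so this has probability at least (y/2)^|A|.
        calc (1 / (4 * Δ) : ℝ) ^ A.card = (y * (1 / 2)) ^ A.card := by
              congr 1; rw [hy]; field_simp; norm_num
          _ ≤ (y * (1 - y) ^ Δ) ^ A.card := by gcongr
          _ = y ^ A.card * (1 - y) ^ (Δ * A.card) := by rw [mul_pow, ← pow_mul]
          _ ≤ y ^ A.card * (1 - y) ^ ((Y A).card - A.card) := by
              refine mul_le_mul_of_nonneg_left ?_ (by positivity)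
              exact pow_le_pow_of_le_one (by linarith) (by linarith) (by omega)
          _ = y ^ A.card * (1 - y) ^ ((Y A).card - A.card) * ∑ ω ∈ (X \ Y A).powerset,
                y ^ ω.card * (1 - y) ^ ((X \ Y A).card - ω.card) := by
              rw [Finset.sum_pow_mul_eq_add_pow, add_sub_cancel, one_pow, mul_one]
          _ = ∑ ω ∈ (X \ Y A).powerset, w (A ∪ ω) := by
              rw [Finset.mul_sum]
              refine Finset.sum_congr rfl fun ω hω => ?_
              have h1 := Finset.card_union_of_disjoint ((hdisj ω hω).mono_left hAY)
              have h2 := Finset.card_le_card (Finset.mem_powerset.1 hω)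
              simp only [w]
              rw [h1, hXc, show (Y A).card + (X \ Y A).card - (A.card + ω.card) =
                ((Y A).card - A.card) + ((X \ Y A).card - ω.card) by omega, pow_add, pow_add]
              ring
          _ = ∑ ω ∈ (X \ Y A).powerset.image (A ∪ ·), w ω := (Finset.sum_image hinj).symm
          _ ≤ ∑ ω ∈ G A, w ω :=
              Finset.sum_le_sum_of_subset_of_nonneg hsub fun ω _ _ => hw0 ω
    _ = ∑ ω ∈ (X.powerset.filter (ConnectedFrom N e)).biUnion G, w ω := by
        refine (Finset.sum_biUnion fun A hA A' hA' hne => ?_).symm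
        rw [Function.onFun, Finset.disjoint_left]
        intro ω hω hω'
        rw [Finset.mem_coe, Finset.mem_filter, Finset.mem_powerset] at hA hA'
        exact hne (hA.2.eq_of_inter_eq hA'.2 hA.1 hA'.1 (Finset.mem_filter.1 hω).2
          (Finset.mem_filter.1 hω').2)
    _ ≤ ∑ ω ∈ X.powerset, w ω :=
        Finset.sum_le_sum_of_subset_of_nonneg
          (Finset.biUnion_subset.2 fun A _ => Finset.filter_subset _ _) fun ω _ _ => hw0 ω
    _ = 1 := htot

section Patterns

variable {β : Type*} {N : β → Finset β}

/-- An acyclic orientation can be recovered from a choice of at most one neighbour per element. -/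
lemma exists_code (n : ℕ) : ∀ B : Finset β, B.card = n →
    (∀ x ∈ B, ∀ y ∈ B, y ∈ N x → x ∈ N y) →
    ∃ code : (β → ℕ) → β → Option β,
      ∀ τ, (∀ x ∈ B, ∀ y ∈ B, y ∈ N x → τ x ≠ τ y) →
      (∀ x, code τ x = none ↔ x ∈ B → ∀ y ∈ B, y ∈ N x → τ x < τ y) ∧
      (∀ x y, code τ x = some y → x ∈ B ∧ y ∈ B ∧ y ∈ N x) ∧
      ∀ τ', (∀ x ∈ B, ∀ y ∈ B, y ∈ N x → τ' x ≠ τ' y) → code τ = code τ' →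
        ∀ x ∈ B, ∀ y ∈ B, y ∈ N x → (τ y < τ x ↔ τ' y < τ' x) := by
  induction n with
  | zero =>
    intro B hB _
    rw [Finset.card_eq_zero] at hB
    subst hB
    exact ⟨fun _ _ => none, fun τ _ => ⟨by simp, by simp, by simp⟩⟩
  | succ n ih =>
    intro B hB hsymm
    have hsub : ∀ m, ∀ x ∈ B.erase m, x ∈ B := fun m x hx => Finset.mem_of_mem_erase hx
    have ih' : ∀ m : β, ∃ code : (β → ℕ) → β → Option β, m ∈ B →
        ∀ τ, (∀ x ∈ B.erase m, ∀ y ∈ B.erase m, y ∈ N x → τ x ≠ τ y) →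
        (∀ x, code τ x = none ↔ x ∈ B.erase m → ∀ y ∈ B.erase m, y ∈ N x → τ x < τ y) ∧
        (∀ x y, code τ x = some y → x ∈ B.erase m ∧ y ∈ B.erase m ∧ y ∈ N x) ∧
        ∀ τ', (∀ x ∈ B.erase m, ∀ y ∈ B.erase m, y ∈ N x → τ' x ≠ τ' y) → code τ = code τ' →
          ∀ x ∈ B.erase m, ∀ y ∈ B.erase m, y ∈ N x → (τ y < τ x ↔ τ' y < τ' x) := by
      intro m
      by_cases hm : m ∈ B
      · obtain ⟨code, h⟩ := ih (B.erase m) (by rw [Finset.card_erase_of_mem hm, hB]; rfl)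
          fun x hx y hy => hsymm x (hsub m x hx) y (hsub m y hy)
        exact ⟨code, fun _ => h⟩
      · exact ⟨fun _ _ => none, fun h => absurd h hm⟩
    choose c hc using ih'
    have hBne : B.Nonempty := Finset.card_pos.1 (by omega)
    let pick : Finset β → β := fun s => if h : s.Nonempty then h.choose else hBne.choose
    have hpick : ∀ s : Finset β, s.Nonempty → pick s ∈ s := fun s h => by
      simp only [pick, dif_pos h]; exact h.choose_spec
    -- Remove one source `m` that depends on the set of sources only, and let elements that become
    -- sources by this point to `m`. Since `none` marks the sources, the code determines `m`, and
    -- the decoding can recurse.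
    let src : (β → ℕ) → Finset β := fun τ => B.filter fun x => ∀ y ∈ B, y ∈ N x → τ x < τ y
    let m : (β → ℕ) → β := fun τ => pick (src τ)
    let code : (β → ℕ) → β → Option β := fun τ x =>
      if x ∈ B.erase (m τ) then
        if c (m τ) τ x = none then if m τ ∈ N x then some (m τ) else none else c (m τ) τ x
      else none
    have hm : ∀ τ, (∀ x ∈ B, ∀ y ∈ B, y ∈ N x → τ x ≠ τ y) → m τ ∈ src τ := by
      intro τ hτ
      refine hpick _ ?_
      obtain ⟨x, hx, hmin⟩ := B.exists_min_image τ hBne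
      exact ⟨x, Finset.mem_filter.2 ⟨hx, fun y hy hyx =>
        lt_of_le_of_ne (hmin y hy) (hτ x hx y hy hyx)⟩⟩
    have hsrc : ∀ τ, (∀ x ∈ B, ∀ y ∈ B, y ∈ N x → τ x ≠ τ y) →
        ∀ x, code τ x = none ↔ x ∈ B → ∀ y ∈ B, y ∈ N x → τ x < τ y := by
      intro τ hτ x
      have hmτ := Finset.mem_filter.1 (hm τ hτ)
      obtain ⟨h1, h2, -⟩ := hc (m τ) hmτ.1 τ fun x hx y hy => hτ x (hsub _ x hx) y (hsub _ y hy)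
      simp only [code]
      by_cases hx : x ∈ B.erase (m τ)
      · have hxB := hsub _ x hx
        rw [if_pos hx]
        split_ifs with h3 h4
        · simp only [false_iff]
          intro h5
          exact lt_asymm (h5 hxB _ hmτ.1 h4) (hmτ.2 x hxB (hsymm x hxB _ hmτ.1 h4))
        · simp only [true_iff]
          intro _ y hy hyx
          have hne : y ≠ m τ := fun h => h4 (h ▸ hyx)
          exact (h1 x).1 h3 hx y (Finset.mem_erase.2 ⟨hne, hy⟩) hyx
        · rw [h1 x]
          refine ⟨fun h => absurd ((h1 x).2 h) h3, fun h _ y hy => h hxB y (hsub _ y hy)⟩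
      · rw [if_neg hx]
        simp only [true_iff]
        intro hxB
        have : x = m τ := by by_contra h; exact hx (Finset.mem_erase.2 ⟨h, hxB⟩)
        exact this ▸ hmτ.2
    refine ⟨code, fun τ hτ => ⟨hsrc τ hτ, fun x y hxy => ?_, fun τ' hτ' h x hx y hy hyx => ?_⟩⟩
    · have hmτ := Finset.mem_filter.1 (hm τ hτ)
      obtain ⟨-, h2, -⟩ := hc (m τ) hmτ.1 τ fun x hx y hy => hτ x (hsub _ x hx) y (hsub _ y hy)
      simp only [code] at hxy
      split_ifs at hxy with h3 h4 h5
      · rw [Option.some_inj] at hxy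
        exact ⟨hsub _ _ h3, hxy ▸ hmτ.1, hxy ▸ h5⟩
      · obtain ⟨h6, h7, h8⟩ := h2 x y hxy
        exact ⟨hsub _ _ h6, hsub _ _ h7, h8⟩
    · have hmm : m τ = m τ' := by
        simp only [m]
        congr 1
        refine Finset.filter_congr fun x hx => ?_
        have h1 := hsrc τ hτ x
        rw [h, hsrc τ' hτ' x] at h1
        exact ⟨fun h2 => h1.2 (fun _ => h2) hx, fun h2 => h1.1 (fun _ => h2) hx⟩
      have hmτ := Finset.mem_filter.1 (hm τ hτ)
      have hmτ' := Finset.mem_filter.1 (hm τ' hτ')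
      have hτm := fun x (hx : x ∈ B.erase (m τ)) y (hy : y ∈ B.erase (m τ)) =>
        hτ x (hsub _ x hx) y (hsub _ y hy)
      have hτm' := fun x (hx : x ∈ B.erase (m τ)) y (hy : y ∈ B.erase (m τ)) =>
        hτ' x (hsub _ x hx) y (hsub _ y hy)
      have hC := hc (m τ) hmτ.1 τ hτm
      have hC' := hc (m τ) hmτ.1 τ' hτm'
      have hdec : ∀ τ, (∀ x ∈ B.erase (m τ), ∀ y ∈ B.erase (m τ), y ∈ N x → τ x ≠ τ y) →
          m τ ∈ B → ∀ z, c (m τ) τ z = if code τ z = some (m τ) then none else code τ z := by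
        intro τ hτ hmB z
        obtain ⟨h1, h2, -⟩ := hc (m τ) hmB τ hτ
        simp only [code]
        have h5 : c (m τ) τ z ≠ some (m τ) := fun h => (Finset.mem_erase.1 (h2 _ _ h).2.1).1 rfl
        by_cases hz : z ∈ B.erase (m τ)
        · rw [if_pos hz]
          by_cases h3 : c (m τ) τ z = none
          · rw [if_pos h3, h3]
            by_cases h4 : m τ ∈ N z
            · rw [if_pos h4, if_pos rfl]
            · rw [if_neg h4, ite_self]
          · rw [if_neg h3, if_neg h5]
        · rw [if_neg hz]
          rw [ite_self]
          exact (h1 z).2 fun h => absurd h hz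
      have hcc : c (m τ) τ = c (m τ) τ' := by
        funext z
        have h1 := hdec τ hτm hmτ.1 z
        have h2 := hdec τ' (hmm ▸ hτm') hmτ'.1 z
        rw [← hmm] at h2
        rw [h1, h2, h]
      by_cases hxm : x = m τ
      · rw [hxm] at hyx ⊢
        have h2 := hmτ'.2
        rw [← hmm] at h2
        exact ⟨fun h3 => absurd (hmτ.2 y hy hyx) h3.asymm, fun h3 => absurd (h2 y hy hyx) h3.asymm⟩
      · by_cases hym : y = m τ
        · rw [hym] at hyx ⊢
          have h2 := hmτ'.2
          rw [← hmm] at h2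
          have hxN := hsymm x hx _ hmτ.1 hyx
          exact ⟨fun _ => h2 x hx hxN, fun _ => hmτ.2 x hx hxN⟩
        · exact hC.2.2 τ' hτm' hcc x (Finset.mem_erase.2 ⟨hxm, hx⟩) y
            (Finset.mem_erase.2 ⟨hym, hy⟩) hyx

/-- There are few acyclic orientations of a graph of bounded degree. -/
lemma exists_orientations (B : Finset β) {D : ℕ} (hD : ∀ x ∈ B, (N x).card ≤ D)
    (hsymm : ∀ x ∈ B, ∀ y ∈ B, y ∈ N x → x ∈ N y) :
    ∃ T : Finset (β → ℕ), T.card ≤ (D + 1) ^ B.card ∧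
      ∀ τ : β → ℕ, (∀ x ∈ B, ∀ y ∈ B, y ∈ N x → τ x ≠ τ y) →
        ∃ τ' ∈ T, ∀ x ∈ B, ∀ y ∈ B, y ∈ N x → (τ y < τ x ↔ τ' y < τ' x) := by
  obtain ⟨code, hcode⟩ := exists_code B.card B rfl hsymm
  let free : (β → ℕ) → Prop := fun τ => ∀ x ∈ B, ∀ y ∈ B, y ∈ N x → τ x ≠ τ y
  let codes : Finset ((x : β) → x ∈ B → Option β) :=
    B.pi fun x => insert none ((N x).image some)
  let f : (β → ℕ) → (x : β) → x ∈ B → Option β := fun τ x _ => code τ x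
  let g : ((x : β) → x ∈ B → Option β) → β → ℕ := fun k =>
    Classical.epsilon fun τ => free τ ∧ f τ = k
  refine ⟨codes.image g, Finset.card_image_le.trans ?_, fun τ hτ => ?_⟩
  · rw [Finset.card_pi]
    refine Finset.prod_le_pow_card _ _ _ fun x hx => ?_
    exact (Finset.card_insert_le _ _).trans (Nat.add_le_add_right
      (Finset.card_image_le.trans (hD x hx)) _)
  · have h1 : f τ ∈ codes := by
      refine Finset.mem_pi.2 fun x hx => ?_
      cases h : code τ x with
      | none => simp [f, h]
      | some y => simp [f, h, ((hcode τ hτ).2.1 x y h).2.2]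
    have h2 : free (g (f τ)) ∧ f (g (f τ)) = f τ :=
      Classical.epsilon_spec (p := fun τ' => free τ' ∧ f τ' = f τ) ⟨τ, hτ, rfl⟩
    refine ⟨_, Finset.mem_image_of_mem g h1, (hcode τ hτ).2.2 _ h2.1 (funext fun x => ?_)⟩
    by_cases hx : x ∈ B
    · exact (congrFun (congrFun h2.2 x) hx).symm
    · rw [((hcode τ hτ).1 x).2 (absurd · hx), ((hcode _ h2.1).1 x).2 (absurd · hx)]

/-- There are few ways in which a rank function can order neighbours. -/
theorem exists_patterns (A : Finset α) {N : α → Finset α} {D : ℕ} (hD : ∀ x ∈ A, (N x).card ≤ D)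
    (hsymm : ∀ x ∈ A, ∀ y ∈ A, y ∈ N x → x ∈ N y) :
    ∃ T : Finset (α → Finset α), T.card ≤ (D + 1) ^ (2 * A.card) ∧
      ∀ ρ : α → ℕ, ∃ S ∈ T, ∀ x ∈ A, S x = A.filter fun y => y ∈ N x ∧ ρ y < ρ x := by
  -- Ranks of neighbours may be equal, whereas an orientation has no ties. On the bipartite double
  -- cover the values 2ρ and 2ρ+1 never tie, and 2ρ(y)+1 < 2ρ(x) means ρ(y) < ρ(x). The doubling
  -- accounts for the exponent `2 * A.card`.
  let N' : α × Bool → Finset (α × Bool) := fun x => (N x.1).image fun y => (y, !x.2)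
  obtain ⟨T, hT, hT'⟩ := exists_orientations (A ×ˢ (Finset.univ : Finset Bool)) (N := N') (D := D)
    (fun x hx => Finset.card_image_le.trans (hD _ (Finset.mem_product.1 hx).1))
    (by
      rintro ⟨x, a⟩ hx ⟨y, b⟩ hy h
      simp only [N', Finset.mem_image, Prod.mk.injEq] at h ⊢
      obtain ⟨z, hz, rfl, rfl⟩ := h
      exact ⟨x, hsymm _ (Finset.mem_product.1 hx).1 _ (Finset.mem_product.1 hy).1 hz, rfl, by simp⟩)
  refine ⟨T.image fun τ x => A.filter fun y => y ∈ N x ∧ τ (y, true) < τ (x, false),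
    Finset.card_image_le.trans ?_, fun ρ => ?_⟩
  · rwa [Finset.card_product, Finset.card_univ, Fintype.card_bool, mul_comm] at hT
  · obtain ⟨τ, hτ, h⟩ := hT' (fun x => 2 * ρ x.1 + if x.2 then 1 else 0) (by
      rintro ⟨x, a⟩ - ⟨y, b⟩ - h
      simp only [N', Finset.mem_image, Prod.mk.injEq] at h
      obtain ⟨z, hz, rfl, rfl⟩ := h
      cases a <;> simp <;> omega)
    refine ⟨_, Finset.mem_image_of_mem _ hτ, fun x hx => Finset.filter_congr fun y hy => ?_⟩
    refine and_congr_right fun hyx => ?_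
    have := h (x, false) (by simp [hx]) (y, true) (by simp [hy]) (by simp [N', hyx])
    rw [← this]
    simp
    omega

end Patterns
end Combinatorics

/-! ### Cascades: local witnesses for large clusters, and their probability. -/

namespace World

/-- The world with the same events but other uniform numbers. -/
def withVal (W : World) (u : Assignment) : World := ⟨W.events, u⟩

variable {W W' : World} {c : Params} {M s ρ : ℕ} {e f g : EventSpec} {A I S X : Finset EventSpec}
  {u : Assignment}

lemma ball_withVal (r : ℕ) (e : EventSpec) : (W.withVal u).ball r e = W.ball r e := by
  induction r with
  | zero => rfl
  | succ r ih => rw [ball, ball, ih]; rfl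

/-- A set of functions that contains all `S x = {y ∈ A ∩ ball 2 x | ρ y < ρ x}`. -/
noncomputable def patterns (W : World) (d : ℕ) (A : Finset EventSpec) :
    Finset (EventSpec → Finset EventSpec) :=
  Classical.epsilon fun T => T.card ≤ ((d + 1) ^ 2 + 1) ^ (2 * A.card) ∧
    ∀ ρ : EventSpec → ℕ, ∃ S ∈ T, ∀ x ∈ A, S x = A.filter fun y => y ∈ W.ball 2 x ∧ ρ y < ρ x

lemma patterns_spec {d : ℕ} (hd : ∀ e ∈ W.events, (W.nb e).card ≤ d + 1) (hA : A ⊆ W.events) :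
    (W.patterns d A).card ≤ ((d + 1) ^ 2 + 1) ^ (2 * A.card) ∧
    ∀ ρ : EventSpec → ℕ, ∃ S ∈ W.patterns d A, ∀ x ∈ A,
      S x = A.filter fun y => y ∈ W.ball 2 x ∧ ρ y < ρ x :=
  Classical.epsilon_spec (p := fun T : Finset (EventSpec → Finset EventSpec) =>
    T.card ≤ ((d + 1) ^ 2 + 1) ^ (2 * A.card) ∧ ∀ ρ : EventSpec → ℕ, ∃ S ∈ T, ∀ x ∈ A,
      S x = A.filter fun y => y ∈ W.ball 2 x ∧ ρ y < ρ x)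
    (exists_patterns A (fun _ hx => card_ball_le hd (hA hx))
      fun _ hx _ _ h => mem_ball_comm (hA hx) h)

/-- The event `f` is likely when the neighbourhoods of all events in `S` are resampled. -/
def dangerSet (W : World) (c : Params) (f : EventSpec) (S : Finset EventSpec) : Set Assignment :=
  {u | c.θ < resampled (W.freed S) (occurs f) u}

/-- Most events in some connected subset of `X` that contains `e` and at least `s` events are
dangerous with respect to the earlier events of this subset. -/
def cascade (W : World) (c : Params) (s : ℕ) (e : EventSpec) (X : Finset EventSpec) :
    Set Assignment :=
  ⋃ A ∈ X.powerset.filter (fun A => ConnectedFrom (W.ball 4) e A ∧ s ≤ A.card),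
    ⋃ I ∈ A.powerset.filter (fun I : Finset EventSpec =>
      (I : Set EventSpec).PairwiseDisjoint EventSpec.vars ∧ 14 * A.card ≤ 15 * I.card),
    ⋃ S ∈ W.patterns c.d A, ⋂ f ∈ I, W.dangerSet c f (S f)

lemma mem_cascade (hd : ∀ e ∈ W.events, (W.nb e).card ≤ c.d + 1) (hX : X ⊆ W.events)
    (hA : A ⊆ X) (hconn : ConnectedFrom (W.ball 4) e A) (hs : s ≤ A.card) (hI : I ⊆ A)
    (hdisj : (I : Set EventSpec).PairwiseDisjoint EventSpec.vars)
    (hcard : 14 * A.card ≤ 15 * I.card) (ρ : EventSpec → ℕ)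
    (h : ∀ f ∈ I, W.Danger c.θ f (A.filter fun y => y ∈ W.ball 2 f ∧ ρ y < ρ f)) :
    W.val ∈ W.cascade c s e X := by
  obtain ⟨S, hS, hSρ⟩ := (patterns_spec hd (hA.trans hX)).2 ρ
  simp only [cascade, Set.mem_iUnion]
  refine ⟨A, Finset.mem_filter.2 ⟨Finset.mem_powerset.2 hA, hconn, hs⟩, I,
    Finset.mem_filter.2 ⟨Finset.mem_powerset.2 hI, hdisj, hcard⟩, S, hS,
    Set.mem_iInter₂.2 fun f hf => ?_⟩
  have := h f hf
  rw [← hSρ f (hI hf)] at this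
  exact this

lemma connectedFrom_clusterBall (he : e ∈ W.active c.θ) {i : ℕ}
    (h : ∀ f ∈ W.clusterBall c.θ i e, W'.ball 4 f = W.ball 4 f) :
    ConnectedFrom (W'.ball 4) e (W.clusterBall c.θ i e) := by
  have hmono : ∀ {j k}, j ≤ k → W.clusterBall c.θ j e ⊆ W.clusterBall c.θ k e := fun hjk =>
    monotone_nat_of_le_succ (f := fun i => W.clusterBall c.θ i e)
      (fun _ => clusterBall_subset_succ he) hjk
  refine ⟨self_mem_clusterBall he, fun B hB heB hcl => hB.antisymm ?_⟩
  have : ∀ j ≤ i, W.clusterBall c.θ j e ⊆ B := by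
    intro j
    induction j with
    | zero => exact fun _ => by simpa [clusterBall] using heB
    | succ j ih =>
      intro hj g hg
      obtain ⟨-, f, hf, hgf⟩ := mem_clusterBall_succ.1 hg
      refine hcl f (ih (by omega) hf) g (hmono hj hg) ?_
      rwa [h f (hmono (by omega) hf)]
  exact this i le_rfl

/-- If all layers from `s` to `2 * s` grew by more than the factor 15/14, the cluster would exceed
`M`. -/
lemma exists_slow_growth (hW : Good c M W) (hM : M * 14 ^ s < 15 ^ s) (he : e ∈ W.active c.θ) :
    ∃ i, s ≤ i ∧ i < 2 * s ∧
      14 * (W.clusterBall c.θ (i + 1) e).card ≤ 15 * (W.clusterBall c.θ i e).card := by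
  by_contra! h
  have : ∀ k ≤ s, 15 ^ k ≤ 14 ^ k * (W.clusterBall c.θ (s + k) e).card := by
    intro k
    induction k with
    | zero =>
      intro _
      have := Finset.card_pos.2 ⟨e, self_mem_clusterBall (i := s) he⟩
      simpa using this
    | succ k ih =>
      intro hk
      have h1 := h (s + k) (by omega) (by omega)
      have h2 := ih (by omega)
      rw [add_assoc] at h1
      calc 15 ^ (k + 1) = 15 * 15 ^ k := by ring
        _ ≤ 15 * (14 ^ k * (W.clusterBall c.θ (s + k) e).card) := by gcongr
        _ = 14 ^ k * (15 * (W.clusterBall c.θ (s + k) e).card) := by ring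
        _ ≤ 14 ^ k * (14 * (W.clusterBall c.θ (s + (k + 1)) e).card) := by gcongr
        _ = _ := by ring
  have h1 := this s le_rfl
  have h2 : (W.clusterBall c.θ (s + s) e).card ≤ M :=
    (Finset.card_le_card (clusterBall_subset_cluster he)).trans (hW.card_le e he)
  have h3 : 14 ^ s * (W.clusterBall c.θ (s + s) e).card ≤ 14 ^ s * M := by gcongr
  rw [mul_comm M] at hM
  omega

/-- A suspect event comes with a cascade. -/
theorem mem_cascade_of_suspect (hd : ∀ e ∈ W.events, (W.nb e).card ≤ c.d + 1)
    (hM : M * 14 ^ s < 15 ^ s) (hρ : 8 * s + 4 ≤ ρ) (h : Suspect c M s ρ W e) :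
    W.val ∈ W.cascade c s e (W.ball (8 * s) e) := by
  obtain ⟨W', hW', hag, he, hs⟩ := h
  -- The cluster of `W'` may leave the region of agreement, so it is cut at layer `i + 1`. Only
  -- events up to layer `i` are tested for danger; slow growth makes them a 14/15 fraction of the
  -- whole.
  obtain ⟨i, hi, hi', hcard⟩ := exists_slow_growth hW' hM he
  have hsub := clusterBall_subset_succ (i := i) he
  have hact := clusterBall_subset_active (i := i + 1) he
  have hball : ∀ g ∈ W'.clusterBall c.θ (i + 1) e, g ∈ W.ball (8 * s) e := fun g hg => by
    rw [hag.ball_eq (by omega)]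
    exact ball_mono hag.same.2.1 (by omega) (clusterBall_subset_ball hg)
  have hagree : ∀ g ∈ W'.clusterBall c.θ (i + 1) e, Agree W W' 4 g := fun g hg =>
    hag.of_mem (hball g hg) (by omega)
  have hE := ball_subset_events (r := 8 * s) hag.1
  refine mem_cascade hd hE hball
    (connectedFrom_clusterBall he fun f hf => (hagree f hf).ball_eq (by omega)) ?_ hsub
    (fun f hf g hg hne => disjoint_of_active hW'.toValid (hact (hsub hf)) (hact (hsub hg)) hne)
    hcard (W'.rank c.θ) fun f hf => ?_
  · refine le_trans ?_ (Finset.card_le_card hsub)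
    rcases clusterBall_eq_or_lt_card (i := i) he with h | h
    · rwa [h]
    · omega
  -- All active events within distance 2 of `f` lie in layer `i + 1`, so the earlier ones among them
  -- are exactly what the pattern at `f` records.
  · have hfA := hagree f (hsub hf)
    refine (danger_congr ((Finset.filter_subset _ _).trans fun g hg => hE (hball g hg))
      stage_subset_events (hfA.mono (by omega)) fun g hg => ?_).2 (danger_rank (hact (hsub hf)))
    rw [Finset.mem_filter, mem_stage_iff]
    refine ⟨fun h => ⟨hact h.1, h.2.2⟩, fun h => ⟨mem_clusterBall_succ.2 ⟨h.1, f, hf, ?_⟩, hg, h.2⟩⟩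
    rw [← hfA.ball_eq (by omega)]
    exact ball_mono hfA.1 (by omega) hg

/-- A component that is too large is a cascade. -/
theorem exists_mem_cascade_of_not_good (hW : W.Valid c) (h : ¬ Good c M W) :
    ∃ e ∈ W.events, W.val ∈ W.cascade c (M + 1) e W.events := by
  have : ∃ e ∈ W.active c.θ, M < (W.cluster c.θ e).card := by
    by_contra! h'
    exact h ⟨hW, h'⟩
  obtain ⟨e, he, hM⟩ := this
  refine ⟨e, active_subset_events he, ?_⟩
  have hcl : W.clusterBall c.θ (W.cluster c.θ e).card e = W.cluster c.θ e := by
    refine (clusterBall_eq_or_lt_card he).resolve_right fun h => ?_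
    exact absurd h (not_lt.2 (Finset.card_le_card (clusterBall_subset_cluster he)))
  refine mem_cascade hW.deg subset_rfl (cluster_subset_active.trans active_subset_events)
    (hcl ▸ connectedFrom_clusterBall he fun _ _ => rfl) hM subset_rfl
    (fun f hf g hg hne => disjoint_of_active hW (cluster_subset_active hf)
      (cluster_subset_active hg) hne) (by omega) (W.rank c.θ) fun f hf => ?_
  have hfE := active_subset_events (cluster_subset_active hf)
  refine (danger_congr ((Finset.filter_subset _ _).trans
    (cluster_subset_active.trans active_subset_events)) stage_subset_events (agree_refl hfE)
    fun g hg => ?_).2 (danger_rank (cluster_subset_active hf))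
  rw [Finset.mem_filter, mem_stage_iff]
  refine ⟨fun h => ⟨cluster_subset_active h.1, h.2.2⟩, fun h => ⟨?_, hg, h.2⟩⟩
  rw [← cluster_eq hf]
  exact mem_cluster_of_mem_ball_le (cluster_subset_active hf) h.1 (by omega) hg

lemma cascade_withVal : (W.withVal u).cascade c s e X = W.cascade c s e X := by
  have hb : (W.withVal u).ball = W.ball := by funext r e; exact ball_withVal r e
  unfold cascade patterns
  rw [hb]
  rfl

lemma measurableSet_dangerSet (h : MeasurableSet (occurs f)) :
    MeasurableSet (W.dangerSet c f S) :=
  measurableSet_lt measurable_const (measurable_resampled _ h)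

lemma measurableSet_cascade (hX : ∀ f ∈ X, MeasurableSet (occurs f)) :
    MeasurableSet (W.cascade c s e X) := by
  refine Finset.measurableSet_biUnion _ fun A hA => Finset.measurableSet_biUnion _ fun I hI =>
    Finset.measurableSet_biUnion _ fun S _ => Finset.measurableSet_biInter _ fun f hf =>
      measurableSet_dangerSet (hX f ?_)
  rw [Finset.mem_filter, Finset.mem_powerset] at hA hI
  exact hA.1 (hI.1 hf)

lemma determinedBy_cascade : DeterminedBy (W.cascade c s e X) {x | ∃ f ∈ X, x ∈ f.vars} := by
  intro u u' h
  simp only [cascade, Set.mem_iUnion, Set.mem_iInter]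
  refine exists_congr fun A => exists_congr fun hA => exists_congr fun I => exists_congr fun hI =>
    exists_congr fun S => exists_congr fun _ => forall₂_congr fun f hf =>
    determinedBy_lt_resampled (determinedBy_occurs f) _ _ _ fun x hx => h x ⟨f, ?_, hx⟩
  rw [Finset.mem_filter, Finset.mem_powerset] at hA hI
  exact hA.1 (hI.1 hf)

/-- Events with disjoint sets of variables are rarely all dangerous. -/
lemma unif_iInter_dangerSet_le (hm : ∀ f ∈ I, MeasurableSet (occurs f))
    (hp : ∀ f ∈ I, unif (occurs f) ≤ c.p)
    (hdisj : (I : Set EventSpec).PairwiseDisjoint EventSpec.vars)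
    (S : EventSpec → Finset EventSpec) :
    unif (⋂ f ∈ I, W.dangerSet c f (S f)) ≤ (c.p / c.θ) ^ I.card := by
  rw [unif_biInter I _ (fun f => (f.vars : Set ℕ)) (fun f hf => measurableSet_dangerSet (hm f hf))
    (fun f _ => determinedBy_lt_resampled (determinedBy_occurs f) _)
    fun f hf g hg hne => Finset.disjoint_coe.2 (hdisj hf hg hne)]
  refine Finset.prod_le_pow_card _ _ _ fun f hf => ?_
  refine (unif_lt_resampled_le _ (hm f hf) c.pos.ne' c.ne_top).trans ?_
  gcongr
  exact hp f hf

lemma sum_powerset_le (A : Finset EventSpec) (P : Finset EventSpec → Prop)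
    [DecidablePred P] (b : ℝ≥0∞) :
    ∑ _I ∈ A.powerset.filter P, b ≤ 2 ^ A.card * b := by
  rw [Finset.sum_const, nsmul_eq_mul]
  gcongr
  have := Finset.card_le_card (Finset.filter_subset P A.powerset)
  rw [Finset.card_powerset] at this
  exact_mod_cast this

/-- Converts a bound per tested event into one per event of `A`, at the price of the exponent 14/15.
Comparing 14th powers avoids roots. -/
lemma pow_card_le {w : ℝ≥0∞} (hle : w ≤ 1) (hw : (c.p / c.θ) ^ 14 ≤ w ^ 15)
    (hAI : 14 * A.card ≤ 15 * I.card) : (c.p / c.θ) ^ I.card ≤ w ^ A.card := by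
  have h1 : ((c.p / c.θ) ^ I.card) ^ 14 ≤ (w ^ A.card) ^ 14 := by
    calc ((c.p / c.θ) ^ I.card) ^ 14 = ((c.p / c.θ) ^ 14) ^ I.card := pow_right_comm _ _ _
      _ ≤ (w ^ 15) ^ I.card := by gcongr
      _ = w ^ (15 * I.card) := (pow_mul _ _ _).symm
      _ ≤ w ^ (14 * A.card) := pow_le_pow_right_of_le_one' hle hAI
      _ = _ := by rw [mul_comm, pow_mul]
  exact (ENNReal.pow_le_pow_left_iff (by norm_num)).1 h1

/-- The part of a cascade in which the connected set is `A` is rare. -/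
lemma unif_cascade_part_le (hd : ∀ e ∈ W.events, (W.nb e).card ≤ c.d + 1)
    (hA : A ⊆ W.events) (hm : ∀ f ∈ A, MeasurableSet (occurs f))
    (hp : ∀ f ∈ A, unif (occurs f) ≤ c.p) {w : ℝ} (h0 : 0 ≤ w) (h1 : w ≤ 1)
    (hw : (c.p / c.θ) ^ 14 ≤ ENNReal.ofReal w ^ 15) :
    unif (⋃ I ∈ A.powerset.filter (fun I : Finset EventSpec =>
      (I : Set EventSpec).PairwiseDisjoint EventSpec.vars ∧ 14 * A.card ≤ 15 * I.card),
      ⋃ S ∈ W.patterns c.d A, ⋂ f ∈ I, W.dangerSet c f (S f)) ≤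
    ENNReal.ofReal ((2 * (((c.d + 1) ^ 2 + 1) ^ 2) * w) ^ A.card) := by
  obtain ⟨b, hb⟩ : ∃ b : ℝ≥0∞,
    b = (((c.d + 1) ^ 2 + 1) ^ (2 * A.card) : ℕ) * ENNReal.ofReal w ^ A.card := ⟨_, rfl⟩
  have hI : ∀ I ∈ A.powerset.filter (fun I : Finset EventSpec =>
      (I : Set EventSpec).PairwiseDisjoint EventSpec.vars ∧ 14 * A.card ≤ 15 * I.card),
      unif (⋃ S ∈ W.patterns c.d A, ⋂ f ∈ I, W.dangerSet c f (S f)) ≤ b := by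
    intro I hI
    rw [Finset.mem_filter, Finset.mem_powerset] at hI
    have h2 : ∀ S ∈ W.patterns c.d A, unif (⋂ f ∈ I, W.dangerSet c f (S f)) ≤
        ENNReal.ofReal w ^ A.card := fun S _ =>
      (unif_iInter_dangerSet_le (fun f hf => hm f (hI.1 hf)) (fun f hf => hp f (hI.1 hf))
        hI.2.1 S).trans (pow_card_le (ENNReal.ofReal_le_one.2 h1) hw hI.2.2)
    refine (measure_biUnion_finset_le _ _).trans ((Finset.sum_le_card_nsmul _ _ _ h2).trans ?_)
    rw [nsmul_eq_mul, hb]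
    exact mul_le_mul_left (Nat.cast_le.2 (patterns_spec hd hA).1) _
  refine (measure_biUnion_finset_le _ _).trans ((Finset.sum_le_sum hI).trans
    ((sum_powerset_le A _ b).trans_eq ?_))
  have e1 : (2 : ℝ≥0∞) ^ A.card = ENNReal.ofReal (2 ^ A.card) := by
    rw [ENNReal.ofReal_pow (by norm_num)]; norm_num
  have e2 : ((((c.d + 1) ^ 2 + 1) ^ (2 * A.card) : ℕ) : ℝ≥0∞) =
      ENNReal.ofReal ((((c.d + 1) ^ 2 + 1) ^ 2) ^ A.card) := by
    rw [← pow_mul, ← ENNReal.ofReal_natCast]; push_cast; rfl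
  rw [hb, mul_pow, mul_pow, mul_assoc, ENNReal.ofReal_mul (by positivity),
    ENNReal.ofReal_mul (by positivity), ENNReal.ofReal_pow h0, e1, e2]

/-- Cascades are rare. -/
theorem unif_cascade_le (hd : ∀ e ∈ W.events, (W.nb e).card ≤ c.d + 1)
    (hX : X ⊆ W.events) (hm : ∀ f ∈ X, MeasurableSet (occurs f))
    (hp : ∀ f ∈ X, unif (occurs f) ≤ c.p) {w z : ℝ}
    (h0 : 0 ≤ w) (h1 : w ≤ 1) (hz0 : 0 ≤ z) (hz1 : z ≤ 1)
    (hw : (c.p / c.θ) ^ 14 ≤ ENNReal.ofReal w ^ 15)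
    (hwz : 4 * ((c.d + 1) ^ 4 : ℝ) * (2 * (((c.d + 1) ^ 2 + 1) ^ 2) * w) ≤ z) :
    unif (W.cascade c s e X) ≤ ENNReal.ofReal (z ^ s) := by
  obtain ⟨Δ, hΔ⟩ : ∃ Δ : ℕ, Δ = (c.d + 1) ^ 4 := ⟨_, rfl⟩
  have hΔ1 : 1 ≤ Δ := hΔ ▸ Nat.one_le_pow _ _ (by omega)
  have hΔ0 : (0 : ℝ) < 4 * Δ := by positivity
  have hsum := sum_connectedFrom_le X (W.ball 4) e hΔ1
    fun x hx => hΔ ▸ card_ball_le hd (hX hx)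
  -- Each event of `A` pays 1/(4Δ) for the sum over connected sets and has a factor `z` to spare; at
  -- least `s` events give `z ^ s`.
  have hbase : 2 * (((c.d + 1 : ℝ) ^ 2 + 1) ^ 2) * w ≤ 1 / (4 * Δ) * z := by
    rw [one_div, inv_mul_eq_div, le_div_iff₀ hΔ0, mul_comm, hΔ]
    push_cast
    exact hwz
  have hb0 : 0 ≤ 2 * (((c.d + 1 : ℝ) ^ 2 + 1) ^ 2) * w := by positivity
  have hpart : ∀ A ∈ X.powerset.filter (fun A => ConnectedFrom (W.ball 4) e A ∧ s ≤ A.card),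
      unif (⋃ I ∈ A.powerset.filter (fun I : Finset EventSpec =>
        (I : Set EventSpec).PairwiseDisjoint EventSpec.vars ∧ 14 * A.card ≤ 15 * I.card),
        ⋃ S ∈ W.patterns c.d A, ⋂ f ∈ I, W.dangerSet c f (S f)) ≤
      ENNReal.ofReal ((1 / (4 * Δ) : ℝ) ^ A.card * z ^ s) := by
    intro A hA
    rw [Finset.mem_filter, Finset.mem_powerset] at hA
    refine (unif_cascade_part_le hd (hA.1.trans hX) (fun f hf => hm f (hA.1 hf))
      (fun f hf => hp f (hA.1 hf)) h0 h1 hw).trans (ENNReal.ofReal_le_ofReal ?_)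
    refine (pow_le_pow_left₀ hb0 hbase _).trans ?_
    rw [mul_pow]
    exact mul_le_mul_of_nonneg_left (pow_le_pow_of_le_one hz0 hz1 hA.2.2) (by positivity)
  refine (measure_biUnion_finset_le _ _).trans ((Finset.sum_le_sum hpart).trans ?_)
  rw [← ENNReal.ofReal_sum_of_nonneg fun _ _ => by positivity, ← Finset.sum_mul]
  refine ENNReal.ofReal_le_ofReal (mul_le_of_le_one_left (by positivity) ?_)
  refine (Finset.sum_le_sum_of_subset_of_nonneg ?_ fun _ _ _ => by positivity).trans hsum
  intro A hA
  rw [Finset.mem_filter] at hA ⊢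
  exact ⟨hA.1, hA.2.1⟩

end World

/-! ### Uniform samples from pooled private randomness. -/

section Pooled

variable {V : Type}

lemma pooled_le_iff {H : Finset V} (hH : H.Nonempty) {a b : unitInterval} (hb : b ^ H.card = a)
    (y : V → unitInterval) : pooled (H.val.map y) ≤ a ↔ ∀ v ∈ H, y v ≤ b := by
  have h1 : pooled (H.val.map y) = H.sup y ^ H.card := by
    rw [pooled, Multiset.card_map]; rfl
  have h2 : ∀ a b : unitInterval, a ^ H.card ≤ b ^ H.card ↔ a ≤ b := fun a b => by
    rw [← Subtype.coe_le_coe, ← Subtype.coe_le_coe, Set.Icc.coe_pow, Set.Icc.coe_pow]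
    exact pow_le_pow_iff_left₀ a.2.1 b.2.1 (Finset.card_ne_zero.2 hH)
  rw [h1, ← hb, h2, Finset.sup_le_iff]

lemma exists_pow_eq {m : ℕ} (hm : m ≠ 0) (a : unitInterval) : ∃ b : unitInterval, b ^ m = a := by
  refine ⟨⟨(a : ℝ) ^ (1 / m : ℝ), Real.rpow_nonneg a.2.1 _,
    Real.rpow_le_one a.2.1 a.2.2 (by positivity)⟩, Subtype.ext ?_⟩
  rw [Set.Icc.coe_pow]
  simp only [one_div]
  exact Real.rpow_inv_natCast_pow a.2.1 hm

lemma measurable_pooled {H : Finset V} (hH : H.Nonempty) :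
    Measurable fun y : V → unitInterval => pooled (H.val.map y) := by
  refine measurable_of_Iic fun a => ?_
  obtain ⟨b, hb⟩ := exists_pow_eq (Finset.card_ne_zero.2 hH) a
  have : (fun y : V → unitInterval => pooled (H.val.map y)) ⁻¹' Set.Iic a =
      ⋂ v ∈ H, (fun y => y v) ⁻¹' Set.Iic b := by
    ext y
    simp [pooled_le_iff hH hb]
  rw [this]
  exact Finset.measurableSet_biInter _ fun v _ => measurable_pi_apply v measurableSet_Iic

variable [Fintype V]

/-- The m-th power of the maximum is at most b^m exactly if all m numbers are at most b, which has
probability b^m. -/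
lemma map_pooled {H : Finset V} (hH : H.Nonempty) :
    (Measure.pi fun _ : V => (volume : Measure unitInterval)).map
      (fun y => pooled (H.val.map y)) = volume := by
  refine Measure.ext_of_Iic _ _ fun a => ?_
  obtain ⟨b, hb⟩ := exists_pow_eq (Finset.card_ne_zero.2 hH) a
  rw [Measure.map_apply (measurable_pooled hH) measurableSet_Iic]
  have : (fun y : V → unitInterval => pooled (H.val.map y)) ⁻¹' Set.Iic a =
      Set.univ.pi fun v => if v ∈ H then Set.Iic b else Set.univ := by
    ext y
    simp only [Set.mem_preimage, Set.mem_Iic, pooled_le_iff hH hb, Set.mem_univ_pi]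
    refine forall_congr' fun v => ?_
    split_ifs with h <;> simp [h]
  rw [this, Measure.pi_pi]
  have : ∀ v : V, volume (if v ∈ H then Set.Iic b else Set.univ) =
      if v ∈ H then ENNReal.ofReal b else 1 := fun v => by
    split_ifs <;> simp
  simp only [this]
  rw [Finset.prod_ite_mem, Finset.univ_inter, Finset.prod_const, unitInterval.volume_Iic, ← hb,
    Set.Icc.coe_pow, ENNReal.ofReal_pow b.2.1]

/-- Seeds are rows, one per node, whereas pooling acts on columns, one per variable; the law is that
of one independent array. -/
lemma seedMeasure_eq : seedMeasure V = (Measure.infinitePi fun _ : ℕ × V =>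
    (volume : Measure unitInterval)).map fun y v x => y (x, v) := by
  have h1 := Measure.infinitePi_map_curry (ι := V) (κ := ℕ)
    fun _ _ => (volume : Measure unitInterval)
  have h2 := Measure.infinitePi_map_piCongrLeft
    (fun _ : V × ℕ => (volume : Measure unitInterval)) (Equiv.prodComm ℕ V)
  rw [seedMeasure, ← Measure.infinitePi_eq_pi, ← h1, ← h2, Measure.map_map (by fun_prop)
    (by fun_prop)]
  congr 1

/-- Pooling independent uniform numbers columnwise gives independent uniform numbers. -/
theorem map_pooled_seedMeasure (H : ℕ → Finset V) (hH : ∀ x, (H x).Nonempty) :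
    (seedMeasure V).map (fun seed x => pooled ((H x).val.map fun v => seed v x)) = unif := by
  have hm : ∀ x, Measurable fun y : V → unitInterval => pooled ((H x).val.map y) :=
    fun x => measurable_pooled (hH x)
  have h1 := Measure.infinitePi_map_curry (ι := ℕ) (κ := V)
    fun _ _ => (volume : Measure unitInterval)
  have h2 := Measure.infinitePi_map_pi (fun _ : ℕ => Measure.infinitePi fun _ : V =>
    (volume : Measure unitInterval)) hm
  have hm' : Measurable fun (z : ℕ → V → unitInterval) x => pooled ((H x).val.map (z x)) :=
    measurable_pi_lambda _ fun x => (hm x).comp (measurable_pi_apply x)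
  have hm'' : Measurable fun (seed : V → Seed) x => pooled ((H x).val.map fun v => seed v x) :=
    measurable_pi_lambda _ fun x => (hm x).comp (g := fun y => pooled ((H x).val.map y))
      (f := fun (seed : V → Seed) v => seed v x) (by fun_prop)
  rw [← h1, Measure.map_map hm' (by fun_prop)] at h2
  rw [seedMeasure_eq, Measure.map_map hm'' (by fun_prop)]
  refine h2.trans ?_
  simp only [Measure.infinitePi_eq_pi, map_pooled (hH _)]
  rfl

end Pooled

/-! ### The world of an instance has the required law and bounds. -/

section Instance

variable {V : Type} {L : LLLInstance V}

lemma measurableSet_occurs (v : V) : MeasurableSet (occurs (L.spec v)) := by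
  have : Measurable fun (u : Assignment) (x : (L.spec v).vars) =>
      quantile ((L.spec v).law x) (u x) :=
    measurable_pi_lambda _ fun x => (measurable_quantile _).comp (measurable_pi_apply _)
  exact this (L.measurableSet_bad v)

lemma unif_occurs (v : V) : unif (occurs (L.spec v)) = L.prob v := by
  have hq : ∀ x : L.vars v, Measurable (quantile (L.law x)) := fun x => measurable_quantile _
  have h1 : Measurable fun (y : L.vars v → unitInterval) (x : L.vars v) =>
      quantile (L.law x) (y x) :=
    measurable_pi_lambda _ fun x => (hq x).comp (measurable_pi_apply _)
  have h2 := Measure.infinitePi_map_restrict (fun _ : ℕ => (volume : Measure unitInterval))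
    (I := L.vars v)
  have h3 := Measure.pi_map_pi (μ := fun _ : L.vars v => (volume : Measure unitInterval))
    (f := fun x => quantile (L.law x)) fun x => (hq x).aemeasurable
  simp only [map_quantile] at h3
  rw [LLLInstance.prob, ← h3, ← h2, Measure.map_map h1 (by fun_prop),
    Measure.map_apply (h1.comp (by fun_prop)) (L.measurableSet_bad v)]
  rfl

variable [Fintype V]

lemma holders_nonempty [Nonempty V] (x : ℕ) : (holders L x).Nonempty := by
  unfold holders
  split_ifs with h
  · obtain ⟨v, hv⟩ := h
    exact ⟨v, by simp [hv]⟩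
  · exact Finset.univ_nonempty

lemma map_worldOf [Nonempty V] :
    (seedMeasure V).map (fun seed => (worldOf L seed).val) = unif :=
  map_pooled_seedMeasure _ holders_nonempty

lemma measurable_worldOf [Nonempty V] :
    Measurable fun seed : V → Seed => (worldOf L seed).val :=
  measurable_pi_lambda _ fun x => (measurable_pooled (holders_nonempty x)).comp (by fun_prop)

lemma card_nb_le {d : ℕ} {seed : V → Seed} (v : V)
    (h : (L.dependencyGraph.neighborSet v).ncard ≤ d) :
    ((worldOf L seed).nb (L.spec v)).card ≤ d + 1 := by
  have hsub : (worldOf L seed).nb (L.spec v) ⊆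
      insert (L.spec v) ((L.dependencyGraph.neighborSet v).toFinset.image L.spec) := by
    intro e he
    obtain ⟨w, rfl⟩ := exists_spec_eq (World.mem_nb.1 he).1
    rcases adj_of_mem_nb he with h | h
    · rw [h]; exact Finset.mem_insert_self _ _
    · exact Finset.mem_insert_of_mem (Finset.mem_image_of_mem _ (by simpa using h))
  refine (Finset.card_le_card hsub).trans ((Finset.card_insert_le _ _).trans ?_)
  rw [Set.ncard_eq_toFinset_card'] at h
  exact Nat.add_le_add_right (Finset.card_image_le.trans h) 1

theorem valid_worldOf {p : ℝ} {c : Params} (hL : L.Bounded p c.d) (hc : c.p = ENNReal.ofReal p)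
    (seed : V → Seed) : (worldOf L seed).Valid c where
  meas e he := by
    obtain ⟨v, rfl⟩ := exists_spec_eq he
    exact measurableSet_occurs v
  prob e he := by
    obtain ⟨v, rfl⟩ := exists_spec_eq he
    rw [unif_occurs, hc]
    exact (hL v).1
  deg e he := by
    obtain ⟨v, rfl⟩ := exists_spec_eq he
    exact card_nb_le v (hL v).2

end Instance

/-! ### A moment bound for locally dependent events. -/

section Concentration

variable {ι : Type*} [Fintype ι] {Z : ι → Set Assignment} {T : ι → Set ℕ} {D j : ℕ}
  {q a b : ℝ≥0∞}

/-- The number of events that occur. -/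
noncomputable def occurring (Z : ι → Set Assignment) (u : Assignment) : ℝ≥0∞ :=
  ∑ v, (Z v).indicator 1 u

lemma measurable_occurring (hZ : ∀ v, MeasurableSet (Z v)) : Measurable (occurring Z) :=
  Finset.measurable_sum _ fun v _ => measurable_one.indicator (hZ v)

/-- The indices that depend on the index `v`. -/
noncomputable def conflicts (T : ι → Set ℕ) (v : ι) : Finset ι :=
  Finset.univ.filter fun v' => v' = v ∨ ¬ Disjoint (T v) (T v')

lemma mem_conflicts {v v' : ι} : v' ∈ conflicts T v ↔ v' = v ∨ ¬ Disjoint (T v) (T v') := by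
  simp [conflicts]

/-- Extend `S` by one occurring index without conflicts: on the event there are at least `b` such
extensions, and at most `Fintype.card ι` indices to try. After `j` indices independence gives `q ^
j`. -/
lemma unif_inter_occurring_le (hZ : ∀ v, MeasurableSet (Z v)) (hT : ∀ v, DeterminedBy (Z v) (T v))
    (hq : ∀ v, unif (Z v) ≤ q) (hD : ∀ v, (conflicts T v).card ≤ D)
    (hab : b + (j * D : ℕ) ≤ a) (k : ℕ) :
    ∀ S : Finset ι, S.card + k = j → (S : Set ι).PairwiseDisjoint T →
      unif ((⋂ v ∈ S, Z v) ∩ {u | a ≤ occurring Z u}) * b ^ k ≤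
        q ^ j * (Fintype.card ι : ℝ≥0∞) ^ k := by
  induction k with
  | zero =>
    intro S hS hd
    rw [pow_zero, mul_one, pow_zero, mul_one]
    refine (measure_mono Set.inter_subset_left).trans ?_
    rw [unif_biInter S Z T (fun v _ => hZ v) (fun v _ => hT v) hd, ← hS, add_zero]
    exact Finset.prod_le_pow_card _ _ _ fun v _ => hq v
  | succ k ih =>
    intro S hS hd
    set B := (⋂ v ∈ S, Z v) ∩ {u | a ≤ occurring Z u} with hB
    have hBm : MeasurableSet B := (Finset.measurableSet_biInter _ fun v _ => hZ v).inter
      (measurableSet_le measurable_const (measurable_occurring hZ))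
    set R := Finset.univ \ S.biUnion (conflicts T) with hR
    -- At most `j * D` indices conflict with `S`, so at least `b` of the occurring ones remain.
    have hpt : ∀ u ∈ B, b ≤ ∑ v ∈ R, (Z v).indicator 1 u := by
      intro u hu
      have h1 : a ≤ ∑ v, (Z v).indicator (1 : Assignment → ℝ≥0∞) u := hu.2
      rw [← Finset.sum_sdiff (Finset.subset_univ (S.biUnion (conflicts T)))] at h1
      have h2 : ∑ v ∈ S.biUnion (conflicts T), (Z v).indicator (1 : Assignment → ℝ≥0∞) u ≤
          (j * D : ℕ) := by
        refine (Finset.sum_le_card_nsmul _ _ 1 fun v _ => ?_).trans ?_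
        · exact Set.indicator_le_self' (fun _ _ => zero_le) u
        · rw [nsmul_eq_mul, mul_one, Nat.cast_le]
          exact (Finset.card_biUnion_le_card_mul _ _ _ fun v _ => hD v).trans
            (Nat.mul_le_mul_right _ (by omega))
      have h3 : b + (j * D : ℕ) ≤ (∑ v ∈ R, (Z v).indicator 1 u) + (j * D : ℕ) :=
        hab.trans (h1.trans (add_le_add_right h2 _))
      exact (ENNReal.add_le_add_iff_right (ENNReal.natCast_ne_top _)).1 h3
    have h1 : unif B * b ≤ ∑ v ∈ R, unif (B ∩ Z v) := by
      calc unif B * b = ∫⁻ _ in B, b ∂unif := by rw [setLIntegral_const, mul_comm]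
        _ ≤ ∫⁻ u in B, ∑ v ∈ R, (Z v).indicator 1 u ∂unif := setLIntegral_mono
            (Finset.measurable_sum _ fun v _ => measurable_one.indicator (hZ v)) hpt
        _ = ∑ v ∈ R, unif (B ∩ Z v) := by
            rw [lintegral_finsetSum _ fun v _ => measurable_one.indicator (hZ v)]
            refine Finset.sum_congr rfl fun v _ => ?_
            rw [lintegral_indicator_one (hZ v), Measure.restrict_apply (hZ v), Set.inter_comm]
    have h2 : ∀ v ∈ R, unif (B ∩ Z v) * b ^ k ≤ q ^ j * (Fintype.card ι : ℝ≥0∞) ^ k := by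
      intro v hv
      rw [hR, Finset.mem_sdiff, Finset.mem_biUnion] at hv
      have hv' : ∀ w ∈ S, v ≠ w ∧ Disjoint (T w) (T v) := fun w hw => by
        have h : v ∉ conflicts T w := fun h => hv.2 ⟨w, hw, h⟩
        rwa [mem_conflicts, not_or, not_not] at h
      have hvS : v ∉ S := fun h => (hv' v h).1 rfl
      have := ih (insert v S) (by rw [Finset.card_insert_of_notMem hvS]; omega) (by
        rw [Finset.coe_insert]
        exact hd.insert fun w hw _ => (hv' w hw).2.symm)
      refine le_trans (mul_le_mul_left (measure_mono ?_) _) this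
      rintro u ⟨⟨hu, hu'⟩, huv⟩
      refine ⟨?_, hu'⟩
      rw [Finset.set_biInter_insert]
      exact ⟨huv, hu⟩
    calc unif B * b ^ (k + 1) = unif B * b * b ^ k := by rw [pow_succ]; ring
      _ ≤ (∑ v ∈ R, unif (B ∩ Z v)) * b ^ k := mul_le_mul_left h1 _
      _ = ∑ v ∈ R, unif (B ∩ Z v) * b ^ k := Finset.sum_mul _ _ _
      _ ≤ R.card • (q ^ j * (Fintype.card ι : ℝ≥0∞) ^ k) := Finset.sum_le_card_nsmul _ _ _ h2
      _ ≤ (Fintype.card ι : ℝ≥0∞) * (q ^ j * (Fintype.card ι : ℝ≥0∞) ^ k) := by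
          rw [nsmul_eq_mul]
          exact mul_le_mul_left (Nat.cast_le.2 (Finset.card_le_univ _)) _
      _ = q ^ j * (Fintype.card ι : ℝ≥0∞) ^ (k + 1) := by rw [pow_succ]; ring

/-- It is unlikely that many of some rare events with bounded dependencies occur. -/
theorem unif_le_occurring (hZ : ∀ v, MeasurableSet (Z v)) (hT : ∀ v, DeterminedBy (Z v) (T v))
    (hq : ∀ v, unif (Z v) ≤ q) (hD : ∀ v, (conflicts T v).card ≤ D)
    (hab : b + (j * D : ℕ) ≤ a) :
    unif {u | a ≤ occurring Z u} * b ^ j ≤ (q * Fintype.card ι) ^ j := by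
  have := unif_inter_occurring_le hZ hT hq hD hab j ∅ (by simp) (by simp)
  simpa [mul_pow] using this

end Concentration

/-! ### Waiting nodes are covered by local rare events. -/

section Waiting

variable {V : Type} [Fintype V] {L : LLLInstance V} {c : Params} {q : Schedule} {seed : V → Seed}
  {v w : V} {p : ℝ}

/-- The world of an instance in which all uniform numbers are zero. -/
noncomputable def baseWorld (L : LLLInstance V) : World := ⟨Finset.univ.image L.spec, fun _ => 0⟩

lemma worldOf_eq : worldOf L seed = (baseWorld L).withVal (worldOf L seed).val := rfl

/-- The uniform numbers for which there is a cascade close to `v`. -/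
noncomputable def waitingSet (c : Params) (s : ℕ) (L : LLLInstance V) (v : V) : Set Assignment :=
  ⋃ f ∈ (baseWorld L).ball 10 (L.spec v), (baseWorld L).cascade c s f ((baseWorld L).ball (8 * s) f)

lemma spec_mem_baseWorld (v : V) : L.spec v ∈ (baseWorld L).events :=
  Finset.mem_image_of_mem _ (Finset.mem_univ v)

lemma mem_waitingSet (hL : L.Bounded p c.d) (hc : c.p = ENNReal.ofReal p)
    (hM : q.M * 14 ^ q.s < 15 ^ q.s) (hρ : 8 * q.s + 4 ≤ q.ρ)
    (h : Waiting c q L seed (L.spec v)) : (worldOf L seed).val ∈ waitingSet c q.s L v := by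
  obtain ⟨f, hf, hs⟩ := h
  have := World.mem_cascade_of_suspect (valid_worldOf hL hc seed).deg hM hρ hs
  rw [worldOf_eq, World.ball_withVal] at hf
  rw [worldOf_eq, World.cascade_withVal, World.ball_withVal] at this
  exact Set.mem_biUnion hf this

lemma valid_baseWorld [Nonempty V] (hL : L.Bounded p c.d) (hc : c.p = ENNReal.ofReal p) :
    (baseWorld L).Valid c := by
  obtain ⟨h1, h2, h3⟩ := valid_worldOf hL hc (fun _ _ => 0 : V → Seed)
  exact ⟨h1, h2, h3⟩

lemma measurableSet_waitingSet {s : ℕ} (hW : (baseWorld L).Valid c) :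
    MeasurableSet (waitingSet c s L v) :=
  Finset.measurableSet_biUnion _ fun _ hf => World.measurableSet_cascade fun g hg =>
    hW.meas g (World.ball_subset_events
      (World.ball_subset_events (spec_mem_baseWorld v) hf) hg)

/-- The variables that determine whether there is a cascade close to `v`. -/
def waitingVars (s : ℕ) (L : LLLInstance V) (v : V) : Set ℕ :=
  {x | ∃ f ∈ (baseWorld L).ball (8 * s + 10) (L.spec v), x ∈ f.vars}

lemma determinedBy_waitingSet {s : ℕ} :
    DeterminedBy (waitingSet c s L v) (waitingVars s L v) := by
  refine DeterminedBy.biUnion (s := (↑((baseWorld L).ball 10 (L.spec v)) : Set EventSpec))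
    fun f hf => World.determinedBy_cascade.mono ?_
  rintro x ⟨g, hg, hx⟩
  refine ⟨g, ?_, hx⟩
  rw [add_comm]
  exact World.mem_ball_trans (Finset.mem_coe.1 hf) hg

lemma unif_waitingSet_le {s : ℕ} (hW : (baseWorld L).Valid c) {w z : ℝ}
    (h0 : 0 ≤ w) (h1 : w ≤ 1) (hz0 : 0 ≤ z) (hz1 : z ≤ 1)
    (hw : (c.p / c.θ) ^ 14 ≤ ENNReal.ofReal w ^ 15)
    (hwz : 4 * ((c.d + 1) ^ 4 : ℝ) * (2 * (((c.d + 1) ^ 2 + 1) ^ 2) * w) ≤ z) :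
    unif (waitingSet c s L v) ≤ ENNReal.ofReal ((c.d + 1) ^ 10 * z ^ s) := by
  have hball := World.card_ball_le (r := 10) hW.deg (spec_mem_baseWorld v)
  have hsub : ∀ f ∈ (baseWorld L).ball 10 (L.spec v),
      (baseWorld L).ball (8 * s) f ⊆ (baseWorld L).events := fun f hf =>
    World.ball_subset_events (World.ball_subset_events (spec_mem_baseWorld v) hf)
  have hle : ∀ f ∈ (baseWorld L).ball 10 (L.spec v),
      unif ((baseWorld L).cascade c s f ((baseWorld L).ball (8 * s) f)) ≤ ENNReal.ofReal (z ^ s) :=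
    fun f hf => World.unif_cascade_le hW.deg (hsub f hf) (fun g hg => hW.meas g (hsub f hf hg))
      (fun g hg => hW.prob g (hsub f hf hg)) h0 h1 hz0 hz1 hw hwz
  refine (measure_biUnion_finset_le _ _).trans ((Finset.sum_le_card_nsmul _ _ _ hle).trans ?_)
  rw [nsmul_eq_mul, ENNReal.ofReal_mul (by positivity)]
  refine mul_le_mul_left ?_ _
  rw [← ENNReal.ofReal_natCast]
  exact ENNReal.ofReal_le_ofReal (by exact_mod_cast hball)

lemma vars_nonempty_of_mem_ball {W : World} {e f : EventSpec} {r : ℕ} (h : f ∈ W.ball r e)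
    (hf : f.vars.Nonempty) : e.vars.Nonempty := by
  induction r generalizing f with
  | zero => rwa [World.mem_ball_zero.1 h] at hf
  | succ r ih =>
    obtain ⟨g, hg, hfg⟩ := World.mem_ball_succ.1 h
    refine ih hg ?_
    rcases (World.mem_nb.1 hfg).2 with rfl | h
    · exact hf
    · obtain ⟨x, hx, -⟩ := Finset.not_disjoint_iff.1 h
      exact ⟨x, hx⟩

/-- Nodes with the same description are adjacent as soon as it has a variable. Descriptions without
variables may be shared by any number of nodes. -/
lemma card_spec_eq_le (hL : L.Bounded p c.d) {e : EventSpec} (he : e.vars.Nonempty) :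
    (Finset.univ.filter fun v => L.spec v = e).card ≤ c.d + 1 := by
  rcases (Finset.univ.filter fun v => L.spec v = e).eq_empty_or_nonempty with h | ⟨v, hv⟩
  · rw [h]; simp
  · have hsub : (Finset.univ.filter fun v => L.spec v = e) ⊆
        insert v (L.dependencyGraph.neighborSet v).toFinset := by
      intro w hw
      rw [Finset.mem_filter] at hv hw
      by_cases hwv : w = v
      · exact hwv ▸ Finset.mem_insert_self _ _
      · refine Finset.mem_insert_of_mem (Set.mem_toFinset.2 ⟨Ne.symm hwv, ?_⟩)
        obtain ⟨x, hx⟩ := he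
        exact ⟨x, by rw [← hv.2] at hx; exact hx, by rw [← hw.2] at hx; exact hx⟩
    have h2 := (hL v).2
    rw [Set.ncard_eq_toFinset_card'] at h2
    exact (Finset.card_le_card hsub).trans ((Finset.card_insert_le _ _).trans (by omega))

/-- Every node depends on few other nodes. -/
lemma card_conflicts_le {s : ℕ} (hW : (baseWorld L).Valid c) (hL : L.Bounded p c.d) :
    (conflicts (waitingVars s L) v).card ≤ (c.d + 1) ^ (16 * s + 22) + 1 := by
  have hsub : conflicts (waitingVars s L) v ⊆ insert v
      ((((baseWorld L).ball (16 * s + 21) (L.spec v)).filter fun e => e.vars.Nonempty).biUnion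
        fun e => Finset.univ.filter fun v => L.spec v = e) := by
    intro w hw
    rcases mem_conflicts.1 hw with rfl | hw
    · exact Finset.mem_insert_self _ _
    · obtain ⟨x, ⟨f, hf, hxf⟩, g, hg, hxg⟩ := Set.not_disjoint_iff.1 hw
      refine Finset.mem_insert_of_mem (Finset.mem_biUnion.2 ⟨L.spec w, Finset.mem_filter.2
        ⟨?_, vars_nonempty_of_mem_ball hg ⟨x, hxg⟩⟩, by simp⟩)
      -- Two radii `8 * s + 10` and one shared variable give `16 * s + 21`; the last factor `d + 1`
      -- counts the nodes with a given description.
      have h1 : g ∈ (baseWorld L).ball 1 f := World.mem_ball_one.2 (World.mem_nb_of_mem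
        (World.ball_subset_events (spec_mem_baseWorld w) hg) hxf hxg)
      have h2 := World.mem_ball_trans (World.mem_ball_trans hf h1)
        (World.mem_ball_comm (spec_mem_baseWorld w) hg)
      rwa [show 8 * s + 10 + 1 + (8 * s + 10) = 16 * s + 21 by ring] at h2
  refine (Finset.card_le_card hsub).trans ((Finset.card_insert_le _ _).trans
    (Nat.add_le_add_right ?_ 1))
  rw [pow_succ]
  refine (Finset.card_biUnion_le_card_mul _ _ _ fun e he =>
    card_spec_eq_le hL (Finset.mem_filter.1 he).2).trans (Nat.mul_le_mul_right _ ?_)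
  exact (Finset.card_le_card (Finset.filter_subset _ _)).trans
    (World.card_ball_le hW.deg (spec_mem_baseWorld v))

/-- The average number of rounds in terms of the number of nodes close to a cascade. -/
lemma averageRounds_le [Nonempty V] (hL : L.Bounded p c.d) (hc : c.p = ENNReal.ofReal p)
    (hM : q.M * 14 ^ q.s < 15 ^ q.s) (hρ : 8 * q.s + 4 ≤ q.ρ)
    (P : PortNumbering L.dependencyGraph) (seed : V → Seed) :
    (algorithm c q).averageRounds P L.spec seed ≤
      q.early + q.late * (occurring (waitingSet c q.s L) (worldOf L seed).val /
        Fintype.card V) := by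
  have hn : (Fintype.card V : ℝ≥0∞) ≠ 0 := by simp
  have hround : ∀ v, ((algorithm c q).rounds P L.spec seed v : ℝ≥0∞) ≤
      q.early + q.late * (waitingSet c q.s L v).indicator 1 (worldOf L seed).val := by
    intro v
    have h1 : ((algorithm c q).rounds P L.spec seed v : ℝ≥0∞) ≤
        ((stopTime c q L seed v : ℕ) : ℝ≥0∞) := by
      have := ENat.toENNReal_mono (rounds_le_stopTime (c := c) (q := q) (P := P) (seed := seed)
        (v := v))
      simpa using this
    refine h1.trans ?_
    unfold stopTime
    split_ifs with h
    · rw [Set.indicator_of_mem (mem_waitingSet hL hc hM hρ h)]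
      simp
    · exact le_self_add
  calc (algorithm c q).averageRounds P L.spec seed
      ≤ (∑ v, ((q.early : ℝ≥0∞) + q.late * (waitingSet c q.s L v).indicator 1 (worldOf L seed).val)) /
          (Fintype.card V : ℝ≥0∞) := by
        exact ENNReal.div_le_div_right (Finset.sum_le_sum fun v _ => hround v) _
    _ = _ := by
        rw [Finset.sum_add_distrib, ← Finset.mul_sum, Finset.sum_const, nsmul_eq_mul,
          ENNReal.add_div, Finset.card_univ, mul_comm (Fintype.card V : ℝ≥0∞),
          ENNReal.mul_div_cancel_right hn (ENNReal.natCast_ne_top _), mul_div_assoc]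
        rfl

end Waiting

/-! ### Choice of constants. -/

/-- The range of parameters for which the algorithm works. -/
structure Regime (d : ℕ) (p z : ℝ) : Prop where
  pos : 0 < z
  small : z ≤ 1 / 25600
  pow_eq : z ^ 50 = p
  deg : d * z ^ 5 ≤ 1
  two_le : 2 ≤ d

namespace Regime

variable {d : ℕ} {p z : ℝ}

lemma mul_le (h : Regime d p z) : 8 * d * p ≤ 8 * z ^ 45 := by
  have := mul_le_mul_of_nonneg_right h.deg (show 0 ≤ 8 * z ^ 45 by have := h.pos; positivity)
  rw [← h.pow_eq]
  calc 8 * d * z ^ 50 = d * z ^ 5 * (8 * z ^ 45) := by ring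
    _ ≤ _ := this
    _ = _ := one_mul _

lemma le_one (h : Regime d p z) : z ≤ 1 := h.small.trans (by norm_num)

lemma mul_le_one (h : Regime d p z) : 8 * d * p ≤ 1 := by
  refine h.mul_le.trans ?_
  have h1 : z ^ 45 ≤ z := pow_le_of_le_one h.pos.le h.le_one (by norm_num)
  linarith [h.small]

lemma p_pos (h : Regime d p z) : 0 < p := h.pow_eq ▸ pow_pos h.pos 50

lemma d_pos (h : Regime d p z) : (2 : ℝ) ≤ d := by exact_mod_cast h.two_le

/-- The parameters of the analysis. -/
noncomputable def params (h : Regime d p z) : Params where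
  d := d
  p := ENNReal.ofReal p
  θ := ENNReal.ofReal (1 / (8 * d))
  p_le := by
    have := h.d_pos
    refine ENNReal.ofReal_le_ofReal ?_
    rw [le_div_iff₀ (by positivity), mul_comm]
    exact h.mul_le_one
  pos := by
    have := h.d_pos
    rw [ENNReal.ofReal_pos]
    positivity
  lll := by
    have := h.d_pos
    rw [ENNReal.toReal_ofReal (by positivity)]
    field_simp
    norm_num
  half := by
    have := h.d_pos
    rw [ENNReal.toReal_ofReal (by positivity)]
    rw [mul_one_div, div_lt_one (by positivity)]
    linarith
  ne_top := ENNReal.ofReal_ne_top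

/-- The loss of the exponent 14/15 turns z^45 into z^42, as 45·14 = 42·15. -/
lemma pow_div_le (h : Regime d p z) :
    (h.params.p / h.params.θ) ^ 14 ≤ ENNReal.ofReal (8 * z ^ 42) ^ 15 := by
  have hd := h.d_pos
  have hz := h.pos
  have hp := h.p_pos
  simp only [params]
  rw [← ENNReal.ofReal_div_of_pos (by positivity), ← ENNReal.ofReal_pow (by positivity),
    ← ENNReal.ofReal_pow (by positivity)]
  refine ENNReal.ofReal_le_ofReal ?_
  calc (p / (1 / (8 * d))) ^ 14 = (8 * d * p) ^ 14 := by field_simp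
    _ ≤ (8 * z ^ 45) ^ 14 := pow_le_pow_left₀ (by positivity) h.mul_le _
    _ = 8 ^ 14 * z ^ 630 := by ring
    _ ≤ 8 ^ 15 * z ^ 630 := mul_le_mul_of_nonneg_right (by norm_num) (by positivity)
    _ = _ := by ring

lemma weight_le_one (h : Regime d p z) : 8 * z ^ 42 ≤ 1 := by
  have h1 : z ^ 42 ≤ z := pow_le_of_le_one h.pos.le h.le_one (by norm_num)
  linarith [h.small]

/-- Connected sets and patterns cost d^8, which z^40 pays for; 25600 collects the constants, and of
the remaining z^2 one factor absorbs it. -/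
lemma weight_le (h : Regime d p z) :
    4 * ((h.params.d + 1) ^ 4 : ℝ) * (2 * (((h.params.d + 1) ^ 2 + 1) ^ 2) * (8 * z ^ 42)) ≤ z := by
  have hd := h.d_pos
  have hz := h.pos
  have h1 : ((d : ℝ) + 1) ^ 4 ≤ (2 * d) ^ 4 := pow_le_pow_left₀ (by positivity) (by linarith) _
  have h2 : (((d : ℝ) + 1) ^ 2 + 1) ^ 2 ≤ (5 * d ^ 2) ^ 2 :=
    pow_le_pow_left₀ (by positivity) (by nlinarith) _
  have h3 : ((d : ℝ) * z ^ 5) ^ 8 ≤ 1 := pow_le_one₀ (by positivity) h.deg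
  calc 4 * (((d : ℝ) + 1) ^ 4) * (2 * (((d + 1) ^ 2 + 1) ^ 2) * (8 * z ^ 42))
      ≤ 4 * (2 * (d : ℝ)) ^ 4 * (2 * (5 * d ^ 2) ^ 2 * (8 * z ^ 42)) := by gcongr
    _ = 25600 * (d * z ^ 5) ^ 8 * z ^ 2 := by ring
    _ ≤ 25600 * 1 * z ^ 2 := by gcongr
    _ = 25600 * z * z := by ring
    _ ≤ 1 * z := mul_le_mul_of_nonneg_right (by linarith [h.small]) hz.le
    _ = z := one_mul _

end Regime

/-- The schedule of the algorithm for components of size at most `M`. -/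
def schedule (M : ℕ) : Schedule where
  M := M
  s := 67 + 15 * Nat.log 2 M
  ρ := 8 * (67 + 15 * Nat.log 2 M) + 4
  early := 8 * (67 + 15 * Nat.log 2 M) + 16
  late := 8 * (67 + 15 * Nat.log 2 M) + 27 + 10 * M
  size := by omega
  radius := by omega
  radius' := by omega
  wait := by omega

section Schedule

variable {M : ℕ}

/-- Since 2·14^15 ≤ 15^15, every doubling of `M` needs 15 more layers. -/
lemma schedule_growth : (schedule M).M * 14 ^ (schedule M).s < 15 ^ (schedule M).s := by
  have h1 : M < 2 ^ (Nat.log 2 M + 1) := Nat.lt_pow_succ_log_self (by norm_num) M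
  have h2 : ∀ l : ℕ, 2 ^ l * 14 ^ (15 * l) ≤ 15 ^ (15 * l) := fun l => by
    rw [pow_mul, pow_mul, ← mul_pow]
    exact Nat.pow_le_pow_left (by norm_num) l
  have h3 := h2 (Nat.log 2 M + 1)
  have h4 : 14 ^ 52 ≤ 15 ^ 52 := Nat.pow_le_pow_left (by norm_num) 52
  change M * 14 ^ (67 + 15 * Nat.log 2 M) < 15 ^ (67 + 15 * Nat.log 2 M)
  rw [show 67 + 15 * Nat.log 2 M = 15 * (Nat.log 2 M + 1) + 52 by ring, pow_add, pow_add]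
  calc M * (14 ^ (15 * (Nat.log 2 M + 1)) * 14 ^ 52)
      < 2 ^ (Nat.log 2 M + 1) * (14 ^ (15 * (Nat.log 2 M + 1)) * 14 ^ 52) :=
        Nat.mul_lt_mul_of_pos_right h1 (by positivity)
    _ = 2 ^ (Nat.log 2 M + 1) * 14 ^ (15 * (Nat.log 2 M + 1)) * 14 ^ 52 := by ring
    _ ≤ _ := Nat.mul_le_mul h3 h4

lemma late_le (hM : 1 ≤ M) : (schedule M).late ≤ 723 * M := by
  have : Nat.log 2 M < M := Nat.log_lt_self 2 (by omega)
  change 8 * (67 + 15 * Nat.log 2 M) + 27 + 10 * M ≤ 723 * M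
  omega

/-- The 52 in `s` pays for d^10 with z^50 and leaves z^2; the term with the logarithm pays for `M`.
So O(M) rounds of a waiting node cost O(1) in expectation. -/
lemma mul_unif_le {d : ℕ} {p z : ℝ} (h : Regime d p z) :
    M * ((d + 1) ^ 10 * z ^ (schedule M).s) ≤ z / 4 := by
  have hd := h.d_pos
  have hz := h.pos
  have h1 : (M : ℝ) ≤ 2 ^ (Nat.log 2 M + 1) := by
    exact_mod_cast (Nat.lt_pow_succ_log_self (by norm_num) M).le
  have h2 : z ^ (15 * (Nat.log 2 M + 1)) ≤ (1 / 2) ^ (Nat.log 2 M + 1) := by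
    rw [pow_mul]
    refine pow_le_pow_left₀ (by positivity) ?_ _
    refine (pow_le_of_le_one hz.le h.le_one (by norm_num)).trans (h.small.trans (by norm_num))
  have h3 : ((d : ℝ) + 1) ^ 10 ≤ (2 * d) ^ 10 := pow_le_pow_left₀ (by positivity) (by linarith) _
  have h4 : ((d : ℝ) * z ^ 5) ^ 10 ≤ 1 := pow_le_one₀ (by positivity) h.deg
  change M * (((d : ℝ) + 1) ^ 10 * z ^ (67 + 15 * Nat.log 2 M)) ≤ z / 4
  rw [show 67 + 15 * Nat.log 2 M = 52 + 15 * (Nat.log 2 M + 1) by ring, pow_add]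
  calc (M : ℝ) * (((d : ℝ) + 1) ^ 10 * (z ^ 52 * z ^ (15 * (Nat.log 2 M + 1))))
      ≤ 2 ^ (Nat.log 2 M + 1) * ((2 * d) ^ 10 * (z ^ 52 * (1 / 2) ^ (Nat.log 2 M + 1))) := by
        gcongr
    _ = (2 * (1 / 2)) ^ (Nat.log 2 M + 1) * (1024 * (d * z ^ 5) ^ 10 * z ^ 2) := by
        rw [mul_pow (2 : ℝ) (1 / 2)]; ring
    _ ≤ 1 * (1024 * 1 * z ^ 2) := by
        rw [show (2 * (1 / 2) : ℝ) = 1 by norm_num, one_pow]; gcongr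
    _ = 1024 * z * z := by ring
    _ ≤ 1 / 4 * z := mul_le_mul_of_nonneg_right (by linarith [h.small]) hz.le
    _ = z / 4 := by ring

end Schedule

/-! ### Probability of large components and of many waiting nodes. -/

section Bounds

variable {V : Type} [Fintype V] [Nonempty V] {L : LLLInstance V} {d M j : ℕ} {p z : ℝ}

lemma seedMeasure_preimage {S : Set Assignment} (hS : MeasurableSet S) :
    seedMeasure V {seed | (worldOf L seed).val ∈ S} = unif S := by
  rw [← map_worldOf (L := L), Measure.map_apply measurable_worldOf hS]
  rfl

/-- Large components are unlikely. -/
lemma seedMeasure_not_good_le (h : Regime d p z) (hL : L.Bounded p d) :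
    seedMeasure V {seed | ¬ (worldOf L seed).Good h.params M} ≤
      ENNReal.ofReal (Fintype.card V * z ^ (M + 1)) := by
  have hW : (baseWorld L).Valid h.params := valid_baseWorld hL rfl
  set S : Set Assignment := ⋃ e ∈ (baseWorld L).events,
    (baseWorld L).cascade h.params (M + 1) e (baseWorld L).events with hS
  have hSm : MeasurableSet S :=
    Finset.measurableSet_biUnion _ fun e _ => World.measurableSet_cascade hW.meas
  have hsub : {seed : V → Seed | ¬ (worldOf L seed).Good h.params M} ⊆
      {seed | (worldOf L seed).val ∈ S} := by
    intro seed hseed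
    obtain ⟨e, he, hmem⟩ := World.exists_mem_cascade_of_not_good
      (valid_worldOf (c := h.params) hL rfl seed) hseed
    rw [worldOf_eq, World.cascade_withVal] at hmem
    exact Set.mem_biUnion he hmem
  have hle : ∀ e ∈ (baseWorld L).events, unif ((baseWorld L).cascade h.params (M + 1) e
      (baseWorld L).events) ≤ ENNReal.ofReal (z ^ (M + 1)) := fun e _ =>
    World.unif_cascade_le hW.deg subset_rfl hW.meas hW.prob
      (by have := h.pos; positivity) h.weight_le_one h.pos.le h.le_one h.pow_div_le h.weight_le
  refine (measure_mono hsub).trans ?_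
  rw [seedMeasure_preimage hSm]
  refine (measure_biUnion_finset_le _ _).trans ((Finset.sum_le_card_nsmul _ _ _ hle).trans ?_)
  rw [nsmul_eq_mul, ENNReal.ofReal_mul (by positivity), ENNReal.ofReal_natCast]
  exact mul_le_mul_left (Nat.cast_le.2 Finset.card_image_le) _

lemma unif_waitingSet_schedule_le (h : Regime d p z) (hL : L.Bounded p d) (v : V) :
    unif (waitingSet h.params (schedule M).s L v) ≤
      ENNReal.ofReal ((d + 1) ^ 10 * z ^ (schedule M).s) :=
  unif_waitingSet_le (valid_baseWorld hL rfl) (by have := h.pos; positivity) h.weight_le_one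
    h.pos.le h.le_one h.pow_div_le h.weight_le

/-- It is unlikely that many nodes have to wait. -/
lemma unif_occurring_le (h : Regime d p z) (hL : L.Bounded p d) (hM : 1 ≤ M)
    {D : ℕ} (hD : (d + 1) ^ (16 * (schedule M).s + 22) + 1 ≤ D)
    (hj : 2 * M * (j * D) ≤ Fintype.card V) :
    unif {u | (Fintype.card V / M : ℝ≥0∞) ≤ occurring (waitingSet h.params (schedule M).s L) u} ≤
      ENNReal.ofReal (z ^ j) := by
  have hW : (baseWorld L).Valid h.params := valid_baseWorld hL rfl
  have hn : (0 : ℝ) < Fintype.card V := by exact_mod_cast Fintype.card_pos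
  have hM' : (0 : ℝ) < M := by exact_mod_cast hM
  have hz := h.pos
  have hq := unif_waitingSet_schedule_le (M := M) h hL
  have hMq := mul_unif_le (M := M) h
  have hconf : ∀ v, (conflicts (waitingVars (schedule M).s L) v).card ≤ D := fun v =>
    (card_conflicts_le (c := h.params) hW hL).trans hD
  clear hD
  generalize (schedule M).s = s at *
  -- Half of the threshold n/M is left for conflicting nodes, the other half is `b`; the bound on
  -- `M` times the waiting probability makes each moment factor at most `z`.
  set b : ℝ := Fintype.card V / (2 * M) with hb
  have hb0 : 0 < b := by positivity
  have hab : ENNReal.ofReal b + (j * D : ℕ) ≤ (Fintype.card V / M : ℝ≥0∞) := by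
    rw [← ENNReal.ofReal_natCast, ← ENNReal.ofReal_natCast (Fintype.card V),
      ← ENNReal.ofReal_natCast M, ← ENNReal.ofReal_div_of_pos hM',
      ← ENNReal.ofReal_add hb0.le (Nat.cast_nonneg _)]
    refine ENNReal.ofReal_le_ofReal ?_
    have h1 : (2 * M * (j * D : ℕ) : ℝ) ≤ Fintype.card V := by exact_mod_cast hj
    have h2 : ((j * D : ℕ) : ℝ) ≤ b := by
      rw [hb, le_div_iff₀ (by positivity)]; linarith
    have h3 : b + b = Fintype.card V / M := by rw [hb]; field_simp; norm_num
    linarith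
  have key := unif_le_occurring (fun v => measurableSet_waitingSet hW)
    (fun v => determinedBy_waitingSet) hq hconf hab
  have hle : ENNReal.ofReal ((d + 1) ^ 10 * z ^ s) * Fintype.card V ≤
      ENNReal.ofReal z * ENNReal.ofReal b := by
    rw [← ENNReal.ofReal_natCast, ← ENNReal.ofReal_mul (by positivity),
      ← ENNReal.ofReal_mul hz.le]
    refine ENNReal.ofReal_le_ofReal ?_
    rw [hb, mul_div_assoc', le_div_iff₀ (by positivity)]
    generalize ((d : ℝ) + 1) ^ 10 * z ^ s = y at *
    nlinarith
  have hb1 : ENNReal.ofReal b ^ j ≠ 0 := pow_ne_zero _ (ENNReal.ofReal_pos.2 hb0).ne'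
  have hb2 : ENNReal.ofReal b ^ j ≠ ∞ := ENNReal.pow_ne_top ENNReal.ofReal_ne_top
  have h1 := key.trans (pow_le_pow_left₀ zero_le hle j)
  rw [mul_pow] at h1
  rw [ENNReal.ofReal_pow hz.le]
  exact (ENNReal.mul_le_mul_iff_left hb1 hb2).1 h1

end Bounds

/-! ### Numerical estimates. -/

section Numerics

/-- With z = p^(1/50), p·d^10 ≤ 1 says (d·z^5)^10 ≤ 1, and d ≥ 25600^5 then forces 25600·z ≤ 1. -/
lemma exists_regime {δ : ℝ} (hδ : 0 < δ) {d : ℕ} {p : ℝ} (hd : 25600 ^ 5 ≤ d) (hp : 0 < p)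
    (hpd : p ≤ (d : ℝ) ^ (-(10 + δ))) : ∃ z, Regime d p z := by
  have hd' : (25600 : ℝ) ^ 5 ≤ d := by exact_mod_cast hd
  have hd1 : (1 : ℝ) ≤ d := le_trans (by norm_num) hd'
  have hd0 : (0 : ℝ) < d := by linarith
  have hpow : (p ^ (1 / 50 : ℝ)) ^ 50 = p := by
    rw [← Real.rpow_natCast, ← Real.rpow_mul hp.le]
    norm_num
  have hz0 : 0 < p ^ (1 / 50 : ℝ) := Real.rpow_pos_of_pos hp _
  set z := p ^ (1 / 50 : ℝ)
  have hp10 : p * d ^ 10 ≤ 1 := by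
    have h1 : p ≤ ((d : ℝ) ^ 10)⁻¹ := by
      refine hpd.trans ?_
      rw [← Real.rpow_natCast, ← Real.rpow_neg hd0.le]
      exact Real.rpow_le_rpow_of_exponent_le hd1 (by push_cast; linarith)
    calc p * d ^ 10 ≤ ((d : ℝ) ^ 10)⁻¹ * d ^ 10 := by gcongr
      _ = 1 := inv_mul_cancel₀ (by positivity)
  have hdeg : d * z ^ 5 ≤ 1 := by
    have h1 : (d * z ^ 5) ^ 10 ≤ 1 ^ 10 := by
      calc (d * z ^ 5) ^ 10 = z ^ 50 * d ^ 10 := by ring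
        _ ≤ 1 ^ 10 := by rw [hpow, one_pow]; exact hp10
    exact (pow_le_pow_iff_left₀ (by positivity) zero_le_one (by norm_num)).1 h1
  refine ⟨z, hz0, ?_, hpow, hdeg, le_trans (by norm_num) hd⟩
  have h1 : (25600 * z) ^ 5 ≤ 1 ^ 5 := by
    calc (25600 * z) ^ 5 = 25600 ^ 5 * z ^ 5 := by ring
      _ ≤ d * z ^ 5 := by gcongr
      _ ≤ 1 ^ 5 := by rw [one_pow]; exact hdeg
  have h2 := (pow_le_pow_iff_left₀ (by positivity) zero_le_one (by norm_num)).1 h1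
  linarith

variable {d n M j : ℕ} {p z k A N : ℝ}

lemma Regime.natCast_eq (h : Regime d p z) (hn : n ≠ 0) :
    (n : ℝ) = z ^ (-(50 * Real.logb (1 / p) n)) := by
  have hp := h.p_pos
  have hp1 : p < 1 := by
    rw [← h.pow_eq]
    exact pow_lt_one₀ h.pos.le (h.small.trans_lt (by norm_num)) (by norm_num)
  have h1 : 1 < 1 / p := by rw [lt_div_iff₀ hp]; linarith
  have hn' : (0 : ℝ) < n := by exact_mod_cast Nat.pos_of_ne_zero hn
  conv_lhs => rw [← Real.rpow_logb (by linarith) h1.ne' hn']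
  rw [← mul_neg, Real.rpow_mul h.pos.le, Real.rpow_ofNat, h.pow_eq, one_div,
    Real.inv_rpow hp.le, Real.rpow_neg hp.le]

lemma Regime.rpow_neg_eq (h : Regime d p z) (hn : n ≠ 0) :
    (n : ℝ) ^ (-k) = z ^ (50 * k * Real.logb (1 / p) n) := by
  conv_lhs => rw [h.natCast_eq hn]
  rw [← Real.rpow_mul h.pos.le]
  congr 1
  ring

lemma Regime.rpow_le_half (h : Regime d p z) (hn : n ≠ 0) {x : ℝ}
    (hx : 50 * k * Real.logb (1 / p) n + 1 ≤ x) : z ^ x ≤ (n : ℝ) ^ (-k) / 2 := by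
  rw [h.rpow_neg_eq hn]
  refine (Real.rpow_le_rpow_of_exponent_ge h.pos h.le_one hx).trans ?_
  rw [Real.rpow_add h.pos, Real.rpow_one, div_eq_mul_one_div]
  exact mul_le_mul_of_nonneg_left (h.small.trans (by norm_num)) (Real.rpow_nonneg h.pos.le _)

lemma Regime.mul_pow_le_half (h : Regime d p z) (hn : n ≠ 0)
    (hM : 50 * (k + 1) * Real.logb (1 / p) n ≤ M) : n * z ^ (M + 1) ≤ (n : ℝ) ^ (-k) / 2 := by
  conv_lhs => rw [h.natCast_eq hn]
  rw [← Real.rpow_natCast z, ← Real.rpow_add h.pos]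
  refine h.rpow_le_half hn ?_
  push_cast
  linarith

lemma log_le (hA : 1 ≤ A) (hM : 1 ≤ M) (hMN : (M : ℝ) ≤ A * max 1 N) :
    (Nat.log 2 M : ℝ) ≤ 2 * Real.log A + 2 * Real.log (max 1 N) := by
  have hK : (0 : ℝ) < max 1 N := lt_max_of_lt_left one_pos
  have hM' : (1 : ℝ) ≤ M := by exact_mod_cast hM
  have h0 := Real.log_nonneg hM'
  have h1 := Real.log_le_log (by linarith) hMN
  rw [Real.log_mul (by linarith) hK.ne'] at h1
  have h2 := Real.natLog_le_logb M 2
  have h3 : Real.logb 2 M ≤ 2 * Real.log M := by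
    rw [Real.logb, div_le_iff₀ (Real.log_pos one_lt_two)]
    have := Real.log_two_gt_d9
    nlinarith
  have h4 : (Nat.log 2 M : ℝ) ≤ Real.logb 2 M := by exact_mod_cast h2
  linarith

lemma log_max_le : Real.log (max 1 N) ≤ max 1 (Real.log N) := by
  rcases le_total N 1 with h | h
  · rw [max_eq_left h, Real.log_one]
    exact zero_le_one.trans (le_max_left _ _)
  · rw [max_eq_right h]
    exact le_max_right _ _

lemma early_le (hA : 1 ≤ A) (hM : 1 ≤ M) (hMN : (M : ℝ) ≤ A * max 1 N) :
    ((schedule M).early : ℝ) ≤ (792 + 240 * Real.log A) * max 1 (Real.log N) := by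
  have h1 := log_le hA hM hMN
  have h2 := log_max_le (N := N)
  have h3 : (1 : ℝ) ≤ max 1 (Real.log N) := le_max_left _ _
  have h4 := Real.log_nonneg hA
  have h5 : ((schedule M).early : ℝ) = 8 * (67 + 15 * Nat.log 2 M) + 16 := by
    simp [schedule]
  rw [h5]
  nlinarith

lemma exists_threshold (A k : ℝ) : ∃ N₀ : ℝ, 1 ≤ N₀ ∧ ∀ N, N₀ ≤ N →
    104 * A * k * N ^ 2 ≤ 2 ^ N ∧ 2189 + 960 * Real.log A + 960 * Real.log N ≤ 9 * N := by
  have h1 : ∀ᶠ N in Filter.atTop, 104 * A * k * N ^ 2 ≤ (2 : ℝ) ^ N := by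
    have h2 := (isLittleO_rpow_exp_pos_mul_atTop 2 (Real.log_pos one_lt_two)).def
      (c := 1 / (|104 * A * k| + 1)) (by positivity)
    filter_upwards [h2, Filter.eventually_ge_atTop 0] with N hN hN0
    rw [Real.norm_of_nonneg (by positivity), Real.norm_of_nonneg (by positivity),
      Real.rpow_ofNat, one_div, inv_mul_eq_div, le_div_iff₀ (by positivity)] at hN
    rw [Real.rpow_def_of_pos two_pos]
    nlinarith [le_abs_self (104 * A * k), sq_nonneg N]
  have h2 : ∀ᶠ N in Filter.atTop, 2189 + 960 * Real.log A + 960 * Real.log N ≤ 9 * N := by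
    have h3 := Real.isLittleO_log_id_atTop.def (c := 1 / 960) (by positivity)
    filter_upwards [h3, Filter.eventually_ge_atTop 0,
      Filter.eventually_ge_atTop ((2189 + 960 * Real.log A) / 8)] with N hN hN0 hN1
    rw [id, Real.norm_of_nonneg hN0] at hN
    have := le_abs_self (Real.log N)
    rw [Real.norm_eq_abs] at hN
    rw [div_le_iff₀ (by norm_num)] at hN1
    linarith
  obtain ⟨N₀, hN₀⟩ := Filter.eventually_atTop.1 (h1.and h2)
  exact ⟨max 1 N₀, le_max_left _ _, fun N hN => hN₀ N ((le_max_right _ _).trans hN)⟩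

lemma card_bound_le (hd : 2 ≤ d) (s : ℕ) :
    (d + 1) ^ (16 * s + 22) + 1 ≤ d ^ (32 * s + 45) := by
  have h1 : (d + 1) ^ (16 * s + 22) ≤ d ^ (32 * s + 44) := by
    calc (d + 1) ^ (16 * s + 22) ≤ (d ^ 2) ^ (16 * s + 22) :=
          Nat.pow_le_pow_left (by nlinarith) _
      _ = d ^ (32 * s + 44) := by rw [← pow_mul]; congr 1; ring
  have h2 : 1 ≤ d ^ (32 * s + 44) := Nat.one_le_pow _ _ (by omega)
  calc (d + 1) ^ (16 * s + 22) + 1 ≤ d ^ (32 * s + 44) * 2 := by omega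
    _ ≤ d ^ (32 * s + 44) * d := Nat.mul_le_mul_left _ hd
    _ = d ^ (32 * s + 45) := (pow_succ _ _).symm

/-- From d ≤ z^(-5) follows d^(10N) ≤ n. Of this budget d^N covers 2Mj = O(N^2), and d^(9N) covers
the dependency bound, whose exponent is only logarithmic in N. -/
lemma Regime.conflicts_le (h : Regime d p z) (hn : n ≠ 0) (hN1 : 1 ≤ N)
    (hN : N = Real.logb (1 / p) n) (hA : 1 ≤ A) (hM : 1 ≤ M)
    (hMN : (M : ℝ) ≤ A * max 1 N) (hj : (j : ℝ) ≤ 52 * k * N)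
    (h1 : 104 * A * k * N ^ 2 ≤ 2 ^ N)
    (h2 : 2189 + 960 * Real.log A + 960 * Real.log N ≤ 9 * N) :
    2 * M * (j * d ^ (32 * (schedule M).s + 45)) ≤ n := by
  have hd := h.d_pos
  have hlog := log_le hA hM hMN
  rw [max_eq_right hN1] at hMN hlog
  have hexp : ((32 * (schedule M).s + 45 : ℕ) : ℝ) ≤ 9 * N := by
    have : ((32 * (schedule M).s + 45 : ℕ) : ℝ) = 2189 + 480 * Nat.log 2 M := by
      simp only [schedule]; push_cast; ring
    rw [this]
    linarith
  have hD : (d : ℝ) ^ (32 * (schedule M).s + 45) ≤ d ^ (9 * N) := by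
    rw [← Real.rpow_natCast]
    exact Real.rpow_le_rpow_of_exponent_le (by linarith) hexp
  have h2N : (2 : ℝ) ^ N ≤ d ^ N := Real.rpow_le_rpow (by norm_num) hd (by linarith)
  have hMj : 2 * (M : ℝ) * j ≤ d ^ N := by
    calc 2 * (M : ℝ) * j ≤ 2 * (A * N) * (52 * k * N) := by gcongr
      _ = 104 * A * k * N ^ 2 := by ring
      _ ≤ _ := h1.trans h2N
  have hz := h.pos
  have hn10 : (d : ℝ) ^ (10 * N) ≤ n := by
    rw [h.natCast_eq hn, ← hN]
    have h3 : (d : ℝ) ≤ z ^ (-5 : ℝ) := by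
      rw [Real.rpow_neg hz.le, Real.rpow_ofNat, ← one_div, le_div_iff₀ (by positivity)]
      exact h.deg
    calc (d : ℝ) ^ (10 * N) ≤ (z ^ (-5 : ℝ)) ^ (10 * N) :=
          Real.rpow_le_rpow (by linarith) h3 (by linarith)
      _ = z ^ (-(50 * N)) := by rw [← Real.rpow_mul hz.le]; congr 1; ring
  have : (2 * M * (j * d ^ (32 * (schedule M).s + 45)) : ℝ) ≤ n := by
    calc (2 * M * (j * d ^ (32 * (schedule M).s + 45)) : ℝ)
        = 2 * (M : ℝ) * j * d ^ (32 * (schedule M).s + 45) := by ring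
      _ ≤ d ^ N * d ^ (9 * N) := by gcongr
      _ = d ^ (10 * N) := by rw [← Real.rpow_add (by linarith)]; congr 1; ring
      _ ≤ n := hn10
  exact_mod_cast this

end Numerics

/-! ### Assembling the round bounds. -/

section Main

variable {V : Type} [Fintype V] {L : LLLInstance V} {d M j : ℕ} {p z : ℝ}
  {c : Params} {q : Schedule} {P : PortNumbering L.dependencyGraph} {seed : V → Seed}

lemma rounds_le_late (v : V) :
    ((algorithm c q).rounds P L.spec seed v : ℝ≥0∞) ≤ q.late := by
  have h1 : (algorithm c q).rounds P L.spec seed v ≤ (q.late : ℕ∞) :=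
    rounds_le_stopTime.trans (Nat.cast_le.2 stopTime_le_late)
  simpa using ENat.toENNReal_mono h1

lemma averageRounds_le_late : (algorithm c q).averageRounds P L.spec seed ≤ q.late := by
  refine ENNReal.div_le_of_le_mul ((Finset.sum_le_card_nsmul _ _ _
    fun v _ => rounds_le_late v).trans_eq ?_)
  rw [nsmul_eq_mul, Finset.card_univ, mul_comm]

lemma averageRounds_le_of_lt [Nonempty V] (h : Regime d p z) (hL : L.Bounded p d) (hM : 1 ≤ M)
    (hu : occurring (waitingSet h.params (schedule M).s L) (worldOf L seed).val ≤
      (Fintype.card V / M : ℝ≥0∞)) :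
    (algorithm h.params (schedule M)).averageRounds P L.spec seed ≤ (schedule M).early + 723 := by
  refine (averageRounds_le (c := h.params) hL rfl schedule_growth le_rfl P seed).trans ?_
  refine add_le_add_right ?_ _
  have hM0 : (M : ℝ≥0∞) ≠ 0 := by simp; omega
  have hn0 : (Fintype.card V : ℝ≥0∞) ≠ 0 := by simp
  calc ((schedule M).late : ℝ≥0∞) *
        (occurring (waitingSet h.params (schedule M).s L) (worldOf L seed).val / Fintype.card V)
      ≤ (723 * M : ℝ≥0∞) * ((Fintype.card V / M : ℝ≥0∞) / Fintype.card V) := by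
        gcongr
        exact_mod_cast late_le hM
    _ = 723 := by
        rw [ENNReal.div_right_comm, ENNReal.div_self hn0 (ENNReal.natCast_ne_top _), mul_assoc,
          ENNReal.mul_div_cancel hM0 (ENNReal.natCast_ne_top _), mul_one]

/-- The run is good with high probability if the number of waiting nodes is concentrated. -/
lemma seedMeasure_failure_le [Nonempty V] (h : Regime d p z) (hL : L.Bounded p d) (hM : 1 ≤ M)
    (P : PortNumbering L.dependencyGraph) {D : ℕ}
    (hD : (d + 1) ^ (16 * (schedule M).s + 22) + 1 ≤ D)
    (hj : 2 * M * (j * D) ≤ Fintype.card V) :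
    seedMeasure V {seed | ¬ (L.SolvedBy (algorithm h.params (schedule M)) P seed ∧
      (algorithm h.params (schedule M)).averageRounds P L.spec seed ≤
        (schedule M).early + 723)} ≤
    ENNReal.ofReal (Fintype.card V * z ^ (M + 1)) + ENNReal.ofReal (z ^ j) := by
  set E : Set Assignment := {u | (Fintype.card V / M : ℝ≥0∞) ≤
    occurring (waitingSet h.params (schedule M).s L) u} with hE
  have hEm : MeasurableSet E := measurableSet_le measurable_const
    (measurable_occurring fun v => measurableSet_waitingSet (valid_baseWorld hL rfl))
  refine (measure_mono (t := {seed | ¬ (worldOf L seed).Good h.params M} ∪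
    {seed | (worldOf L seed).val ∈ E}) fun seed hs => ?_).trans ((measure_union_le _ _).trans
      (add_le_add (seedMeasure_not_good_le h hL) ?_))
  · by_contra hns
    rw [Set.mem_union, not_or] at hns
    obtain ⟨h1, h2⟩ := hns
    refine hs ⟨solvedBy_of_good (not_not.1 h1), averageRounds_le_of_lt h hL hM ?_⟩
    exact (not_le.1 h2).le
  · rw [seedMeasure_preimage hEm]
    exact unif_occurring_le h hL hM hD hj

lemma seedMeasure_failure_le' [Nonempty V] (h : Regime d p z) (hL : L.Bounded p d)
    (P : PortNumbering L.dependencyGraph) :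
    seedMeasure V {seed | ¬ (L.SolvedBy (algorithm h.params (schedule M)) P seed ∧
      (algorithm h.params (schedule M)).averageRounds P L.spec seed ≤ (schedule M).late)} ≤
    ENNReal.ofReal (Fintype.card V * z ^ (M + 1)) := by
  refine (measure_mono fun seed hs => ?_).trans (seedMeasure_not_good_le h hL)
  intro h1
  exact hs ⟨solvedBy_of_good h1, averageRounds_le_late⟩

/-- The expected average number of rounds. -/
lemma exists_measurable_bound [Nonempty V] (h : Regime d p z) (hL : L.Bounded p d) (hM : 1 ≤ M)
    (P : PortNumbering L.dependencyGraph) :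
    ∃ g : (V → Seed) → ℝ≥0∞, Measurable g ∧
      (∀ seed, (algorithm h.params (schedule M)).averageRounds P L.spec seed ≤ g seed) ∧
      ∫⁻ seed, g seed ∂(seedMeasure V) ≤ (schedule M).early + 723 := by
  have hW : (baseWorld L).Valid h.params := valid_baseWorld hL rfl
  have hZm : ∀ v, MeasurableSet (waitingSet h.params (schedule M).s L v) :=
    fun v => measurableSet_waitingSet hW
  have hocc := measurable_occurring hZm
  have hn0 : (Fintype.card V : ℝ≥0∞) ≠ 0 := by simp
  -- The number of rounds depends on a quantification over all worlds, so it is dominated by a count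
  -- of cascades, which is measurable.
  let G : Assignment → ℝ≥0∞ := fun u => (schedule M).early + (schedule M).late *
    (occurring (waitingSet h.params (schedule M).s L) u / Fintype.card V)
  have hG : Measurable G := ((hocc.div_const _).const_mul _).const_add _
  refine ⟨fun seed => G (worldOf L seed).val, hG.comp measurable_worldOf,
    averageRounds_le (c := h.params) hL rfl schedule_growth le_rfl P, ?_⟩
  rw [← lintegral_map hG measurable_worldOf, map_worldOf]
  have hint : ∫⁻ u, occurring (waitingSet h.params (schedule M).s L) u ∂unif ≤
      Fintype.card V * ENNReal.ofReal ((d + 1) ^ 10 * z ^ (schedule M).s) := by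
    unfold occurring
    rw [lintegral_finsetSum _ fun v _ => measurable_one.indicator (hZm v)]
    refine (Finset.sum_le_card_nsmul _ _ (ENNReal.ofReal ((d + 1) ^ 10 * z ^ (schedule M).s))
      fun v _ => ?_).trans_eq ?_
    · rw [lintegral_indicator_one (hZm v)]
      exact unif_waitingSet_schedule_le h hL v
    · rw [nsmul_eq_mul, Finset.card_univ]
  simp only [G]
  rw [lintegral_add_left measurable_const, lintegral_const, measure_univ, mul_one,
    lintegral_const_mul _ (hocc.div_const _)]
  refine add_le_add_right ?_ _
  simp only [div_eq_mul_inv]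
  rw [lintegral_mul_const _ hocc]
  calc ((schedule M).late : ℝ≥0∞) *
        ((∫⁻ u, occurring (waitingSet h.params (schedule M).s L) u ∂unif) *
          (Fintype.card V : ℝ≥0∞)⁻¹)
      ≤ (723 * M : ℝ≥0∞) * ((Fintype.card V *
          ENNReal.ofReal ((d + 1) ^ 10 * z ^ (schedule M).s)) * (Fintype.card V : ℝ≥0∞)⁻¹) := by
        gcongr
        exact_mod_cast late_le hM
    _ = 723 * (M * ENNReal.ofReal ((d + 1) ^ 10 * z ^ (schedule M).s)) := by
        rw [mul_right_comm (Fintype.card V : ℝ≥0∞),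
          ENNReal.mul_inv_cancel hn0 (ENNReal.natCast_ne_top _), one_mul, mul_assoc]
    _ ≤ 723 * 1 := by
        gcongr
        rw [← ENNReal.ofReal_natCast, ← ENNReal.ofReal_mul (by positivity),
          ENNReal.ofReal_le_one]
        exact (mul_unif_le h).trans (by linarith [h.le_one])
    _ = 723 := mul_one _

end Main
end LLLProof

open LLLProof in
theorem theorem2 :
    ∀ δ : ℝ, 0 < δ → ∃ d₀ : ℕ, ∀ k : ℝ, 1 ≤ k → ∃ C : ℝ,
      ∀ (n d : ℕ) (p : ℝ), d₀ ≤ d → 0 < p → p < 1 → p ≤ (d : ℝ) ^ (-(10 + δ)) →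
        ∃ A : LocalAlgorithm EventSpec Seed (ℕ → ℝ),
          ∀ (V : Type) [Fintype V], Fintype.card V = n →
          ∀ L : LLLInstance V, L.Bounded p d →
          ∀ P : PortNumbering L.dependencyGraph,
            -- every node always terminates within `O(log_{1/p} n)` rounds
            (∀ (seed : V → Seed) (v : V), (A.rounds P L.spec seed v : ℝ≥0∞) ≤
              ENNReal.ofReal (C * max 1 (Real.logb (1 / p) n))) ∧
            -- with high probability the output is correct and the node average is small
            seedMeasure V {seed | ¬ (L.SolvedBy A P seed ∧
                A.averageRounds P L.spec seed ≤
                  ENNReal.ofReal (C * max 1 (Real.log (Real.logb (1 / p) n))))} ≤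
              ENNReal.ofReal ((n : ℝ) ^ (-k)) ∧
            -- the expected node average is small (stated through a measurable upper bound)
            ∃ g : (V → Seed) → ℝ≥0∞, Measurable g ∧
              (∀ seed, A.averageRounds P L.spec seed ≤ g seed) ∧
              ∫⁻ seed, g seed ∂(seedMeasure V) ≤
                ENNReal.ofReal (C * max 1 (Real.log (Real.logb (1 / p) n))) := by
  intro δ hδ
  refine ⟨25600 ^ 5, fun k hk => ?_⟩
  -- 51 instead of 50 absorbs the rounding in `M`.
  obtain ⟨A, hA⟩ : ∃ A, A = 51 * (k + 1) := ⟨_, rfl⟩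
  have hA1 : 1 ≤ A := by linarith
  obtain ⟨N₀, hN₀, hN₀'⟩ := exists_threshold A k
  -- The first term serves the worst case, also as node average when `N < N₀`; the others bound the
  -- early stopping time and the 723 rounds contributed by waiting nodes.
  obtain ⟨C, hC⟩ : ∃ C, C = 723 * A * N₀ + (792 + 240 * Real.log A) + 723 := ⟨_, rfl⟩
  have hlogA := Real.log_nonneg hA1
  refine ⟨C, fun n d p hd hp _ hpd => ?_⟩
  obtain ⟨z, h⟩ := exists_regime hδ hd hp hpd
  set N := Real.logb (1 / p) n with hN
  have hK1 : 1 ≤ max 1 N := le_max_left _ _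
  have hΛ1 : 1 ≤ max 1 (Real.log N) := le_max_left _ _
  obtain ⟨M, hM⟩ : ∃ M, M = ⌈50 * (k + 1) * max 1 N⌉₊ := ⟨_, rfl⟩
  have hM1 : 1 ≤ M := by
    rw [hM, Nat.one_le_ceil_iff]
    positivity
  have hMge : 50 * (k + 1) * max 1 N ≤ M := hM ▸ Nat.le_ceil _
  have hMle : (M : ℝ) ≤ A * max 1 N := by
    have := (Nat.ceil_lt_add_one (show 0 ≤ 50 * (k + 1) * max 1 N by positivity)).le
    rw [← hM] at this
    nlinarith
  have hlate : ((schedule M).late : ℝ) ≤ 723 * (A * max 1 N) := by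
    have : ((schedule M).late : ℝ) ≤ 723 * M := by exact_mod_cast late_le hM1
    linarith
  have hlate' : ((schedule M).late : ℝ≥0∞) ≤ ENNReal.ofReal (C * max 1 N) := by
    rw [← ENNReal.ofReal_natCast]
    refine ENNReal.ofReal_le_ofReal (hlate.trans ?_)
    rw [← mul_assoc]
    refine mul_le_mul_of_nonneg_right ?_ (by linarith)
    nlinarith
  have hearly : ((schedule M).early : ℝ≥0∞) + 723 ≤
      ENNReal.ofReal (C * max 1 (Real.log N)) := by
    rw [← ENNReal.ofReal_natCast, ← ENNReal.ofReal_ofNat, ← ENNReal.ofReal_add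
      (Nat.cast_nonneg _) (by norm_num)]
    refine ENNReal.ofReal_le_ofReal ?_
    have h1 := early_le hA1 hM1 hMle
    have h2 : 0 ≤ 723 * A * N₀ := by positivity
    rw [hC]
    nlinarith
  refine ⟨algorithm h.params (schedule M), fun V _ hV L hL P =>
    ⟨fun seed v => (rounds_le_late v).trans hlate', ?_⟩⟩
  rcases isEmpty_or_nonempty V with hVe | hVe
  · have havg : ∀ seed, (algorithm h.params (schedule M)).averageRounds P L.spec seed = 0 := by
      intro seed
      simp [LocalAlgorithm.averageRounds]
    refine ⟨?_, fun _ => 0, measurable_const, fun seed => (havg seed).le, by simp⟩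
    have : {seed | ¬ (L.SolvedBy (algorithm h.params (schedule M)) P seed ∧
        (algorithm h.params (schedule M)).averageRounds P L.spec seed ≤
          ENNReal.ofReal (C * max 1 (Real.log N)))} = ∅ := by
      refine Set.eq_empty_of_forall_notMem fun seed hs => hs ⟨⟨fun _ => 0, isEmptyElim⟩, ?_⟩
      rw [havg]
      exact zero_le
    rw [this, measure_empty]
    exact zero_le
  have hn : n ≠ 0 := by rw [← hV]; exact Fintype.card_ne_zero
  have hk0 : 0 ≤ 50 * (k + 1) := by linarith
  have hfail : (n : ℝ) * z ^ (M + 1) ≤ (n : ℝ) ^ (-k) / 2 := h.mul_pow_le_half hn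
    ((mul_le_mul_of_nonneg_left (le_max_right _ _) hk0).trans hMge)
  have hpow0 : 0 ≤ (n : ℝ) ^ (-k) := by positivity
  refine ⟨?_, ?_⟩
  -- For small `N` concentration is not available, but then the worst-case bound is a constant.
  · by_cases hNN : N₀ ≤ N
    · have hN1 : 1 ≤ N := hN₀.trans hNN
      have hkN : 1 ≤ k * N := one_le_mul_of_one_le_of_one_le hk hN1
      obtain ⟨h1, h2⟩ := hN₀' N hNN
      -- As n = z^(-50N), this moment makes `z ^ j` at most half of n^(-k).
      obtain ⟨j, hj⟩ : ∃ j, j = ⌈50 * k * N⌉₊ + 1 := ⟨_, rfl⟩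
      have hjge : 50 * k * N + 1 ≤ (j : ℝ) := by
        rw [hj]; push_cast; linarith [Nat.le_ceil (50 * k * N)]
      have hjle : (j : ℝ) ≤ 52 * k * N := by
        have := (Nat.ceil_lt_add_one (show 0 ≤ 50 * k * N by positivity)).le
        rw [hj]; push_cast; nlinarith
      have h3 := h.conflicts_le hn hN1 hN hA1 hM1 hMle hjle h1 h2
      rw [← hV] at h3
      refine (measure_mono fun seed hs => ?_).trans ((seedMeasure_failure_le h hL hM1 P
        (card_bound_le h.two_le _) h3).trans ?_)
      · exact fun hs' => hs ⟨hs'.1, hs'.2.trans hearly⟩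
      · have h4 : z ^ j ≤ (n : ℝ) ^ (-k) / 2 := by
          rw [← Real.rpow_natCast]
          exact h.rpow_le_half hn hjge
        rw [hV]
        calc _ ≤ ENNReal.ofReal ((n : ℝ) ^ (-k) / 2) + ENNReal.ofReal ((n : ℝ) ^ (-k) / 2) :=
              add_le_add (ENNReal.ofReal_le_ofReal hfail) (ENNReal.ofReal_le_ofReal h4)
          _ = _ := by rw [← ENNReal.ofReal_add (by positivity) (by positivity), add_halves]
    · refine (measure_mono fun seed hs => ?_).trans ((seedMeasure_failure_le' (M := M) h hL
        P).trans (ENNReal.ofReal_le_ofReal ?_))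
      · refine fun hs' => hs ⟨hs'.1, hs'.2.trans ?_⟩
        rw [← ENNReal.ofReal_natCast]
        refine ENNReal.ofReal_le_ofReal (hlate.trans ?_)
        have h1 : max 1 N ≤ N₀ := max_le hN₀ (not_le.1 hNN).le
        have h2 : 723 * (A * max 1 N) ≤ 723 * A * N₀ := by
          rw [← mul_assoc]; exact mul_le_mul_of_nonneg_left h1 (by linarith)
        have h3 : 723 * A * N₀ ≤ C := by linarith
        have h4 : 0 ≤ C := le_trans (by positivity) h3
        nlinarith
      · rw [hV]
        linarith
  · obtain ⟨g, hg, hg1, hg2⟩ := exists_measurable_bound h hL hM1 P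
    exact ⟨g, hg, hg1, hg2.trans hearly⟩
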